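/- Let $k\ge 1$ be an integer and let $X=X^0\supset X^1\supset X^2\supset\cdots$ be a scale of real Banach spaces (for instance Hilbert spaces), each continuously and densely embedded in the preceding one, such that the embeddings $X^{r}\subset X^{r-1}$, $1\le r\le k$, have norms at most $C_E$ (e.g. $C_E=1$). For $\delta,R>0$ write $X^{r}(u,\delta)$ for the open ball of $X^r$ centred at $u$ with radius $\delta$, and $X^r(R)=X^r(0,R)$; $\mathbb L(Y,Z)$ denotes the bounded linear operators and $\mathbf D$ the Fréchet derivative. Consider $$v_t=\mathbf A(v)v+f(v),\qquad v(0)=v_0. \tag{1}$$ Let $\omega\in\mathbb R$, $C_L,C_Q\ge1$, $C_0,\delta_0,C_{f,0},C_{f,1}>0$, $v_*\in X^k$, $R_0>C_L^2C_Q^{2k}|v_*|_{X^k}$, write $\mathcal V=X^{k-1}(v_*,\delta_0)$, let $\mathbf L\in C^1(\mathcal V,\mathbb L(X,X^*))$ and $\mathbf Q\in C^1(\mathcal V,\mathbb L(X^1,X))$, and assume: (H.1) For all $v\in\mathcal V$, $w\in X$: $\mathbf L(v)=\mathbf L(v)^*$ and $C_L^{-1}|w|_X\le\langle \mathbf L(v)w,w\rangle^{1/2}\le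 C_L|w|_X$; and $|\mathbf D\mathbf L(v)|_{\mathbb L(X^{k-1},\mathbb L(X,X^*))}\le C_0$. (H.2) For every $v\in\mathcal V$, $\mathbf A(v)$ is a closed linear operator in $X$ whose domain contains $X^1$ and which is the closure of its restriction to $X^1$, and $\lambda-\mathbf A(v):Dom(\mathbf A(v))\to X$ is surjective for some $\lambda>\omega$. For $1\le r\le k$, $\mathbf A(v)$ restricts to an element of $\mathbb L(X^r,X^{r-1})$ whose norm is at most $C_0$ and which is Lipschitz in $v\in\mathcal V$ (in the $X^{k-1}$ norm) with constant $C_0$. Moreover $\langle \mathbf L(v)w,\mathbf A(v)w\rangle\le\omega\langle \mathbf L(v)w,w\rangle$ for all $w\in X^1$. (H.3) For every $v\in\mathcal V$ and $1\le r\le k$, $\mathbf Q(v)$ restricts to an isomorphism of $X^r$ onto $X^{r-1}$; as a map into $\mathbb L(X^r,X^{r-1})$ it is $C^1$ in $v$, with $|\mathbf Q(v)|_{\mathbb L(X^r,X^{r-1})},\,|\mathbf Q(v)^{-1}|_{\mathbb L(X^{r-1},X^r)}\le C_Q$ and $|\mathbf D\mathbf Q(v)|_{\mathbb L(X^{k-1},\mathbb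 L(X^{r},X^{r-1}))},\,|\mathbf D\mathbf Q^{-1}(v)|_{\mathbb L(X^{k-1},\mathbb L(X^{r-1},X^{r}))}\le C_0$. The commutator $[\mathbf Q(v),\mathbf A(v)]$ belongs to $\mathbb L(X^r,X^{r-1})$, is continuous in $v$ and has norm at most $C_0$; that is, there is $B_r\in C^0(\mathcal V,\mathbb L(X^r,X^{r-1}))$ with $|B_r(v)|\le C_0$ such that, whenever $w\in X^r$ and $\mathbf Q(v)w\in X^r$, also $\mathbf A(v)w\in X^r$ and $\mathbf Q(v)\mathbf A(v)w-\mathbf A(v)\mathbf Q(v)w=B_r(v)w$. (H.4) On $\mathcal V\cap X^k(R_0)$, $f$ is continuous into $X^k$ (for the $X^k$ topology) with $|f(v)|_{X^k}\le C_{f,0}$, and $|f(v_1)-f(v_2)|_{X^{k-1}}\le C_{f,1}|v_1-v_2|_{X^{k-1}}$. Then for any $\delta\in(0,\delta_0)$ and $R\in(|v_*|_{X^k},\,C_L^{-2}C_Q^{-2k}R_0)$ there is $T>0$, determined only by $k$, $\delta$, $R$, $R_0$ and the constants $\omega,C_L,C_Q,C_0,\delta_0,C_{f,0},C_{f,1},C_E$,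 such that for every $v_0\in X^{k-1}(v_*,\delta)\cap X^k(R)$, problem (1) has a unique solution $v$ on $[0,T]$ in the class $$v\in C^0([0,T],X^k)\cap C^1([0,T],X^{k-1}),\qquad v(t)\in X^{k-1}(v_*,\delta_0)\cap X^k(R_0)\ \text{ for all } t\in[0,T].$$ Moreover, if $v_1$, $v_2$ are such solutions with initial values $v_{01},v_{02}\in X^{k-1}(v_*,\delta)\cap X^k(R)$, then $$\sup_{t\in[0,T]}|v_2(t)-v_1(t)|_{X^{k-1}}\le 4C_L^2C_Q^{2(k-1)}\,|v_{02}-v_{01}|_{X^{k-1}}.$$ -/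

import Mathlib

set_option maxSynthPendingDepth 3

open Set Metric

universe u

/-- A scale `X 0 ⊇ X 1 ⊇ X 2 ⊇ ⋯` of real normed spaces: each space is continuously and densely
embedded in the previous one, `incl r` being the embedding of `X (r + 1)` in `X r`. -/
structure DenseScale (X : ℕ → Type u) [∀ r, NormedAddCommGroup (X r)]
    [∀ r, NormedSpace ℝ (X r)] where
  incl : ∀ r, X (r + 1) →L[ℝ] X r
  injective : ∀ r, Function.Injective (incl r)
  denseRange : ∀ r, DenseRange (incl r)

namespace DenseScale

variable {X : ℕ → Type u} [∀ r, NormedAddCommGroup (X r)] [∀ r, NormedSpace ℝ (X r)]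

/-- The embedding of `X r` in the base space `X 0`. -/
def toBase (S : DenseScale X) : ∀ r, X r →L[ℝ] X 0
  | 0 => ContinuousLinearMap.id ℝ (X 0)
  | r + 1 => (toBase S r).comp (S.incl r)

end DenseScale

/-- The constants in the assumptions on the quasilinear equation. `CE` bounds the norms of the
embeddings of the scale (`CE = 1` for the usual normalization `|w|_{X^{r-1}} ≤ |w|_{X^r}`). -/
structure QLConst where
  ω : ℝ
  CL : ℝ
  CQ : ℝ
  C0 : ℝ
  δ0 : ℝ
  Cf0 : ℝ
  Cf1 : ℝ
  R0 : ℝ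
  CE : ℝ
  one_le_CL : 1 ≤ CL
  one_le_CQ : 1 ≤ CQ
  C0_pos : 0 < C0
  δ0_pos : 0 < δ0
  Cf0_pos : 0 < Cf0
  Cf1_pos : 0 < Cf1

/-- The objects in the equation `v_t = A(v) v + f(v)` and in the assumptions on it. The regularity
index is `k = m + 1`, so that `X^{k-1}` is `X m` and `X^k` is `X (m + 1)`. All maps are total; only
their values at the points of the ball, respectively of the domain, below are ever used. -/
structure QLData (X : ℕ → Type u) [∀ r, NormedAddCommGroup (X r)]
    [∀ r, NormedSpace ℝ (X r)] (m : ℕ) where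
  /-- The centre `v_* ∈ X^k`. -/
  vs : X (m + 1)
  /-- The unbounded operator `A(v)` in `X`, with its domain. -/
  A : X m → (X 0 →ₗ.[ℝ] X 0)
  /-- The operator `A(v)` as an element of `𝕃(X^{r+1}, X^r)`. -/
  Ab : ∀ r, X m → (X (r + 1) →L[ℝ] X r)
  /-- The bounded operator `L(v) : X → X^*`; the pairing `⟨L(v) w, z⟩` is `L v w z`. -/
  L : X m → (X 0 →L[ℝ] (X 0 →L[ℝ] ℝ))
  /-- The operator `Q(v)` as an element of `𝕃(X^{r+1}, X^r)`. -/
  Q : ∀ r, X m → (X (r + 1) →L[ℝ] X r)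
  /-- The lower order nonlinearity. -/
  f : X (m + 1) → X (m + 1)

namespace QLData

variable {X : ℕ → Type u} [∀ r, NormedAddCommGroup (X r)] [∀ r, NormedSpace ℝ (X r)] {m : ℕ}

/-- The open ball `X^{k-1}(v_*, δ)`. -/
def ballLow (D : QLData X m) (S : DenseScale X) (δ : ℝ) : Set (X m) :=
  ball (S.incl m D.vs) δ

/-- The set `X^{k-1}(v_*, δ) ∩ X^k(R)`, as a subset of `X^k`. -/
def dom (D : QLData X m) (S : DenseScale X) (δ R : ℝ) : Set (X (m + 1)) :=
  {v | S.incl m v ∈ D.ballLow S δ ∧ v ∈ ball (0 : X (m + 1)) R}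

/-- `B` is the commutator `[Q(v), A(v)]` as a bounded operator from `X^{r+1}` to `X^r`: for every
`w ∈ X^{r+1}` with `z = Q(v) w ∈ X^{r+1}` also `y = A(v) w` lies in `X^{r+1}`, and
`Q(v) A(v) w - A(v) Q(v) w = B w`. If `Q(v)` is an isomorphism from `X^{r+1}` to `X^r`, such `w`
are dense in `X^{r+1}`; if it is one also from `X^{r+2}` to `X^{r+1}`, they are the elements of
`X^{r+2}`. -/
def IsCommutator (D : QLData X m) (S : DenseScale X) (r : ℕ) (v : X m)
    (B : X (r + 1) →L[ℝ] X r) : Prop :=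
  ∀ w z : X (r + 1), S.incl r z = D.Q r v w →
    ∃ y : X (r + 1), S.incl r y = D.Ab r v w ∧ D.Q r v y - D.Ab r v z = B w

/-- (H.1) -/
structure H1 (D : QLData X m) (S : DenseScale X) (c : QLConst) : Prop where
  contDiffOn : ContDiffOn ℝ 1 D.L (D.ballLow S c.δ0)
  symm : ∀ v ∈ D.ballLow S c.δ0, ∀ w z, D.L v w z = D.L v z w
  lower : ∀ v ∈ D.ballLow S c.δ0, ∀ w, c.CL⁻¹ * ‖w‖ ≤ √(D.L v w w)
  upper : ∀ v ∈ D.ballLow S c.δ0, ∀ w, √(D.L v w w) ≤ c.CL * ‖w‖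
  fderiv_le : ∀ v ∈ D.ballLow S c.δ0, ‖fderiv ℝ D.L v‖ ≤ c.C0

/-- (H.2) -/
structure H2 (D : QLData X m) (S : DenseScale X) (c : QLConst) : Prop where
  /-- `A(v)` is a closed operator, -/
  isClosed : ∀ v ∈ D.ballLow S c.δ0, (D.A v).IsClosed
  /-- its domain contains `X^1`, and it is the closure of its restriction to `X^1`. -/
  hasCore : ∀ v ∈ D.ballLow S c.δ0,
    (D.A v).HasCore (LinearMap.range (S.incl 0 : X 1 →ₗ[ℝ] X 0))
  surjective : ∀ v ∈ D.ballLow S c.δ0, ∃ l : ℝ, c.ω < l ∧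
    ∀ y : X 0, ∃ x : (D.A v).domain, l • (x : X 0) - D.A v x = y
  /-- For `1 ≤ r + 1 ≤ k`, `A(v)` restricts to the bounded operator `Ab r v` from `X^{r+1}`
  to `X^r`, -/
  restrict : ∀ r ≤ m, ∀ v ∈ D.ballLow S c.δ0, ∀ w : X (r + 1),
    (S.toBase (r + 1) w, S.toBase r (D.Ab r v w)) ∈ (D.A v).graph
  /-- which is bounded and Lipschitz in `v`. -/
  norm_le : ∀ r ≤ m, ∀ v ∈ D.ballLow S c.δ0, ‖D.Ab r v‖ ≤ c.C0
  lipschitz : ∀ r ≤ m, ∀ v ∈ D.ballLow S c.δ0, ∀ v' ∈ D.ballLow S c.δ0,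
    ‖D.Ab r v - D.Ab r v'‖ ≤ c.C0 * ‖v - v'‖
  dissipative : ∀ v ∈ D.ballLow S c.δ0, ∀ w : X 1,
    D.L v (S.incl 0 w) (D.Ab 0 v w) ≤ c.ω * D.L v (S.incl 0 w) (S.incl 0 w)

/-- (H.3) -/
structure H3 (D : QLData X m) (S : DenseScale X) (c : QLConst) : Prop where
  /-- The operators `Q r v` are restrictions of one operator `Q(v) = Q 0 v`. -/
  restrict : ∀ r < m, ∀ v ∈ D.ballLow S c.δ0, ∀ w : X (r + 2),
    S.incl r (D.Q (r + 1) v w) = D.Q r v (S.incl (r + 1) w)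
  isInvertible : ∀ r ≤ m, ∀ v ∈ D.ballLow S c.δ0, (D.Q r v).IsInvertible
  contDiffOn : ∀ r ≤ m, ContDiffOn ℝ 1 (D.Q r) (D.ballLow S c.δ0)
  norm_le : ∀ r ≤ m, ∀ v ∈ D.ballLow S c.δ0, ‖D.Q r v‖ ≤ c.CQ
  norm_inverse_le : ∀ r ≤ m, ∀ v ∈ D.ballLow S c.δ0, ‖(D.Q r v).inverse‖ ≤ c.CQ
  fderiv_le : ∀ r ≤ m, ∀ v ∈ D.ballLow S c.δ0, ‖fderiv ℝ (D.Q r) v‖ ≤ c.C0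
  fderiv_inverse_le : ∀ r ≤ m, ∀ v ∈ D.ballLow S c.δ0,
    ‖fderiv ℝ (fun v' => (D.Q r v').inverse) v‖ ≤ c.C0
  commutator : ∀ r ≤ m, ∃ B : X m → (X (r + 1) →L[ℝ] X r),
    ContinuousOn B (D.ballLow S c.δ0) ∧
    ∀ v ∈ D.ballLow S c.δ0, D.IsCommutator S r v (B v) ∧ ‖B v‖ ≤ c.C0

/-- (H.4) -/
structure H4 (D : QLData X m) (S : DenseScale X) (c : QLConst) : Prop where
  continuousOn : ContinuousOn D.f (D.dom S c.δ0 c.R0)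
  norm_le : ∀ v ∈ D.dom S c.δ0 c.R0, ‖D.f v‖ ≤ c.Cf0
  lipschitz : ∀ v ∈ D.dom S c.δ0 c.R0, ∀ v' ∈ D.dom S c.δ0 c.R0,
    ‖S.incl m (D.f v) - S.incl m (D.f v')‖ ≤ c.Cf1 * ‖S.incl m v - S.incl m v'‖

/-- `v` is a solution of `v_t = A(v) v + f(v)`, `v(0) = v0`, on `[0, T]` with values in
`X^{k-1}(v_*, δ0) ∩ X^k(R0)` and of class `C^0_t X^k ∩ C^1_t X^{k-1}`. -/
structure IsSolution (D : QLData X m) (S : DenseScale X) (c : QLConst) (T : ℝ)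
    (v0 : X (m + 1)) (v : ℝ → X (m + 1)) : Prop where
  mem_dom : ∀ t ∈ Icc 0 T, v t ∈ D.dom S c.δ0 c.R0
  continuousOn : ContinuousOn v (Icc 0 T)
  contDiffOn : ContDiffOn ℝ 1 (fun t => S.incl m (v t)) (Icc 0 T)
  initial : v 0 = v0
  equation : ∀ t ∈ Icc 0 T, HasDerivWithinAt (fun s => S.incl m (v s))
    (D.Ab m (S.incl m (v t)) (v t) + S.incl m (D.f (v t))) (Icc 0 T) t

end QLData

/-! The evolution takes place in the pair Z = X^k ⊂ Y = X^{k-1}. The lower spaces serve to construct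
resolvents. On each X^r with r ≤ k - 1 the inner product ⟨L(v)Q(v)^r ·, Q(v)^r ·⟩ (`form`) is
equivalent to the norm and Lipschitz in v. Since [Q, A] is bounded, A(v) is quasi-dissipative for it
(`dissipative`). The range of 1 - hA(v) is dense in X^0 by a Lumer–Phillips argument, and in X^r by
induction (`denseRange_sub_smul_Ab`). So 1 - hA(v) is invertible in Z, and Q(v) carries this inverse
to the resolvent of Y up to the bounded term hB (`exists_resolvent`).

Solutions are limits of the schemes v_{n+1} = (1 - hA(v_n))⁻¹(v_n + h g_n). The norm |Q(v)w|_{L(v)}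
of Z grows by a factor e^{O(h)} in each step, because v_n moves by O(h) in Y; hence the schemes stay
bounded in Z for a time determined by the constants (`exists_isEuler`). In an energy estimate in Y
the loss of a derivative falls on factors bounded in Z, so two approximate solutions remain close in
Y (`IsGood.compare`). This gives Lipschitz dependence, uniqueness and convergence in Y.

Convergence in Z meets two obstacles. The first is that f is merely continuous in Z, so f along the
schemes need not converge there. It is bounded, however, and Z carries an inner product, so suitable
convex combinations are Cauchy in L²(0, T; Z); the Lipschitz bound of f in Y identifies their limit
(`exists_forcing`). New schemes are run with these combinations as prescribed forcing.

The second is that Q(v_n)v_n obeys a linear scheme in Y whose forcing (`force`, `drift`) has no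
values in Z and depends on the scheme itself through its norm in Z. Replacing the forcing of one
fixed scheme by nearby elements of Z yields comparison schemes that are bounded in Z, hence converge
in Y by the energy estimate. If the images Q(v_n)v_n are eventually d-close, they are d/8-close to
the comparison schemes for small T, hence eventually d/2-close to each other (`ImageClose.half`).
Iteration gives a uniform Cauchy sequence in Z (`IsEulerSeq.cauchy`). The velocities then converge
uniformly in Y, so the limit is a solution. -/

/-! ### Inner products equivalent to a norm -/

/-- `ℓ` is an inner product on `Y` whose norm is equivalent to the given one, with constant `M`. -/
structure EquivForm {Y : Type*} [NormedAddCommGroup Y] [NormedSpace ℝ Y]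
    (ℓ : Y →L[ℝ] Y →L[ℝ] ℝ) (M : ℝ) : Prop where
  one_le : 1 ≤ M
  symm : ∀ x y, ℓ x y = ℓ y x
  lower : ∀ x, ‖x‖ ^ 2 ≤ M ^ 2 * ℓ x x
  upper : ∀ x, ℓ x x ≤ M ^ 2 * ‖x‖ ^ 2

/-- The norm of an inner product. -/
noncomputable def formNorm {Y : Type*} [NormedAddCommGroup Y] [NormedSpace ℝ Y]
    (ℓ : Y →L[ℝ] Y →L[ℝ] ℝ) (x : Y) : ℝ := √(ℓ x x)

namespace EquivForm

variable {Y : Type*} [NormedAddCommGroup Y] [NormedSpace ℝ Y] {ℓ : Y →L[ℝ] Y →L[ℝ] ℝ} {M : ℝ}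

theorem nonneg (hl : EquivForm ℓ M) (x : Y) : 0 ≤ ℓ x x := by
  have h1 := hl.lower x
  have h2 := hl.one_le
  by_contra! h
  have : M ^ 2 * ℓ x x < 0 := mul_neg_of_pos_of_neg (by positivity) h
  nlinarith [sq_nonneg ‖x‖]

theorem formNorm_sq (hl : EquivForm ℓ M) (x : Y) : formNorm ℓ x ^ 2 = ℓ x x :=
  Real.sq_sqrt (hl.nonneg x)

theorem formNorm_nonneg (ℓ : Y →L[ℝ] Y →L[ℝ] ℝ) (x : Y) : 0 ≤ formNorm ℓ x := Real.sqrt_nonneg _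

theorem pos (hl : EquivForm ℓ M) : 0 < M := lt_of_lt_of_le one_pos hl.one_le

theorem apply_le (hl : EquivForm ℓ M) (x y : Y) : ℓ x y ≤ formNorm ℓ x * formNorm ℓ y := by
  -- Cauchy–Schwarz by expanding the square of |y|x - |x|y. A vanishing form norm forces a zero
  -- vector by `lower`, so division by the two norms is harmless.
  have h : 0 ≤ ℓ (formNorm ℓ y • x - formNorm ℓ x • y) (formNorm ℓ y • x - formNorm ℓ x • y) :=
    hl.nonneg _
  have h1 := hl.symm x y
  have hx := hl.formNorm_sq x
  have hy := hl.formNorm_sq y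
  simp only [map_sub, map_smul, sub_apply, smul_apply,
    smul_eq_mul] at h
  have nx := formNorm_nonneg ℓ x
  have ny := formNorm_nonneg ℓ y
  rw [← h1, ← hx, ← hy] at h
  rcases nx.eq_or_lt with h0 | hx0
  · have : x = 0 := by
      have := hl.lower x
      rw [← hx, ← h0] at this
      have h5 : ‖x‖ ^ 2 ≤ 0 := by simpa using this
      exact norm_eq_zero.1 (pow_eq_zero_iff two_ne_zero |>.1 (le_antisymm h5 (sq_nonneg _)))
    simp [this, formNorm]
  rcases ny.eq_or_lt with h0 | hy0
  · have : y = 0 := by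
      have := hl.lower y
      rw [← hy, ← h0] at this
      have h5 : ‖y‖ ^ 2 ≤ 0 := by simpa using this
      exact norm_eq_zero.1 (pow_eq_zero_iff two_ne_zero |>.1 (le_antisymm h5 (sq_nonneg _)))
    simp [this, formNorm]
  by_contra! hlt
  have h6 : 0 < formNorm ℓ x * formNorm ℓ y := by positivity
  nlinarith

theorem abs_apply_le (hl : EquivForm ℓ M) (x y : Y) :
    |ℓ x y| ≤ formNorm ℓ x * formNorm ℓ y := by
  refine abs_le.2 ⟨?_, hl.apply_le x y⟩
  have := hl.apply_le (-x) y
  simp only [map_neg, neg_apply] at this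
  have h2 : formNorm ℓ (-x) = formNorm ℓ x := by simp [formNorm]
  rw [h2] at this
  linarith

theorem formNorm_add_le (hl : EquivForm ℓ M) (x y : Y) :
    formNorm ℓ (x + y) ≤ formNorm ℓ x + formNorm ℓ y := by
  have nx := formNorm_nonneg ℓ x
  have ny := formNorm_nonneg ℓ y
  refine Real.sqrt_le_iff.2 ⟨by positivity, ?_⟩
  have h1 := hl.apply_le x y
  have h2 := hl.symm x y
  have hx := hl.formNorm_sq x
  have hy := hl.formNorm_sq y
  simp only [map_add, add_apply]
  nlinarith

theorem formNorm_smul (ℓ : Y →L[ℝ] Y →L[ℝ] ℝ) (c : ℝ) (x : Y) :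
    formNorm ℓ (c • x) = |c| * formNorm ℓ x := by
  simp only [formNorm, map_smul, smul_apply, smul_eq_mul]
  rw [← mul_assoc, Real.sqrt_mul (mul_self_nonneg c), Real.sqrt_mul_self_eq_abs]

theorem norm_le (hl : EquivForm ℓ M) (x : Y) : ‖x‖ ≤ M * formNorm ℓ x := by
  have h := hl.pos
  have := formNorm_nonneg ℓ x
  refine (abs_le_of_sq_le_sq' ?_ (by positivity)).2
  rw [mul_pow, hl.formNorm_sq]
  exact hl.lower x

theorem formNorm_le (hl : EquivForm ℓ M) (x : Y) : formNorm ℓ x ≤ M * ‖x‖ := by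
  have h := hl.pos
  refine Real.sqrt_le_iff.2 ⟨by positivity, ?_⟩
  rw [mul_pow]
  exact hl.upper x

theorem abs_apply_le_norm (hl : EquivForm ℓ M) (x y : Y) : |ℓ x y| ≤ M ^ 2 * ‖x‖ * ‖y‖ := by
  have h := hl.pos
  calc |ℓ x y| ≤ formNorm ℓ x * formNorm ℓ y := hl.abs_apply_le x y
    _ ≤ (M * ‖x‖) * (M * ‖y‖) := mul_le_mul (hl.formNorm_le x) (hl.formNorm_le y)
        (formNorm_nonneg _ _) (by positivity)
    _ = _ := by ring

end EquivForm

/-! ### The resolvent in Z obtained from the one in Y -/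

section Resolvent

variable {Y Z : Type*} [NormedAddCommGroup Y] [NormedSpace ℝ Y]
  [NormedAddCommGroup Z] [NormedSpace ℝ Z]
  {ℓ : Y →L[ℝ] Y →L[ℝ] ℝ} {M ω h : ℝ} {ι A : Z →L[ℝ] Y}

/-- Quasi-dissipativity bounds `1 - h A` from below. -/
theorem formNorm_le_of_dissipative (hl : EquivForm ℓ M)
    (diss : ∀ w, ℓ (ι w) (A w) ≤ ω * ℓ (ι w) (ι w)) (h0 : 0 ≤ h) (w : Z) :
    (1 - h * ω) * formNorm ℓ (ι w) ≤ formNorm ℓ (ι w - h • A w) := by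
  rcases (EquivForm.formNorm_nonneg ℓ (ι w)).eq_or_lt with hz | hp
  · rw [← hz, mul_zero]; exact EquivForm.formNorm_nonneg _ _
  have h1 := hl.apply_le (ι w) (ι w - h • A w)
  have h2 := mul_le_mul_of_nonneg_left (diss w) h0
  have h3 := hl.formNorm_sq (ι w)
  simp only [map_sub, map_smul, smul_eq_mul] at h1
  rw [← h3] at h1 h2
  refine le_of_mul_le_mul_left ?_ hp
  nlinarith

/-- If `1 - h A` has dense range in `Y`, it is invertible in `Z`, provided that `Z` is the image of
`Y` under an isomorphism almost commuting with `A`. -/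
theorem exists_resolvent [CompleteSpace Y] [CompleteSpace Z] (hl : EquivForm ℓ M)
    (diss : ∀ w, ℓ (ι w) (A w) ≤ ω * ℓ (ι w) (ι w))
    (h0 : 0 < h) (hω : h * ω ≤ 1 / 2) (Q : Z ≃L[ℝ] Y) (B : Z →L[ℝ] Y) {q qi b : ℝ}
    (hq : ∀ w, ‖Q w‖ ≤ q * ‖w‖) (hqi : ∀ y, ‖Q.symm y‖ ≤ qi * ‖y‖)
    (hqi0 : 0 ≤ qi) (hb : ∀ w, ‖B w‖ ≤ b * ‖w‖) (hb0 : 0 ≤ b)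
    (hsmall : h * (2 * M ^ 2 * b * qi) ≤ 1 / 2)
    (comm : ∀ w z : Z, ι z = Q w → ∃ y : Z, ι y = A w ∧ Q y - A z = B w)
    (hd : DenseRange fun w => ι w - h • A w) :
    ∃ J : Z →L[ℝ] Z, (∀ g, ι (J g) - h • A (J g) = ι g) ∧
      (∀ g, ‖J g‖ ≤ 4 * M ^ 2 * q * qi * ‖g‖) ∧
      ∀ g g' u' : Z, ι u' - h • A u' = ι g' →
        (1 - h * ω) * formNorm ℓ (Q (J g) - ι u') ≤
          formNorm ℓ (Q g + h • B (J g) - ι g') := by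
  have hM := hl.one_le
  set T : Z →L[ℝ] Y := ι - h • A with hT
  have hTd : DenseRange (T : Z →ₗ[ℝ] Y) := hd
  have hbound : ∀ w, ‖(ι : Z →ₗ[ℝ] Y) w‖ ≤ (2 * M ^ 2) * ‖(T : Z →ₗ[ℝ] Y) w‖ := by
    intro w
    have h1 := formNorm_le_of_dissipative hl diss h0.le w
    have h2 := hl.norm_le (ι w)
    have h3 := hl.formNorm_le (ι w - h • A w)
    have h4 := EquivForm.formNorm_nonneg ℓ (ι w)
    change ‖ι w‖ ≤ 2 * M ^ 2 * ‖ι w - h • A w‖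
    have h5 : formNorm ℓ (ι w) ≤ 2 * (M * ‖ι w - h • A w‖) := by nlinarith
    nlinarith
  -- `J` is the resolvent in Y, the continuous extension of T w ↦ ι w from the dense range of T. Its
  -- values need not lie in the image of ι.
  set J := (ι : Z →ₗ[ℝ] Y).extendOfNorm (T : Z →ₗ[ℝ] Y) with hJ
  have hJT : ∀ w, J (T w) = ι w := fun w => LinearMap.extendOfNorm_eq hTd ⟨_, hbound⟩ w
  have hJn : ∀ y, ‖J y‖ ≤ 2 * M ^ 2 * ‖y‖ :=
    LinearMap.norm_extendOfNorm_apply_le hTd _ hbound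
  have hJf : ∀ y, (1 - h * ω) * formNorm ℓ (J y) ≤ formNorm ℓ y := by
    refine fun y => hTd.induction_on (p := fun y => (1 - h * ω) * formNorm ℓ (J y) ≤ formNorm ℓ y) y
      (isClosed_le ?_ ?_) ?_
    · unfold formNorm; fun_prop
    · unfold formNorm; fun_prop
    · intro w
      have := formNorm_le_of_dissipative hl diss h0.le w
      change (1 - h * ω) * formNorm ℓ (J (T w)) ≤ formNorm ℓ (T w)
      rw [hJT]; exact this
  -- On the image of ι the commutator identity reads (1 - hA)Q⁻¹ = Q⁻¹(1 - hA) - Q⁻¹hBQ⁻¹. Composed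
  -- with `J` it holds on the dense range of T, hence everywhere.
  have hkey : ∀ y, T (Q.symm (J y)) = ι (Q.symm (y - h • B (Q.symm (J y)))) := by
    refine fun y => hTd.induction_on
      (p := fun y => T (Q.symm (J y)) = ι (Q.symm (y - h • B (Q.symm (J y))))) y
      (isClosed_eq (by fun_prop) (by fun_prop)) ?_
    intro w
    change T (Q.symm (J (T w))) = ι (Q.symm (T w - h • B (Q.symm (J (T w)))))
    rw [hJT]
    obtain ⟨y, hy1, hy2⟩ := comm (Q.symm (ι w)) w (by simp)
    have : Q.symm (T w - h • B (Q.symm (ι w))) = Q.symm (ι w) - h • y := by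
      rw [← hy2]
      apply Q.injective
      simp only [map_sub, map_smul, ContinuousLinearEquiv.apply_symm_apply, hT,
        sub_apply, smul_apply, smul_sub]
      abel
    rw [this]
    simp [hT, hy1]
  -- Applying Q to u - hAu = g suggests Qu = J(Qg + hBu), that is (1 - K)Qu = JQg. Smallness of h
  -- gives ‖K‖ ≤ 1/2, and u = Q⁻¹(1 - K)⁻¹JQg; `hkey` shows that it solves the equation.
  set K : Y →L[ℝ] Y := h • (J.comp (B.comp (Q.symm : Y →L[ℝ] Z))) with hK
  have hKn : ∀ y, ‖K y‖ ≤ 1 / 2 * ‖y‖ := by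
    intro y
    have h1 := hJn (B (Q.symm y))
    have h2 := hb (Q.symm y)
    have h3 := hqi y
    have : K y = h • J (B (Q.symm y)) := rfl
    rw [this, norm_smul, Real.norm_of_nonneg h0.le]
    calc h * ‖J (B (Q.symm y))‖ ≤ h * (2 * M ^ 2 * (b * (qi * ‖y‖))) := by
          gcongr
          exact h1.trans (by gcongr; exact h2.trans (by gcongr))
      _ = h * (2 * M ^ 2 * b * qi) * ‖y‖ := by ring
      _ ≤ _ := by gcongr
  have hKN : ‖K‖ < 1 :=
    lt_of_le_of_lt (K.opNorm_le_bound (by norm_num) hKn) (by norm_num)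
  set U := Units.oneSub K hKN with hU
  set S : Y →L[ℝ] Y := ((U⁻¹ : (Y →L[ℝ] Y)ˣ) : Y →L[ℝ] Y) with hS
  have hSK : ∀ y, S y = y + K (S y) := by
    intro y
    have h1 : (U : Y →L[ℝ] Y) * S = 1 := U.mul_inv
    have h2 := congrArg (fun f : Y →L[ℝ] Y => f y) h1
    simp only [hU, Units.val_oneSub, mul_apply_eq_comp, sub_apply,
      one_apply_eq_self] at h2
    rw [← sub_eq_iff_eq_add]; exact h2
  have hSn : ∀ y, ‖S y‖ ≤ 2 * ‖y‖ := by
    intro y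
    have h1 := norm_add_le y (K (S y))
    rw [← hSK] at h1
    have := hKn (S y)
    linarith
  refine ⟨(Q.symm : Y →L[ℝ] Z).comp (S.comp (J.comp (Q : Z →L[ℝ] Y))), ?_⟩
  have hz : ∀ g, ∃ u, ((Q.symm : Y →L[ℝ] Z).comp (S.comp (J.comp (Q : Z →L[ℝ] Y)))) g = u ∧
      J (Q g + h • B u) = Q u ∧ ‖u‖ ≤ 4 * M ^ 2 * q * qi * ‖g‖ := by
    intro g
    refine ⟨_, rfl, ?_, ?_⟩
    · have := hSK (J (Q g))
      simp only [ContinuousLinearMap.comp_apply, ContinuousLinearEquiv.coe_coe, map_add, map_smul,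
        ContinuousLinearEquiv.apply_symm_apply]
      exact this.symm
    · simp only [ContinuousLinearMap.comp_apply, ContinuousLinearEquiv.coe_coe]
      calc _ ≤ qi * ‖S (J (Q g))‖ := hqi _
        _ ≤ qi * (2 * (2 * M ^ 2 * (q * ‖g‖))) := by
          gcongr
          refine (hSn _).trans ?_
          gcongr
          refine (hJn _).trans ?_
          gcongr
          exact hq g
        _ = _ := by ring
  refine ⟨?_, ?_, ?_⟩
  · intro g
    obtain ⟨u, hu, hJu, -⟩ := hz g
    rw [hu]
    have := hkey (Q g + h • B u)
    rw [hJu] at this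
    simp only [ContinuousLinearEquiv.symm_apply_apply, add_sub_cancel_right] at this
    exact this
  · intro g
    obtain ⟨u, hu, -, hn⟩ := hz g
    rw [hu]; exact hn
  · intro g g' u' hu'
    obtain ⟨u, hu, hJu, -⟩ := hz g
    rw [hu]
    have h1 := hJf (Q g + h • B u - ι g')
    have h2 : J (ι g') = ι u' := by rw [← hu']; exact hJT u'
    rwa [map_sub, hJu, h2] at h1

end Resolvent

/-! ### Lumer–Phillips argument in the base space -/

section LumerPhillips

variable {Y Z : Type*} [NormedAddCommGroup Y] [NormedSpace ℝ Y]
  [NormedAddCommGroup Z] [NormedSpace ℝ Z]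
  {ℓ : Y →L[ℝ] Y →L[ℝ] ℝ} {M ω h : ℝ}

/-- Neumann series for a contraction in an equivalent norm. -/
theorem EquivForm.exists_sub_eq [CompleteSpace Y] (hl : EquivForm ℓ M) (K : Y →L[ℝ] Y) {θ : ℝ}
    (h0 : 0 ≤ θ) (h1 : θ < 1) (hK : ∀ y, formNorm ℓ (K y) ≤ θ * formNorm ℓ y) (y : Y) :
    ∃ x, x - K x = y := by
  have hM := hl.pos
  have hpow : ∀ n : ℕ, ∀ y, formNorm ℓ ((K ^ n) y) ≤ θ ^ n * formNorm ℓ y := by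
    intro n
    induction n with
    | zero => intro y; simp
    | succ n ih =>
      intro y
      rw [pow_succ', mul_apply_eq_comp]
      calc _ ≤ θ * formNorm ℓ ((K ^ n) y) := hK _
        _ ≤ θ * (θ ^ n * formNorm ℓ y) := by gcongr; exact ih y
        _ = _ := by ring
  -- K contracts the form norm only. In the given norm K^n is small for large n, and 1 - K^n = (1 -
  -- K)(1 + ... + K^{n-1}).
  obtain ⟨n, hn⟩ := exists_pow_lt_of_lt_one (show (0 : ℝ) < 1 / (2 * M ^ 2) by positivity) h1
  have hKn : ‖K ^ n‖ < 1 := by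
    refine lt_of_le_of_lt ((K ^ n).opNorm_le_bound (by norm_num : (0 : ℝ) ≤ 1 / 2) fun y => ?_)
      (by norm_num)
    calc _ ≤ M * formNorm ℓ ((K ^ n) y) := hl.norm_le _
      _ ≤ M * (1 / (2 * M ^ 2) * (M * ‖y‖)) := by
        gcongr
        exact (hpow n y).trans (mul_le_mul hn.le (hl.formNorm_le y) (formNorm_nonneg _ _)
          (by positivity))
      _ = _ := by field_simp
  set U := Units.oneSub (K ^ n) hKn
  have hU : (1 - K ^ n) * ((U⁻¹ : (Y →L[ℝ] Y)ˣ) : Y →L[ℝ] Y) = 1 := U.mul_inv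
  rw [← mul_neg_geom_sum, mul_assoc] at hU
  exact ⟨_, congrArg (fun f : Y →L[ℝ] Y => f y) hU⟩

variable {A : Y →ₗ.[ℝ] Y} {ι Ab : Z →L[ℝ] Y}

/-- The core property lets closed conditions pass from the image of ι to the whole graph; `hAb`
identifies A on this image with `Ab`. -/
theorem graph_subset_closure_range (hA : A.IsClosed)
    (hcore : A.HasCore (LinearMap.range (ι : Z →ₗ[ℝ] Y))) (hAb : ∀ w, (ι w, Ab w) ∈ A.graph) :
    (A.graph : Set (Y × Y)) ⊆ closure (range fun w => (ι w, Ab w)) := by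
  have hle : A.domRestrict (LinearMap.range (ι : Z →ₗ[ℝ] Y)) ≤ A := LinearPMap.domRestrict_le
  have hcl : (A.domRestrict (LinearMap.range (ι : Z →ₗ[ℝ] Y))).IsClosable :=
    hA.isClosable.leIsClosable hle
  have h1 := hcl.graph_closure_eq_closure_graph
  rw [hcore.closure_eq] at h1
  rw [← h1, Submodule.topologicalClosure_coe]
  refine closure_mono ?_
  rintro ⟨x, y⟩ hxy
  obtain ⟨⟨x', hx'⟩, h2, h3⟩ := (LinearPMap.mem_graph_iff _).1 hxy
  simp only at h2 h3
  subst h2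
  obtain ⟨w, hw'⟩ : ∃ w, ι w = x' := (Submodule.mem_inf.1 hx').1
  have hm := LinearPMap.le_graph_of_le hle hxy
  refine ⟨w, ?_⟩
  have h4 := hAb w
  rw [hw'] at h4
  exact Prod.ext hw' (LinearPMap.mem_graph_snd_inj A h4 hm rfl)

/-- Dissipativity is a closed condition on the pair (x, Ax), so it extends from the core to the
graph. Pairing with x and Cauchy–Schwarz then give the resolvent estimate. -/
theorem formNorm_le_of_mem_graph (hl : EquivForm ℓ M) (hA : A.IsClosed)
    (hcore : A.HasCore (LinearMap.range (ι : Z →ₗ[ℝ] Y))) (hAb : ∀ w, (ι w, Ab w) ∈ A.graph)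
    (diss : ∀ w, ℓ (ι w) (Ab w) ≤ ω * ℓ (ι w) (ι w)) (l : ℝ) (p : Y × Y) (hp : p ∈ A.graph) :
    (l - ω) * formNorm ℓ p.1 ≤ formNorm ℓ (l • p.1 - p.2) := by
  have hd : ℓ p.1 p.2 ≤ ω * ℓ p.1 p.1 := by
    have hc : IsClosed {p : Y × Y | ℓ p.1 p.2 ≤ ω * ℓ p.1 p.1} :=
      isClosed_le (by fun_prop) (by fun_prop)
    refine closure_minimal ?_ hc (graph_subset_closure_range hA hcore hAb hp)
    rintro _ ⟨w, rfl⟩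
    exact diss w
  rcases (EquivForm.formNorm_nonneg ℓ p.1).eq_or_lt with hz | hpos
  · rw [← hz, mul_zero]; exact EquivForm.formNorm_nonneg _ _
  have h1 := hl.apply_le p.1 (l • p.1 - p.2)
  have h3 := hl.formNorm_sq p.1
  simp only [map_sub, map_smul, smul_eq_mul] at h1
  rw [← h3] at h1 hd
  refine le_of_mul_le_mul_left ?_ hpos
  nlinarith

/-- The resolvent at l has form norm at most 1/(l - ω), so the equation at l' is solved by a Neumann
series. The graph is a Banach space on which l - A is a bounded bijection, which supplies the
inverse without a norm on the domain. -/
theorem surjective_of_surjective_of_near [CompleteSpace Y] (hl : EquivForm ℓ M) (hA : A.IsClosed)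
    (hcore : A.HasCore (LinearMap.range (ι : Z →ₗ[ℝ] Y))) (hAb : ∀ w, (ι w, Ab w) ∈ A.graph)
    (diss : ∀ w, ℓ (ι w) (Ab w) ≤ ω * ℓ (ι w) (ι w)) {l l' : ℝ} (hl1 : ω < l)
    (hs : ∀ y, ∃ p ∈ A.graph, l • p.1 - p.2 = y) (hl2 : |l - l'| < l - ω) (y : Y) :
    ∃ p ∈ A.graph, l' • p.1 - p.2 = y := by
  have hA' : _root_.IsClosed (A.graph : Set (Y × Y)) := hA
  have : CompleteSpace A.graph := hA'.completeSpace_coe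
  set F : A.graph →L[ℝ] Y := (ContinuousLinearMap.fst ℝ Y Y).comp A.graph.subtypeL with hF
  set G : A.graph →L[ℝ] Y := (ContinuousLinearMap.snd ℝ Y Y).comp A.graph.subtypeL with hG
  have hlow := formNorm_le_of_mem_graph hl hA hcore hAb diss l
  have hinj : LinearMap.ker ((l • F - G : A.graph →L[ℝ] Y) : A.graph →ₗ[ℝ] Y) = ⊥ := by
    rw [LinearMap.ker_eq_bot']
    rintro ⟨p, hp⟩ h0
    have h0' : l • p.1 - p.2 = 0 := h0
    have h1 := hlow p hp
    rw [h0'] at h1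
    have h2 : formNorm ℓ p.1 ≤ 0 := by
      have h4 : formNorm ℓ (0 : Y) = 0 := by simp [formNorm]
      rw [h4] at h1
      nlinarith
    have h3 := hl.norm_le p.1
    have h4 := hl.pos
    have h5 : p.1 = 0 := norm_le_zero_iff.1 (by nlinarith)
    have h6 : p.2 = 0 := by rw [h5] at h0'; simpa using h0'
    exact Subtype.ext (Prod.ext h5 h6)
  have hran : LinearMap.range ((l • F - G : A.graph →L[ℝ] Y) : A.graph →ₗ[ℝ] Y) = ⊤ := by
    rw [LinearMap.range_eq_top]
    intro y
    obtain ⟨p, hp, h⟩ := hs y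
    exact ⟨⟨p, hp⟩, h⟩
  set e := ContinuousLinearEquiv.ofBijective (l • F - G) hinj hran with he
  have he' : ∀ p : A.graph, e p = l • (p : Y × Y).1 - (p : Y × Y).2 := fun p => rfl
  set K : Y →L[ℝ] Y := (l - l') • F.comp (e.symm : Y →L[ℝ] A.graph) with hK
  have hpos : 0 < l - ω := by linarith
  have hKn : ∀ y, formNorm ℓ (K y) ≤ |l - l'| / (l - ω) * formNorm ℓ y := by
    intro y
    have h1 : K y = (l - l') • ((e.symm y : A.graph) : Y × Y).1 := rfl
    have h2 := hlow _ (e.symm y).2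
    rw [← he', e.apply_symm_apply] at h2
    rw [h1, EquivForm.formNorm_smul, div_mul_eq_mul_div, mul_div_assoc]
    gcongr
    rw [le_div_iff₀ hpos]
    linarith
  obtain ⟨x, hx⟩ := hl.exists_sub_eq K (by positivity) ((div_lt_one hpos).2 hl2) hKn y
  refine ⟨_, (e.symm x).2, ?_⟩
  have h1 : K x = (l - l') • ((e.symm x : A.graph) : Y × Y).1 := rfl
  have h2 := he' (e.symm x)
  rw [e.apply_symm_apply] at h2
  rw [← hx, h1, sub_smul]
  nth_rewrite 3 [h2]
  abel

/-- A closed quasi-dissipative operator `A` such that `l - A` is surjective for some `l > ω` is such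
that `1 - h A` has dense range on a core for all small `h`. -/
theorem denseRange_sub_smul [CompleteSpace Y] (hl : EquivForm ℓ M) (hA : A.IsClosed)
    (hcore : A.HasCore (LinearMap.range (ι : Z →ₗ[ℝ] Y))) (hAb : ∀ w, (ι w, Ab w) ∈ A.graph)
    (diss : ∀ w, ℓ (ι w) (Ab w) ≤ ω * ℓ (ι w) (ι w))
    (hs : ∃ l : ℝ, ω < l ∧ ∀ y : Y, ∃ x : A.domain, l • (x : Y) - A x = y)
    (h0 : 0 < h) (hω : h * ω < 1) : DenseRange fun w => ι w - h • Ab w := by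
  obtain ⟨l, hl1, hs⟩ := hs
  have hs' : ∀ y, ∃ p ∈ A.graph, l • p.1 - p.2 = y := by
    intro y
    obtain ⟨x, hx⟩ := hs y
    exact ⟨(x, A x), A.mem_graph x, hx⟩
  have hpos : 0 < l - ω := by linarith
  -- Surjectivity climbs by l - ω ↦ (3/2)(l - ω); a factor 2 would violate the strict inequality of
  -- the perturbation lemma. Once h⁻¹ is passed, one step down reaches it because h⁻¹ > ω.
  have hall : ∀ n : ℕ, ∀ y, ∃ p ∈ A.graph, (ω + (3 / 2) ^ n * (l - ω)) • p.1 - p.2 = y := by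
    intro n
    induction n with
    | zero => intro y; obtain ⟨p, hp, h⟩ := hs' y; exact ⟨p, hp, by rw [← h]; simp⟩
    | succ n ih =>
      have hp : 0 < (3 / 2 : ℝ) ^ n * (l - ω) := by positivity
      refine fun y => surjective_of_surjective_of_near hl hA hcore hAb diss
        (l := ω + (3 / 2) ^ n * (l - ω)) (by linarith) ih ?_ y
      rw [pow_succ, show ω + (3 / 2 : ℝ) ^ n * (l - ω) - (ω + (3 / 2) ^ n * (3 / 2) * (l - ω))
        = - (1 / 2 * ((3 / 2) ^ n * (l - ω))) by ring, abs_neg, abs_of_pos (by positivity)]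
      linarith
  have hinv : ω < h⁻¹ := by
    rw [inv_eq_one_div, lt_div_iff₀ h0, mul_comm]
    exact hω
  obtain ⟨n, hn⟩ := pow_unbounded_of_one_lt ((h⁻¹ - ω) / (l - ω)) (show (1 : ℝ) < 3 / 2 by norm_num)
  rw [div_lt_iff₀ hpos] at hn
  have hsur : ∀ y, ∃ p ∈ A.graph, h⁻¹ • p.1 - p.2 = y := by
    refine surjective_of_surjective_of_near hl hA hcore hAb diss
        (l := ω + (3 / 2) ^ n * (l - ω)) (by linarith) (hall n) ?_
    rw [abs_lt]
    constructor <;> linarith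
  intro y
  obtain ⟨p, hp, hpy⟩ := hsur (h⁻¹ • y)
  have h1 : p.1 - h • p.2 = y := by
    have := congrArg (fun x => h • x) hpy
    simpa [smul_sub, smul_smul, h0.ne'] using this
  rw [← h1]
  have h2 : MapsTo (fun p : Y × Y => p.1 - h • p.2) (range fun w => (ι w, Ab w))
      (range fun w => ι w - h • Ab w) := by
    rintro _ ⟨w, rfl⟩
    exact ⟨w, rfl⟩
  exact h2.closure (by fun_prop) (graph_subset_closure_range hA hcore hAb hp)

end LumerPhillips

/-! ### Inner products and resolvents on the spaces of the scale -/

/-- Growth bound of `A(v)` on `X^r` in the norm `|Q(v)^r w|_{L(v)}`. -/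
noncomputable def QLConst.growth (c : QLConst) : ℕ → ℝ
  | 0 => |c.ω|
  | r + 1 => growth c r + (c.CL * c.CQ ^ r) ^ 2 * c.C0 * c.CQ

/-- Lipschitz constant in `v` of the inner product `⟨L(v) Q(v)^r w, Q(v)^r z⟩` on `X^r`. -/
noncomputable def QLConst.formLip (c : QLConst) : ℕ → ℝ
  | 0 => c.C0
  | r + 1 => formLip c r * c.CQ ^ 2 + 2 * (c.CL * c.CQ ^ r) ^ 2 * c.C0 * c.CQ

namespace QLConst

variable (c : QLConst)

theorem CQ_pos : 0 < c.CQ := lt_of_lt_of_le one_pos c.one_le_CQ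

theorem CL_pos : 0 < c.CL := lt_of_lt_of_le one_pos c.one_le_CL

theorem growth_mono : Monotone c.growth := by
  refine monotone_nat_of_le_succ fun r => ?_
  have := c.CQ_pos
  have := c.CL_pos
  have := c.C0_pos
  simp only [growth, le_add_iff_nonneg_right]
  positivity

theorem growth_nonneg (r : ℕ) : 0 ≤ c.growth r := (abs_nonneg _).trans (c.growth_mono (Nat.zero_le r))

theorem formLip_nonneg (r : ℕ) : 0 ≤ c.formLip r := by
  have := c.CQ_pos
  have := c.CL_pos
  have := c.C0_pos
  induction r with
  | zero => exact this.le
  | succ r ih => simp only [formLip]; positivity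

end QLConst

namespace QLData

variable {X : ℕ → Type u} [∀ r, NormedAddCommGroup (X r)] [∀ r, NormedSpace ℝ (X r)] {m : ℕ}

/-- The inner product `⟨L(v) Q(v)^r w, Q(v)^r z⟩` on `X^r`. -/
noncomputable def form (D : QLData X m) (v : X m) : ∀ r, X r →L[ℝ] X r →L[ℝ] ℝ
  | 0 => D.L v
  | r + 1 => (form D v r).bilinearComp (D.Q r v) (D.Q r v)

@[simp]
theorem form_succ_apply (D : QLData X m) (v : X m) (r : ℕ) (x y : X (r + 1)) :
    D.form v (r + 1) x y = D.form v r (D.Q r v x) (D.Q r v y) := rfl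

variable {S : DenseScale X} {D : QLData X m} {c : QLConst} {v v' : X m}

theorem convex_ballLow {δ : ℝ} : Convex ℝ (D.ballLow S δ) := convex_ball _ _

theorem isOpen_ballLow {δ : ℝ} : IsOpen (D.ballLow S δ) := isOpen_ball

theorem norm_sub_le_of_fderiv_le {F : Type*} [NormedAddCommGroup F] [NormedSpace ℝ F] {f : X m → F}
    {δ C : ℝ} (hf : ContDiffOn ℝ 1 f (D.ballLow S δ))
    (hC : ∀ v ∈ D.ballLow S δ, ‖fderiv ℝ f v‖ ≤ C) (hv : v ∈ D.ballLow S δ)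
    (hv' : v' ∈ D.ballLow S δ) : ‖f v - f v'‖ ≤ C * ‖v - v'‖ :=
  convex_ballLow.norm_image_sub_le_of_norm_fderiv_le (𝕜 := ℝ)
    (fun _ hx => (hf.differentiableOn one_ne_zero).differentiableAt (isOpen_ballLow.mem_nhds hx))
    hC hv' hv

theorem H3.norm_apply_le (h3 : D.H3 S c) {r : ℕ} (hr : r ≤ m) (hv : v ∈ D.ballLow S c.δ0)
    (w : X (r + 1)) : ‖D.Q r v w‖ ≤ c.CQ * ‖w‖ :=
  (D.Q r v).le_of_opNorm_le (h3.norm_le r hr v hv) w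

theorem H3.exists_equiv (h3 : D.H3 S c) {r : ℕ} (hr : r ≤ m) (hv : v ∈ D.ballLow S c.δ0) :
    ∃ e : X (r + 1) ≃L[ℝ] X r, (∀ w, D.Q r v w = e w) ∧ ∀ y, ‖e.symm y‖ ≤ c.CQ * ‖y‖ := by
  obtain ⟨e, he⟩ := h3.isInvertible r hr v hv
  refine ⟨e, fun w => by rw [← he]; rfl, fun y => ?_⟩
  have := h3.norm_inverse_le r hr v hv
  rw [← he, ContinuousLinearMap.inverse_equiv] at this
  exact (e.symm : X r →L[ℝ] X (r + 1)).le_of_opNorm_le this y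

theorem H3.norm_le_apply (h3 : D.H3 S c) {r : ℕ} (hr : r ≤ m) (hv : v ∈ D.ballLow S c.δ0)
    (w : X (r + 1)) : ‖w‖ ≤ c.CQ * ‖D.Q r v w‖ := by
  obtain ⟨e, he, hn⟩ := h3.exists_equiv hr hv
  have := hn (e w)
  rwa [e.symm_apply_apply, ← he] at this

theorem H3.lipschitz (h3 : D.H3 S c) {r : ℕ} (hr : r ≤ m) (hv : v ∈ D.ballLow S c.δ0)
    (hv' : v' ∈ D.ballLow S c.δ0) (w : X (r + 1)) :
    ‖D.Q r v w - D.Q r v' w‖ ≤ c.C0 * ‖v - v'‖ * ‖w‖ :=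
  (D.Q r v - D.Q r v').le_of_opNorm_le
    (norm_sub_le_of_fderiv_le (h3.contDiffOn r hr) (h3.fderiv_le r hr) hv hv') w

theorem equivForm (h1 : D.H1 S c) (h3 : D.H3 S c) (hv : v ∈ D.ballLow S c.δ0) :
    ∀ {r : ℕ}, r ≤ m → EquivForm (D.form v r) (c.CL * c.CQ ^ r) := by
  have hL := c.CL_pos
  have hQ := c.CQ_pos
  intro r
  induction r with
  | zero =>
    intro _
    -- The lower bound is stated with a square root, which is 0 at negative arguments; a negative
    -- value would therefore force w = 0.
    have hpos : ∀ w, 0 ≤ D.L v w w := by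
      intro w
      rcases eq_or_ne w 0 with rfl | hw
      · simp
      by_contra! hneg
      have h := h1.lower v hv w
      rw [Real.sqrt_eq_zero_of_nonpos hneg.le] at h
      have : 0 < c.CL⁻¹ * ‖w‖ := by positivity
      linarith
    refine ⟨by simpa using c.one_le_CL, h1.symm v hv, fun w => ?_, fun w => ?_⟩
    · have h := h1.lower v hv w
      rw [inv_mul_le_iff₀ hL] at h
      calc ‖w‖ ^ 2 ≤ (c.CL * √(D.L v w w)) ^ 2 := by gcongr
        _ = (c.CL * c.CQ ^ 0) ^ 2 * D.form v 0 w w := by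
          rw [mul_pow, Real.sq_sqrt (hpos w)]; simp [form]
    · have h := h1.upper v hv w
      calc D.form v 0 w w = √(D.L v w w) ^ 2 := (Real.sq_sqrt (hpos w)).symm
        _ ≤ (c.CL * ‖w‖) ^ 2 := by gcongr
        _ = _ := by ring
  | succ r ih =>
    intro hr
    have hr' : r ≤ m := by omega
    have ih := ih hr'
    refine ⟨one_le_mul_of_one_le_of_one_le c.one_le_CL (one_le_pow₀ c.one_le_CQ),
      fun x y => ih.symm _ _, fun w => ?_, fun w => ?_⟩
    · calc ‖w‖ ^ 2 ≤ (c.CQ * ‖D.Q r v w‖) ^ 2 := by gcongr; exact h3.norm_le_apply hr' hv w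
        _ = c.CQ ^ 2 * ‖D.Q r v w‖ ^ 2 := by ring
        _ ≤ c.CQ ^ 2 * ((c.CL * c.CQ ^ r) ^ 2 * D.form v r (D.Q r v w) (D.Q r v w)) := by
          gcongr; exact ih.lower _
        _ = _ := by rw [form_succ_apply]; ring
    · calc D.form v (r + 1) w w ≤ (c.CL * c.CQ ^ r) ^ 2 * ‖D.Q r v w‖ ^ 2 := ih.upper _
        _ ≤ (c.CL * c.CQ ^ r) ^ 2 * (c.CQ * ‖w‖) ^ 2 := by
          gcongr; exact h3.norm_apply_le hr' hv w
        _ = _ := by ring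

/-- The form at level r + 1 depends on v through the form at level r and through two factors Q(v).
The difference is telescoped accordingly, and `equivForm` bounds the last two terms. -/
theorem form_lipschitz (h1 : D.H1 S c) (h3 : D.H3 S c) (hv : v ∈ D.ballLow S c.δ0)
    (hv' : v' ∈ D.ballLow S c.δ0) :
    ∀ {r : ℕ}, r ≤ m → ∀ x y : X r,
      |D.form v r x y - D.form v' r x y| ≤ c.formLip r * ‖v - v'‖ * ‖x‖ * ‖y‖ := by
  have hL := c.CL_pos
  have hQ := c.CQ_pos
  intro r
  induction r with
  | zero =>
    intro _ x y
    have := norm_sub_le_of_fderiv_le h1.contDiffOn h1.fderiv_le hv hv'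
    exact (D.L v - D.L v').le_of_opNorm₂_le_of_le this le_rfl le_rfl
  | succ r ih =>
    intro hr x y
    have hr' : r ≤ m := by omega
    have ih := ih hr' (D.Q r v x) (D.Q r v y)
    have he := equivForm h1 h3 hv' hr'
    have hΛ := c.formLip_nonneg r
    have hC0 := c.C0_pos
    have e1 := he.abs_apply_le_norm (D.Q r v x - D.Q r v' x) (D.Q r v y)
    have e2 := he.abs_apply_le_norm (D.Q r v' x) (D.Q r v y - D.Q r v' y)
    have q1 := h3.lipschitz hr' hv hv' x
    have q2 := h3.lipschitz hr' hv hv' y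
    have n1 := h3.norm_apply_le hr' hv x
    have n2 := h3.norm_apply_le hr' hv y
    have n3 := h3.norm_apply_le hr' hv' x
    have ih' : |D.form v r (D.Q r v x) (D.Q r v y) - D.form v' r (D.Q r v x) (D.Q r v y)| ≤
        c.formLip r * ‖v - v'‖ * (c.CQ * ‖x‖) * (c.CQ * ‖y‖) := ih.trans (by gcongr)
    have e1' := e1.trans (show _ ≤ (c.CL * c.CQ ^ r) ^ 2 * (c.C0 * ‖v - v'‖ * ‖x‖) * (c.CQ * ‖y‖) by
      gcongr)
    have e2' := e2.trans (show _ ≤ (c.CL * c.CQ ^ r) ^ 2 * (c.CQ * ‖x‖) * (c.C0 * ‖v - v'‖ * ‖y‖) by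
      gcongr)
    have key : D.form v (r + 1) x y - D.form v' (r + 1) x y =
        (D.form v r (D.Q r v x) (D.Q r v y) - D.form v' r (D.Q r v x) (D.Q r v y)) +
        (D.form v' r (D.Q r v x - D.Q r v' x) (D.Q r v y) +
          D.form v' r (D.Q r v' x) (D.Q r v y - D.Q r v' y)) := by
      simp only [form_succ_apply, map_sub, sub_apply]; ring
    rw [key]
    refine (abs_add_le _ _).trans ((add_le_add ih' ((abs_add_le _ _).trans
      (add_le_add e1' e2'))).trans (le_of_eq ?_))
    simp only [QLConst.formLip]; ring

theorem _root_.DenseScale.toBase_injective (S : DenseScale X) (r : ℕ) :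
    Function.Injective (S.toBase r) := by
  induction r with
  | zero => exact fun _ _ h => h
  | succ r ih => exact ih.comp (S.injective r)

/-- Both sides are values of the single operator A(v) at the same element of the base space, and its
graph is single valued. -/
theorem H2.incl_Ab (h2 : D.H2 S c) {r : ℕ} (hr : r + 1 ≤ m) (hv : v ∈ D.ballLow S c.δ0)
    (w : X (r + 2)) : S.incl r (D.Ab (r + 1) v w) = D.Ab r v (S.incl (r + 1) w) := by
  have e1 := h2.restrict (r + 1) hr v hv w
  have e2 := h2.restrict r (by omega) v hv (S.incl (r + 1) w)
  exact S.toBase_injective r (LinearPMap.mem_graph_snd_inj _ e1 e2 rfl)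

/-- Moving Q(v) past A(v) reduces level r + 1 to level r at z = Q(v)w, up to the pairing of z with
the commutator term, which is bounded by the squared form norm of z since ‖w‖_{X^{r+1}} ≤ C_Q‖z‖. -/
theorem dissipative (h1 : D.H1 S c) (h2 : D.H2 S c) (h3 : D.H3 S c) (hv : v ∈ D.ballLow S c.δ0) :
    ∀ {r : ℕ}, r ≤ m → ∀ w : X (r + 1), D.form v r (S.incl r w) (D.Ab r v w) ≤
      c.growth r * D.form v r (S.incl r w) (S.incl r w) := by
  have hL := c.CL_pos
  have hQ := c.CQ_pos
  have hC0 := c.C0_pos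
  intro r
  induction r with
  | zero =>
    intro hr w
    refine (h2.dissipative v hv w).trans ?_
    exact mul_le_mul_of_nonneg_right (le_abs_self _) ((equivForm h1 h3 hv hr).nonneg _)
  | succ r ih =>
    intro hr w
    have hr' : r ≤ m := by omega
    obtain ⟨B, -, hB⟩ := h3.commutator r hr'
    obtain ⟨hc, hBn⟩ := hB v hv
    obtain ⟨y, hy1, hy2⟩ := hc (S.incl (r + 1) w) (D.Q (r + 1) v w) (h3.restrict r hr v hv w)
    have hy : y = D.Ab (r + 1) v w := S.injective r (hy1.trans (h2.incl_Ab hr hv w).symm)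
    have he := equivForm h1 h3 hv hr'
    have hz := ih hr' (D.Q (r + 1) v w)
    rw [h3.restrict r hr v hv w] at hz
    set z := D.Q r v (S.incl (r + 1) w) with hzdef
    have hBw : ‖B v (S.incl (r + 1) w)‖ ≤ c.C0 * (c.CQ * ‖z‖) :=
      ((B v).le_of_opNorm_le hBn _).trans (by gcongr; exact h3.norm_le_apply hr' hv _)
    have h5 := he.apply_le z (B v (S.incl (r + 1) w))
    have h6 := he.formNorm_le (B v (S.incl (r + 1) w))
    have h7 := he.norm_le z
    have h8 := EquivForm.formNorm_nonneg (D.form v r) z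
    have h9 := he.formNorm_sq z
    have h10 : D.Q r v (D.Ab (r + 1) v w) = D.Ab r v (D.Q (r + 1) v w) + B v (S.incl (r + 1) w) := by
      rw [← hy2, hy]; abel
    rw [form_succ_apply, form_succ_apply, h10, ← hzdef, map_add]
    have h11 : D.form v r z (B v (S.incl (r + 1) w)) ≤
        (c.CL * c.CQ ^ r) ^ 2 * c.C0 * c.CQ * D.form v r z z := by
      calc _ ≤ formNorm (D.form v r) z * formNorm (D.form v r) (B v (S.incl (r + 1) w)) := h5
        _ ≤ formNorm (D.form v r) z * ((c.CL * c.CQ ^ r) * (c.C0 * (c.CQ *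
            ((c.CL * c.CQ ^ r) * formNorm (D.form v r) z)))) := by
          gcongr; exact h6.trans (by gcongr; exact hBw.trans (by gcongr))
        _ = _ := by rw [← h9]; ring
    simp only [QLConst.growth, add_mul]
    linarith

/-- The commutators are given separately at each level. They agree on the w ∈ X^{r+2} with Q(v)w ∈
X^{r+2}, where both are QA - AQ, and such w are dense. -/
theorem incl_commutator (h2 : D.H2 S c) (h3 : D.H3 S c) {r : ℕ} (hr : r + 1 ≤ m)
    (hv : v ∈ D.ballLow S c.δ0) {B : X (r + 1) →L[ℝ] X r} {B' : X (r + 2) →L[ℝ] X (r + 1)}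
    (hB : D.IsCommutator S r v B) (hB' : D.IsCommutator S (r + 1) v B') (w : X (r + 2)) :
    S.incl r (B' w) = B (S.incl (r + 1) w) := by
  obtain ⟨e, he, -⟩ := h3.exists_equiv hr hv
  have hdense : DenseRange fun z => e.symm (S.incl (r + 1) z) :=
    e.symm.surjective.denseRange.comp (S.denseRange (r + 1)) e.symm.continuous
  refine hdense.induction_on (p := fun w => S.incl r (B' w) = B (S.incl (r + 1) w)) w
    (isClosed_eq (by fun_prop) (by fun_prop)) fun z' => ?_
  set w := e.symm (S.incl (r + 1) z') with hw
  have hQw : D.Q (r + 1) v w = S.incl (r + 1) z' := by rw [he, hw, e.apply_symm_apply]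
  obtain ⟨y', hy1', hy2'⟩ := hB' w z' hQw.symm
  obtain ⟨y, hy1, hy2⟩ := hB (S.incl (r + 1) w) (S.incl (r + 1) z')
    (by rw [← h3.restrict r hr v hv w, hQw])
  have hy : y = S.incl (r + 1) y' :=
    S.injective r (by rw [hy1, hy1', h2.incl_Ab hr hv])
  rw [← hy2, ← hy2', map_sub, h3.restrict r hr v hv, h2.incl_Ab hr hv, hy]

/-- The resolvent of `A(v)` in `X^{r+1}`. -/
theorem exists_resolvent_of_denseRange [∀ r, CompleteSpace (X r)]
    (h1 : D.H1 S c) (h2 : D.H2 S c) (h3 : D.H3 S c)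
    {r : ℕ} (hr : r ≤ m) (hv : v ∈ D.ballLow S c.δ0) {B : X (r + 1) →L[ℝ] X r}
    (hB : D.IsCommutator S r v B) (hBn : ‖B‖ ≤ c.C0) {h : ℝ} (h0 : 0 < h)
    (hω : h * c.growth m ≤ 1 / 2)
    (hs : h * (4 * (c.CL * c.CQ ^ m) ^ 2 * c.CQ ^ 3 * c.C0) ≤ 1 / 2)
    (hd : DenseRange fun w => S.incl r w - h • D.Ab r v w) :
    ∃ J : X (r + 1) →L[ℝ] X (r + 1), (∀ g, S.incl r (J g) - h • D.Ab r v (J g) = S.incl r g) ∧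
      (∀ g, ‖J g‖ ≤ 4 * (c.CL * c.CQ ^ r) ^ 2 * c.CQ * c.CQ * ‖g‖) ∧
      ∀ g g' u' : X (r + 1), S.incl r u' - h • D.Ab r v u' = S.incl r g' →
        (1 - h * c.growth r) * formNorm (D.form v r) (D.Q r v (J g) - S.incl r u') ≤
          formNorm (D.form v r) (D.Q r v g + h • B (J g) - S.incl r g') := by
  have hL := c.CL_pos
  have hQ := c.CQ_pos
  have hC0 := c.C0_pos
  obtain ⟨e, he, hen⟩ := h3.exists_equiv hr hv
  have hω' : h * c.growth r ≤ 1 / 2 := hω.trans' (by gcongr; exact c.growth_mono hr)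
  have hs' : h * (2 * (c.CL * c.CQ ^ r) ^ 2 * c.C0 * c.CQ) ≤ 1 / 2 := by
    refine hs.trans' ?_
    have e1 : (c.CL * c.CQ ^ r) ^ 2 ≤ (c.CL * c.CQ ^ m) ^ 2 := by
      gcongr
      exact c.one_le_CQ
    have e2 : c.CQ ≤ c.CQ ^ 3 := le_self_pow₀ c.one_le_CQ (by norm_num)
    calc h * (2 * (c.CL * c.CQ ^ r) ^ 2 * c.C0 * c.CQ)
        = h * (2 * (c.CL * c.CQ ^ r) ^ 2 * c.CQ * c.C0) := by ring
      _ ≤ h * (4 * (c.CL * c.CQ ^ m) ^ 2 * c.CQ ^ 3 * c.C0) := by gcongr; norm_num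
  simp only [he]
  exact exists_resolvent (equivForm h1 h3 hv hr) (dissipative h1 h2 h3 hv hr) h0 hω' e B
    (fun w => by rw [← he]; exact h3.norm_apply_le hr hv w) hen hQ.le
    (fun w => B.le_of_opNorm_le hBn w) hC0.le hs'
    (fun w z hwz => by simpa only [← he] using hB w z (by rw [he]; exact hwz)) hd

/-- Density at level r gives the resolvent J in X^{r+1}. To solve w - hA(v)w = g in X^{r+2}, one
seeks z = Q(v)w with z = J(Q(v)g + hB'w), B' being the commutator one level up. So the range at
level r + 1 contains the dense subspace X^{r+2}. -/
theorem denseRange_sub_smul_Ab [∀ r, CompleteSpace (X r)]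
    (h1 : D.H1 S c) (h2 : D.H2 S c) (h3 : D.H3 S c) (hv : v ∈ D.ballLow S c.δ0)
    {h : ℝ} (h0 : 0 < h) (hω : h * c.growth m ≤ 1 / 2)
    (hs : h * (4 * (c.CL * c.CQ ^ m) ^ 2 * c.CQ ^ 3 * c.C0) ≤ 1 / 2) :
    ∀ {r : ℕ}, r ≤ m → DenseRange fun w => S.incl r w - h • D.Ab r v w := by
  have hL := c.CL_pos
  have hQ := c.CQ_pos
  have hC0 := c.C0_pos
  intro r
  induction r with
  | zero =>
    intro hr
    have h5 : h * c.ω ≤ 1 / 2 :=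
      hω.trans' (by gcongr; exact (le_abs_self _).trans (c.growth_mono hr))
    exact denseRange_sub_smul (equivForm h1 h3 hv hr) (h2.isClosed v hv) (h2.hasCore v hv)
      (fun w => h2.restrict 0 hr v hv w) (h2.dissipative v hv) (h2.surjective v hv) h0 (by linarith)
  | succ r ih =>
    intro hr
    have hr' : r ≤ m := by omega
    obtain ⟨B, -, hB⟩ := h3.commutator r hr'
    obtain ⟨B', -, hB'⟩ := h3.commutator (r + 1) hr
    obtain ⟨hBc, hBn⟩ := hB v hv
    obtain ⟨hBc', hBn'⟩ := hB' v hv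
    obtain ⟨J, hJ1, hJ2, -⟩ :=
      exists_resolvent_of_denseRange h1 h2 h3 hr' hv hBc hBn h0 hω hs (ih hr')
    obtain ⟨e, he, hen⟩ := h3.exists_equiv hr hv
    obtain ⟨e', he', -⟩ := h3.exists_equiv hr' hv
    refine (S.denseRange (r + 1)).mono ?_
    rintro _ ⟨g, rfl⟩
    -- The equation for z is z - Kz = J(Qg). The bound of `J` contributes C_Q² and Q⁻¹ one more
    -- factor, whence C_Q³ in `hs`.
    set K : X (r + 1) →L[ℝ] X (r + 1) :=
      h • (J.comp ((B' v).comp (e.symm : X (r + 1) →L[ℝ] X (r + 2)))) with hK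
    have hKy : ∀ y, K y = h • J (B' v (e.symm y)) := fun y => rfl
    have hKn : ‖K‖ < 1 := by
      refine lt_of_le_of_lt (K.opNorm_le_bound (by norm_num : (0 : ℝ) ≤ 1 / 2) fun y => ?_)
        (by norm_num)
      rw [hKy, norm_smul, Real.norm_of_nonneg h0.le]
      have e1 : (c.CL * c.CQ ^ r) ^ 2 ≤ (c.CL * c.CQ ^ m) ^ 2 := by
        gcongr
        exact c.one_le_CQ
      calc h * ‖J (B' v (e.symm y))‖
          ≤ h * (4 * (c.CL * c.CQ ^ r) ^ 2 * c.CQ * c.CQ * (c.C0 * (c.CQ * ‖y‖))) := by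
            gcongr
            refine (hJ2 _).trans ?_
            gcongr
            refine ((B' v).le_of_opNorm_le hBn' _).trans ?_
            gcongr
            exact hen y
        _ ≤ h * (4 * (c.CL * c.CQ ^ m) ^ 2 * c.CQ * c.CQ * (c.C0 * (c.CQ * ‖y‖))) := by gcongr
        _ = h * (4 * (c.CL * c.CQ ^ m) ^ 2 * c.CQ ^ 3 * c.C0) * ‖y‖ := by ring
        _ ≤ _ := by gcongr
    set U := Units.oneSub K hKn
    have hU : (1 - K) * ((U⁻¹ : (X (r + 1) →L[ℝ] X (r + 1))ˣ) : X (r + 1) →L[ℝ] X (r + 1)) = 1 :=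
      U.mul_inv
    obtain ⟨z, hz⟩ : ∃ z, z - K z = J (D.Q (r + 1) v g) :=
      ⟨_, congrArg (fun f : X (r + 1) →L[ℝ] X (r + 1) => f (J (D.Q (r + 1) v g))) hU⟩
    set w := e.symm z with hw
    have hQw : D.Q (r + 1) v w = z := by rw [he, hw, e.apply_symm_apply]
    have hzJ : J (D.Q (r + 1) v g + h • B' v w) = z := by
      rw [map_add, map_smul, ← hKy, ← hz]; abel
    have hz2 := hJ1 (D.Q (r + 1) v g + h • B' v w)
    rw [hzJ, map_add, map_smul, incl_commutator h2 h3 hr hv hBc hBc' w,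
      h3.restrict r hr v hv g] at hz2
    obtain ⟨y, hy1, hy2⟩ := hBc (S.incl (r + 1) w) z (by rw [← h3.restrict r hr v hv w, hQw])
    have hy : y = D.Ab (r + 1) v w := S.injective r (hy1.trans (h2.incl_Ab hr hv w).symm)
    refine ⟨w, ?_⟩
    -- The equation is checked after applying the injective Q(v) of the level below, where it
    -- becomes the resolvent equation `hz2` for z.
    refine e'.injective ?_
    rw [← he', ← he', map_sub, map_smul, ← hy, ← h3.restrict r hr v hv w, hQw]
    have h7 : D.Q r v y = B v (S.incl (r + 1) w) + D.Ab r v z := by rw [← hy2]; abel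
    rw [h7, smul_add, sub_add_eq_sub_sub_swap, hz2]
    abel

end QLData

open Filter Topology

/-! ### Linear interpolation and the energy inequality -/

section Interp

variable {E : Type*} [NormedAddCommGroup E] [NormedSpace ℝ E]

/-- Piecewise linear interpolation of a sequence. -/
noncomputable def interp (a : ℕ → E) (s : ℝ) : E :=
  a ⌊s⌋₊ + (s - ⌊s⌋₊) • (a (⌊s⌋₊ + 1) - a ⌊s⌋₊)

theorem interp_eq (a : ℕ → E) {n : ℕ} {s : ℝ} (h1 : n ≤ s) (h2 : s ≤ n + 1) :
    interp a s = a n + (s - n) • (a (n + 1) - a n) := by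
  have hs : 0 ≤ s := n.cast_nonneg.trans h1
  rcases h2.eq_or_lt with h | h
  · have hf : ⌊s⌋₊ = n + 1 := by rw [h]; exact_mod_cast Nat.floor_natCast (n + 1)
    rw [interp, hf, h]
    simp
  · rw [interp, (Nat.floor_eq_iff hs).2 ⟨h1, h⟩]

theorem interp_natCast (a : ℕ → E) (n : ℕ) : interp a n = a n := by simp [interp]

theorem interp_zero (a : ℕ → E) : interp a 0 = a 0 := by simp [interp]

theorem continuous_interp (a : ℕ → E) : Continuous (interp a) := by
  have h : ∀ n : ℕ, ContinuousOn (interp a) (Iic n) := by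
    intro n
    induction n with
    | zero =>
      have h1 : EqOn (interp a) (fun s => a 0 + s • (a 1 - a 0)) (Iic ((0 : ℕ) : ℝ)) := by
        intro s hs
        have : ⌊s⌋₊ = 0 := Nat.floor_of_nonpos (by simpa using hs)
        simp [interp, this]
      exact ContinuousOn.congr (by fun_prop) h1
    | succ n ih =>
      have h1 : EqOn (interp a) (fun s => a n + (s - n) • (a (n + 1) - a n))
          (Icc (n : ℝ) (n + 1)) := fun s hs => interp_eq a hs.1 hs.2
      have h2 : ContinuousOn (interp a) (Icc (n : ℝ) (n + 1)) :=
        ContinuousOn.congr (by fun_prop) h1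
      have h3 := ih.union_of_isClosed h2 isClosed_Iic isClosed_Icc
      refine h3.mono fun s hs => ?_
      rcases le_total s n with h | h
      · exact Or.inl h
      · exact Or.inr ⟨h, by simpa using hs⟩
  refine continuous_iff_continuousAt.2 fun t => ?_
  obtain ⟨n, hn⟩ := exists_nat_gt t
  exact (h n).continuousAt (Iic_mem_nhds hn)

theorem hasDerivWithinAt_interp (a : ℕ → E) {h t : ℝ} (h0 : 0 < h) (ht : 0 ≤ t) :
    HasDerivWithinAt (fun t => interp a (t / h)) (h⁻¹ • (a (⌊t / h⌋₊ + 1) - a ⌊t / h⌋₊))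
      (Ici t) t := by
  set n := ⌊t / h⌋₊ with hn
  have h1 : (n : ℝ) ≤ t / h := Nat.floor_le (by positivity)
  have h2 : t / h < n + 1 := Nat.lt_floor_add_one _
  have h3 : HasDerivAt (fun t : ℝ => a n + (t / h - n) • (a (n + 1) - a n))
      (h⁻¹ • (a (n + 1) - a n)) t := by
    have h4 : HasDerivAt (fun t : ℝ => t / h - n) (h⁻¹) t := by
      simpa [one_div] using ((hasDerivAt_id t).div_const h).sub_const (n : ℝ)
    exact (h4.smul_const _).const_add _
  refine h3.hasDerivWithinAt.congr_of_eventuallyEq ?_ (interp_eq a h1 h2.le)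
  have h5 : Iio ((n + 1) * h) ∈ 𝓝 t := Iio_mem_nhds (by rwa [div_lt_iff₀ h0] at h2)
  filter_upwards [self_mem_nhdsWithin, mem_nhdsWithin_of_mem_nhds h5] with s hs hs'
  refine interp_eq a (h1.trans ?_) ?_
  · gcongr; exact hs
  · rw [div_le_iff₀ h0]; exact (hs' : s < _).le

theorem interp_mem_segment (a : ℕ → E) {s : ℝ} (hs : 0 ≤ s) :
    interp a s ∈ segment ℝ (a ⌊s⌋₊) (a (⌊s⌋₊ + 1)) := by
  rw [segment_eq_image']
  exact ⟨s - ⌊s⌋₊, ⟨sub_nonneg.2 (Nat.floor_le hs), by linarith [Nat.lt_floor_add_one s]⟩, rfl⟩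

theorem norm_sub_endpoints_le_of_mem_segment {x y z : E} (h : z ∈ segment ℝ x y) :
    ‖z - x‖ ≤ ‖y - x‖ ∧ ‖z - y‖ ≤ ‖y - x‖ := by
  constructor
  · have := (convex_closedBall x ‖y - x‖).segment_subset (x := x) (y := y)
      (by simp) (by simp [dist_eq_norm]) h
    simpa [dist_eq_norm] using this
  · have := (convex_closedBall y ‖y - x‖).segment_subset (x := x) (y := y)
      (by simp [dist_eq_norm, norm_sub_rev]) (by simp) h
    simpa [dist_eq_norm] using this

theorem norm_sub_le_of_mem_segments {x y x' y' z z' : E} {d : ℝ} (h : z ∈ segment ℝ x y)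
    (h' : z' ∈ segment ℝ x' y') (h1 : ‖x - x'‖ ≤ d) (h2 : ‖x - y'‖ ≤ d) (h3 : ‖y - x'‖ ≤ d)
    (h4 : ‖y - y'‖ ≤ d) : ‖z - z'‖ ≤ d := by
  have key : ∀ u, ‖x - u‖ ≤ d → ‖y - u‖ ≤ d → ‖u - z‖ ≤ d := by
    intro u hx hy
    have := (convex_closedBall u d).segment_subset (x := x) (y := y)
      (by simpa [dist_eq_norm] using hx) (by simpa [dist_eq_norm] using hy) h
    rw [norm_sub_rev]
    simpa [dist_eq_norm] using this
  have := (convex_closedBall z d).segment_subset (x := x') (y := y')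
    (by simpa [dist_eq_norm] using key x' h1 h3) (by simpa [dist_eq_norm] using key y' h2 h4) h'
  rw [norm_sub_rev]
  simpa [dist_eq_norm] using this

end Interp

/-- From e^x - 1 ≤ x e^x; the bound has no division by K. -/
theorem gronwallBound_le {δ K ε x : ℝ} (hK : 0 < K) (hε : 0 ≤ ε) :
    gronwallBound δ K ε x ≤ Real.exp (K * x) * (δ + ε * x) := by
  rw [gronwallBound_of_K_ne_0 hK.ne']
  have h1 : Real.exp (K * x) - 1 ≤ K * x * Real.exp (K * x) := by
    have h2 := Real.add_one_le_exp (-(K * x))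
    have h3 : Real.exp (-(K * x)) * Real.exp (K * x) = 1 := by rw [← Real.exp_add]; simp
    nlinarith [Real.exp_pos (K * x)]
  calc δ * Real.exp (K * x) + ε / K * (Real.exp (K * x) - 1)
      ≤ δ * Real.exp (K * x) + ε / K * (K * x * Real.exp (K * x)) := by gcongr
    _ = _ := by field_simp

/-- Energy estimate for a time dependent inner product. -/
theorem form_le_of_deriv_le {Y : Type*} [NormedAddCommGroup Y] [NormedSpace ℝ Y]
    {ℓ : Y → (Y →L[ℝ] Y →L[ℝ] ℝ)} {s : Set Y} {M Λ cL T K κ : ℝ}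
    (hl : ∀ v ∈ s, EquivForm (ℓ v) M) (hΛ : 0 ≤ Λ) (hcL : 0 ≤ cL) (hK : 0 < K) (hκ : 0 ≤ κ)
    (lip : ∀ v ∈ s, ∀ v' ∈ s, ∀ x y, |ℓ v x y - ℓ v' x y| ≤ Λ * ‖v - v'‖ * ‖x‖ * ‖y‖)
    {p w w' : ℝ → Y} (hp : ∀ t ∈ Icc 0 T, p t ∈ s)
    (hpL : ∀ t ∈ Icc 0 T, ∀ t' ∈ Icc 0 T, ‖p t - p t'‖ ≤ cL * |t - t'|)
    (hw : ContinuousOn w (Icc 0 T))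
    (hw' : ∀ t ∈ Ico 0 T, HasDerivWithinAt w (w' t) (Ici t) t)
    (bound : ∀ t ∈ Ico 0 T, 2 * ℓ (p t) (w t) (w' t) ≤ K * ℓ (p t) (w t) (w t) + κ) :
    ∀ t ∈ Icc 0 T, ℓ (p t) (w t) (w t) ≤
      Real.exp ((K + Λ * cL * M ^ 2) * t) * (ℓ (p 0) (w 0) (w 0) + κ * t) := by
  have hop : ∀ v ∈ s, ∀ v' ∈ s, ‖ℓ v - ℓ v'‖ ≤ Λ * ‖v - v'‖ := fun v hv v' hv' =>
    (ℓ v - ℓ v').opNorm_le_bound₂ (by positivity) fun x y => lip v hv v' hv' x y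
  have hℓp : ContinuousOn (fun t => ℓ (p t)) (Icc 0 T) := by
    have hlip : LipschitzOnWith (Real.toNNReal (Λ * cL)) (fun t => ℓ (p t)) (Icc 0 T) := by
      refine LipschitzOnWith.of_dist_le_mul fun t ht t' ht' => ?_
      rw [dist_eq_norm, Real.dist_eq, Real.coe_toNNReal _ (by positivity)]
      refine (hop _ (hp t ht) _ (hp t' ht')).trans ?_
      rw [mul_assoc]
      exact mul_le_mul_of_nonneg_left (hpL t ht t' ht') hΛ
    exact hlip.continuousOn
  intro t ht
  -- As `p` is only Lipschitz, the energy need not be differentiable. Its difference quotient splits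
  -- into one with the form frozen at the left point, which converges, and the change of the form,
  -- at most Λ cL ‖w‖².
  have hG := le_gronwallBound_of_liminf_deriv_right_le (f := fun t => ℓ (p t) (w t) (w t))
    (f' := fun t => 2 * ℓ (p t) (w t) (w' t) + Λ * cL * ‖w t‖ ^ 2)
    (δ := ℓ (p 0) (w 0) (w 0)) (K := K + Λ * cL * M ^ 2) (ε := κ) (a := 0) (b := T)
    ((hℓp.clm_apply hw).clm_apply hw) ?_ le_rfl ?_ t ht
  · rw [sub_zero] at hG
    exact hG.trans (gronwallBound_le (by positivity) hκ)
  · intro x hx r hr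
    have hx' : x ∈ Icc 0 T := ⟨hx.1, hx.2.le⟩
    have hsym := (hl _ (hp x hx')).symm
    have hd : HasDerivWithinAt (fun z => ℓ (p x) (w z) (w z)) (2 * ℓ (p x) (w x) (w' x))
        (Ici x) x := by
      have h1 := hw' x hx
      have h2 : HasDerivWithinAt (fun z => ℓ (p x) (w z)) (ℓ (p x) (w' x)) (Ici x) x :=
        (ℓ (p x)).hasFDerivAt.comp_hasDerivWithinAt x h1
      have h3 := h2.clm_apply h1
      refine h3.congr_deriv ?_
      rw [hsym (w' x) (w x)]; ring
    have hd' := (hasDerivWithinAt_iff_tendsto_slope' self_notMem_Ioi).1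
      (hd.mono Ioi_subset_Ici_self)
    have hwc : Tendsto (fun z => Λ * cL * ‖w z‖ ^ 2) (𝓝[>] x) (𝓝 (Λ * cL * ‖w x‖ ^ 2)) := by
      have : Tendsto w (𝓝[>] x) (𝓝 (w x)) :=
        ((hw' x hx).continuousWithinAt.mono Ioi_subset_Ici_self)
      exact (this.norm.pow 2).const_mul _
    have hT : Ioo x T ∈ 𝓝[>] x := Ioo_mem_nhdsGT hx.2
    refine Eventually.frequently ?_
    filter_upwards [(hd'.add hwc).eventually_lt_const hr, hT] with z hz hzT
    refine lt_of_le_of_lt ?_ hz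
    have hzx : 0 < z - x := sub_pos.2 hzT.1
    have hz' : z ∈ Icc 0 T := ⟨hx.1.trans hzT.1.le, hzT.2.le⟩
    have h6 := le_of_abs_le (lip _ (hp z hz') _ (hp x hx') (w z) (w z))
    have h7 := hpL z hz' x hx'
    rw [abs_of_pos hzx] at h7
    have h8 : Λ * ‖p z - p x‖ * ‖w z‖ * ‖w z‖ ≤ Λ * (cL * (z - x)) * ‖w z‖ * ‖w z‖ := by gcongr
    rw [slope_def_field, inv_mul_le_iff₀ hzx, mul_add, mul_div_cancel₀ _ hzx.ne']
    linarith
  · intro x hx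
    have hx' : x ∈ Icc 0 T := ⟨hx.1, hx.2.le⟩
    have h1 := (hl _ (hp x hx')).lower (w x)
    have h2 := bound x hx
    have h3 : Λ * cL * ‖w x‖ ^ 2 ≤ Λ * cL * (M ^ 2 * ℓ (p x) (w x) (w x)) := by gcongr
    linarith

/-! ### The abstract pair Z ⊂ Y and comparison of paths in Y -/

/-- The constants for a quasilinear equation in a pair of spaces. -/
structure PairConst where
  M : ℝ
  q : ℝ
  C : ℝ
  δ0 : ℝ
  δ : ℝ
  R : ℝ
  R0 : ℝ
  h0 : ℝ
  one_le_M : 1 ≤ M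
  M_le_C : M ≤ C
  one_le_q : 1 ≤ q
  q_le_C : q ≤ C
  δ_lt : δ < δ0
  R_pos : 0 < R
  -- Passing from the norm of Z to |Q(v)·|_{L(v)} and back costs a factor M q each way, so M²q²R is
  -- the a priori bound at T = 0.
  R_lt : M ^ 2 * q ^ 2 * R < R0
  R0_le_C : R0 ≤ C
  h0_pos : 0 < h0

/-- The objects in the equation `v_t = A(v) v + f(v)` in a pair of spaces `Z ⊆ Y`. -/
structure KatoPair (Y Z : Type*) [NormedAddCommGroup Y] [NormedSpace ℝ Y]
    [NormedAddCommGroup Z] [NormedSpace ℝ Z] where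
  y0 : Y
  ι : Z →L[ℝ] Y
  A : Y → (Z →L[ℝ] Y)
  ℓ : Y → (Y →L[ℝ] Y →L[ℝ] ℝ)
  Q : Y → (Z →L[ℝ] Y)
  B : Y → (Z →L[ℝ] Y)
  f : Z → Z

namespace KatoPair

variable {Y Z : Type*} [NormedAddCommGroup Y] [NormedSpace ℝ Y]
  [NormedAddCommGroup Z] [NormedSpace ℝ Z]

/-- The domain of the nonlinearity. -/
def dom (P : KatoPair Y Z) (δ R : ℝ) : Set Z := {v | P.ι v ∈ ball P.y0 δ ∧ v ∈ ball (0 : Z) R}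

/-- The assumptions of the existence theorem. -/
structure IsGood (P : KatoPair Y Z) (c : PairConst) : Prop where
  denseRange : DenseRange P.ι
  norm_ι : ∀ w, ‖P.ι w‖ ≤ c.C * ‖w‖
  form : ∀ v ∈ ball P.y0 c.δ0, EquivForm (P.ℓ v) c.M
  form_lip : ∀ v ∈ ball P.y0 c.δ0, ∀ v' ∈ ball P.y0 c.δ0, ∀ x y,
    |P.ℓ v x y - P.ℓ v' x y| ≤ c.C * ‖v - v'‖ * ‖x‖ * ‖y‖
  A_norm : ∀ v ∈ ball P.y0 c.δ0, ∀ w, ‖P.A v w‖ ≤ c.C * ‖w‖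
  A_lip : ∀ v ∈ ball P.y0 c.δ0, ∀ v' ∈ ball P.y0 c.δ0, ∀ w,
    ‖P.A v w - P.A v' w‖ ≤ c.C * ‖v - v'‖ * ‖w‖
  diss : ∀ v ∈ ball P.y0 c.δ0, ∀ w, P.ℓ v (P.ι w) (P.A v w) ≤ c.C * P.ℓ v (P.ι w) (P.ι w)
  Q_norm : ∀ v ∈ ball P.y0 c.δ0, ∀ w, ‖P.Q v w‖ ≤ c.q * ‖w‖
  Q_inv : ∀ v ∈ ball P.y0 c.δ0, ∀ w, ‖w‖ ≤ c.q * ‖P.Q v w‖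
  Q_contDiff : ContDiffOn ℝ 1 P.Q (ball P.y0 c.δ0)
  Q_lip : ∀ v ∈ ball P.y0 c.δ0, ∀ v' ∈ ball P.y0 c.δ0, ∀ w,
    ‖P.Q v w - P.Q v' w‖ ≤ c.C * ‖v - v'‖ * ‖w‖
  fderiv_Q : ∀ v ∈ ball P.y0 c.δ0, ‖fderiv ℝ P.Q v‖ ≤ c.C
  B_cont : ContinuousOn P.B (ball P.y0 c.δ0)
  B_norm : ∀ v ∈ ball P.y0 c.δ0, ∀ w, ‖P.B v w‖ ≤ c.C * ‖w‖
  -- The resolvent of Y is not named. The second clause expresses that it maps Q(v)g + hB(v)u to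
  -- Q(v)u, through the distance to solutions u' in Z.
  resolvent : ∀ v ∈ ball P.y0 c.δ0, ∀ h, 0 < h → h ≤ c.h0 → ∀ g, ∃ u,
    P.ι u - h • P.A v u = P.ι g ∧ ∀ g' u', P.ι u' - h • P.A v u' = P.ι g' →
      (1 - h * c.C) * formNorm (P.ℓ v) (P.Q v u - P.ι u') ≤
        formNorm (P.ℓ v) (P.Q v g + h • P.B v u - P.ι g')
  f_cont : ContinuousOn P.f (P.dom c.δ0 c.R0)
  f_norm : ∀ v ∈ P.dom c.δ0 c.R0, ‖P.f v‖ ≤ c.C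
  f_lip : ∀ v ∈ P.dom c.δ0 c.R0, ∀ v' ∈ P.dom c.δ0 c.R0,
    ‖P.ι (P.f v) - P.ι (P.f v')‖ ≤ c.C * ‖P.ι v - P.ι v'‖

end KatoPair

namespace PairConst

variable (c : PairConst)

theorem one_le_C : 1 ≤ c.C := c.one_le_M.trans c.M_le_C

theorem C_pos : 0 < c.C := one_pos.trans_le c.one_le_C

theorem M_pos : 0 < c.M := one_pos.trans_le c.one_le_M

theorem q_pos : 0 < c.q := one_pos.trans_le c.one_le_q

/-- The growth rate in the comparison of two paths. -/
noncomputable def cmp (β κ cL : ℝ) : ℝ :=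
  4 * c.C + 16 * c.C * c.M ^ 2 + 8 * c.M ^ 2 * c.C * β +
    2 * c.M ^ 4 * (2 * c.C * β + 1) * (κ + 1) + c.C * cL * c.M ^ 2

end PairConst

namespace KatoPair

variable {Y Z : Type*} [NormedAddCommGroup Y] [NormedSpace ℝ Y]
  [NormedAddCommGroup Z] [NormedSpace ℝ Z]

/-- `q` satisfies `q' = A(a) b + γ`, where `b` is bounded by `β` in `Z` and `ε`-close to `q`. -/
structure IsPath (P : KatoPair Y Z) (c : PairConst) (T β ε : ℝ) (q a : ℝ → Y) (b : ℝ → Z)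
    (γ : ℝ → Y) : Prop where
  cont : ContinuousOn q (Icc 0 T)
  deriv : ∀ t ∈ Ico 0 T, HasDerivWithinAt q (P.A (a t) (b t) + γ t) (Ici t) t
  mem : ∀ t ∈ Ico 0 T, a t ∈ ball P.y0 c.δ0
  norm_le : ∀ t ∈ Ico 0 T, ‖b t‖ ≤ β
  close : ∀ t ∈ Ico 0 T, ‖q t - P.ι (b t)‖ ≤ ε

variable {P : KatoPair Y Z} {c : PairConst}

/-- Dissipativity applies to d = b1 - b2 in Z, but the energy is that of w = q1 - q2 in Y. Their
difference e is O(ε) and is paired with A(p)d, bounded because ‖d‖ ≤ 2β. Replacing a1 and a2 by p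
likewise puts the derivative on b1 and b2. The assumption ε ≤ 1 turns ε² into ε. -/
theorem IsGood.two_form_le (hP : P.IsGood c) {β κ ε : ℝ} (hβ : 0 ≤ β) (hκ : 0 ≤ κ)
    (hε : 0 ≤ ε) (hε1 : ε ≤ 1) {p a1 a2 q1 q2 γ1 γ2 : Y} {b1 b2 : Z}
    (hp : p ∈ ball P.y0 c.δ0) (ha1 : a1 ∈ ball P.y0 c.δ0) (ha2 : a2 ∈ ball P.y0 c.δ0)
    (hb1 : ‖b1‖ ≤ β) (hb2 : ‖b2‖ ≤ β) (hq1 : ‖q1 - P.ι b1‖ ≤ ε) (hq2 : ‖q2 - P.ι b2‖ ≤ ε)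
    (hap1 : ‖a1 - p‖ ≤ κ * ‖q1 - q2‖ + ε) (hap2 : ‖a2 - p‖ ≤ κ * ‖q1 - q2‖ + ε)
    (hγ : ‖γ1 - γ2‖ ≤ κ * ‖q1 - q2‖ + ε) :
    2 * P.ℓ p (q1 - q2) (P.A a1 b1 + γ1 - (P.A a2 b2 + γ2)) ≤
      (4 * c.C + 2 * c.M ^ 4 * (2 * c.C * β + 1) * (κ + 1)) * P.ℓ p (q1 - q2) (q1 - q2) +
        (16 * c.C * c.M ^ 2 + 8 * c.M ^ 2 * c.C * β + c.M ^ 2 * (2 * c.C * β + 1)) * ε := by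
  have hC := c.C_pos
  have hM := c.M_pos
  have hl := hP.form p hp
  set w := q1 - q2 with hw
  set d := b1 - b2 with hd
  set e := w - P.ι d with he
  set rem := P.A a1 b1 + γ1 - (P.A a2 b2 + γ2) - P.A p d with hrem
  have hdn : ‖d‖ ≤ 2 * β := (norm_sub_le _ _).trans (by linarith)
  have hen : ‖e‖ ≤ 2 * ε := by
    have : e = (q1 - P.ι b1) - (q2 - P.ι b2) := by rw [he, hw, hd, map_sub]; abel
    rw [this]
    exact (norm_sub_le _ _).trans (by linarith)
  have hremn : ‖rem‖ ≤ (2 * c.C * β + 1) * (κ * ‖w‖ + ε) := by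
    have h1 : rem = (P.A a1 b1 - P.A p b1) - (P.A a2 b2 - P.A p b2) + (γ1 - γ2) := by
      rw [hrem, hd, map_sub]; abel
    have h2 := hP.A_lip a1 ha1 p hp b1
    have h3 := hP.A_lip a2 ha2 p hp b2
    have h4 : c.C * ‖a1 - p‖ * ‖b1‖ ≤ c.C * (κ * ‖w‖ + ε) * β := by gcongr
    have h5 : c.C * ‖a2 - p‖ * ‖b2‖ ≤ c.C * (κ * ‖w‖ + ε) * β := by gcongr
    rw [h1]
    refine (norm_add_le _ _).trans ?_
    have := norm_sub_le (P.A a1 b1 - P.A p b1) (P.A a2 b2 - P.A p b2)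
    linarith
  have e1 := hP.diss p hp d
  have e2 := (abs_le.1 (hl.abs_apply_le_norm e (P.A p d))).2
  have e3 := (abs_le.1 (hl.abs_apply_le_norm w rem)).2
  have hAd := hP.A_norm p hp d
  have e2' : P.ℓ p e (P.A p d) ≤ c.M ^ 2 * (2 * ε) * (c.C * (2 * β)) :=
    e2.trans (by gcongr; exact hAd.trans (by gcongr))
  have e3' : P.ℓ p w rem ≤ c.M ^ 2 * ‖w‖ * ((2 * c.C * β + 1) * (κ * ‖w‖ + ε)) :=
    e3.trans (by gcongr)
  have e4 : P.ℓ p (P.ι d) (P.ι d) ≤ 2 * P.ℓ p w w + 2 * (c.M ^ 2 * (2 * ε) ^ 2) := by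
    have h1 : P.ι d = w - e := by rw [he]; abel
    have h2 := hl.nonneg (w + e)
    have h3 : P.ℓ p e e ≤ c.M ^ 2 * (2 * ε) ^ 2 := (hl.upper e).trans (by gcongr)
    have h4 := hl.symm w e
    rw [h1]
    simp only [map_sub, map_add, sub_apply, add_apply] at h2 ⊢
    linarith
  have e5 : P.ℓ p w (P.A a1 b1 + γ1 - (P.A a2 b2 + γ2)) =
      P.ℓ p (P.ι d) (P.A p d) + P.ℓ p e (P.A p d) + P.ℓ p w rem := by
    have h1 : P.A a1 b1 + γ1 - (P.A a2 b2 + γ2) = P.A p d + rem := by rw [hrem]; abel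
    have h2 : P.ℓ p w (P.A p d) = P.ℓ p (P.ι d + e) (P.A p d) := by rw [he, add_sub_cancel]
    rw [h1, map_add, h2, map_add, add_apply]
  have e6 := hl.lower w
  have hεε : ε ^ 2 ≤ ε := by nlinarith
  have hwε : ‖w‖ * ε ≤ (‖w‖ ^ 2 + ε) / 2 := by nlinarith [sq_nonneg (‖w‖ - ε)]
  rw [e5]
  set N := P.ℓ p w w with hN
  have hN0 : 0 ≤ N := hl.nonneg w
  have e7 : ‖w‖ * (κ * ‖w‖ + ε) ≤ (κ + 1) * (c.M ^ 2 * N) + ε / 2 := by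
    have : ‖w‖ * (κ * ‖w‖ + ε) = κ * ‖w‖ ^ 2 + ‖w‖ * ε := by ring
    have h2 : κ * ‖w‖ ^ 2 ≤ κ * (c.M ^ 2 * N) := by gcongr
    have h3 : 0 ≤ c.M ^ 2 * N := by positivity
    linarith
  have e8 : c.M ^ 2 * ‖w‖ * ((2 * c.C * β + 1) * (κ * ‖w‖ + ε)) ≤
      c.M ^ 2 * (2 * c.C * β + 1) * ((κ + 1) * (c.M ^ 2 * N) + ε / 2) := by
    calc _ = c.M ^ 2 * (2 * c.C * β + 1) * (‖w‖ * (κ * ‖w‖ + ε)) := by ring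
      _ ≤ _ := by gcongr
  have e9 : c.C * P.ℓ p (P.ι d) (P.ι d) ≤ c.C * (2 * N + 8 * c.M ^ 2 * ε) := by
    gcongr
    refine e4.trans ?_
    nlinarith [sq_nonneg c.M]
  linarith

/-- Two paths with nearly the same coefficients and forcing remain close. -/
theorem IsGood.compare (hP : P.IsGood c) {T β κ cL ε : ℝ} (hβ : 0 ≤ β) (hκ : 0 ≤ κ)
    (hcL : 0 ≤ cL) (hε : 0 ≤ ε) (hε1 : ε ≤ 1) {p a1 a2 q1 q2 γ1 γ2 : ℝ → Y} {b1 b2 : ℝ → Z}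
    (hp : ∀ t ∈ Icc 0 T, p t ∈ ball P.y0 c.δ0)
    (hpL : ∀ t ∈ Icc 0 T, ∀ t' ∈ Icc 0 T, ‖p t - p t'‖ ≤ cL * |t - t'|)
    (h1 : P.IsPath c T β ε q1 a1 b1 γ1) (h2 : P.IsPath c T β ε q2 a2 b2 γ2)
    (hap1 : ∀ t ∈ Ico 0 T, ‖a1 t - p t‖ ≤ κ * ‖q1 t - q2 t‖ + ε)
    (hap2 : ∀ t ∈ Ico 0 T, ‖a2 t - p t‖ ≤ κ * ‖q1 t - q2 t‖ + ε)
    (hγ : ∀ t ∈ Ico 0 T, ‖γ1 t - γ2 t‖ ≤ κ * ‖q1 t - q2 t‖ + ε) :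
    ∀ t ∈ Icc 0 T, ‖q1 t - q2 t‖ ^ 2 ≤ c.M ^ 2 * (Real.exp (c.cmp β κ cL * t) *
      (c.M ^ 2 * ‖q1 0 - q2 0‖ ^ 2 + c.cmp β κ cL * ε * t)) := by
  intro t ht
  have hC := c.C_pos
  have hM := c.M_pos
  have h0 : (0 : ℝ) ∈ Icc 0 T := ⟨le_rfl, ht.1.trans ht.2⟩
  have key := form_le_of_deriv_le (s := ball P.y0 c.δ0) (T := T)
    (K := 4 * c.C + 2 * c.M ^ 4 * (2 * c.C * β + 1) * (κ + 1))
    (κ := (16 * c.C * c.M ^ 2 + 8 * c.M ^ 2 * c.C * β + c.M ^ 2 * (2 * c.C * β + 1)) * ε)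
    hP.form hC.le hcL (by positivity) (by positivity) hP.form_lip hp hpL
    (w := fun t => q1 t - q2 t)
    (w' := fun t => P.A (a1 t) (b1 t) + γ1 t - (P.A (a2 t) (b2 t) + γ2 t)) (h1.cont.sub h2.cont)
    (fun t ht => (h1.deriv t ht).sub (h2.deriv t ht))
    (fun t ht => hP.two_form_le hβ hκ hε hε1 (hp t (Ico_subset_Icc_self ht))
      (h1.mem t ht) (h2.mem t ht) (h1.norm_le t ht) (h2.norm_le t ht) (h1.close t ht)
      (h2.close t ht) (hap1 t ht) (hap2 t ht) (hγ t ht)) t ht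
  have hl := hP.form _ (hp t ht)
  have hl0 := hP.form _ (hp 0 h0)
  refine (hl.lower _).trans ?_
  have ht0 := ht.1
  have hn0 := hl0.nonneg (q1 0 - q2 0)
  gcongr
  refine key.trans ?_
  have e1 : 16 * c.C * c.M ^ 2 + 8 * c.M ^ 2 * c.C * β + c.M ^ 2 * (2 * c.C * β + 1) ≤
      c.cmp β κ cL := by
    have h3 : c.M ^ 2 * (2 * c.C * β + 1) ≤ c.M ^ 4 * (2 * c.C * β + 1) := by
      gcongr
      exacts [c.one_le_M, by norm_num]
    have h4 : 0 ≤ c.M ^ 4 * (2 * c.C * β + 1) * (2 * κ + 1) := by positivity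
    have h5 : 0 ≤ c.C * cL * c.M ^ 2 := by positivity
    unfold PairConst.cmp
    linarith
  have e2 : 4 * c.C + 2 * c.M ^ 4 * (2 * c.C * β + 1) * (κ + 1) + c.C * cL * c.M ^ 2 ≤
      c.cmp β κ cL := by
    have h5 : 0 ≤ 16 * c.C * c.M ^ 2 + 8 * c.M ^ 2 * c.C * β := by positivity
    unfold PairConst.cmp
    linarith
  gcongr
  exact hl0.upper _

end KatoPair

/-! ### Time of existence and bounds in Z for implicit Euler steps -/

namespace PairConst

variable (c : PairConst)

/-- Growth rate of a resolvent step in `Z`. -/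
noncomputable def resRate : ℝ := 2 * (c.C + c.M ^ 2 * c.C * c.q)

/-- Growth rate of the norm of `Z` under a change of the coefficient. -/
noncomputable def shiftRate : ℝ := c.C * c.M ^ 2 + c.M ^ 2 * c.C * c.q

/-- Growth rate of the implicit Euler scheme in `Z`. -/
noncomputable def rate : ℝ := c.resRate + c.shiftRate * (2 * c.C ^ 2) + c.M * c.q * c.C

/-- Bound in `Z` for the implicit Euler scheme on `[0, T]`. -/
noncomputable def bound (T : ℝ) : ℝ :=
  c.q * c.M * (Real.exp (c.rate * T) * (c.M * c.q * c.R + c.rate * T))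

theorem resRate_pos : 0 < c.resRate := by
  have := c.M_pos; have := c.q_pos; have := c.C_pos
  unfold resRate; positivity

theorem shiftRate_pos : 0 < c.shiftRate := by
  have := c.M_pos; have := c.q_pos; have := c.C_pos
  unfold shiftRate; positivity

theorem rate_pos : 0 < c.rate := by
  have := c.M_pos; have := c.q_pos; have := c.C_pos
  have := c.resRate_pos; have := c.shiftRate_pos
  unfold rate; positivity

theorem resRate_le_rate : c.resRate ≤ c.rate := by
  have := c.M_pos; have := c.q_pos; have := c.C_pos
  have h := c.shiftRate_pos
  have : 0 ≤ c.shiftRate * (2 * c.C ^ 2) := by positivity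
  have : 0 ≤ c.M * c.q * c.C := by positivity
  unfold rate; linarith

/-- The conditions on the time of existence. -/
structure IsTime (T : ℝ) : Prop where
  pos : 0 < T
  le_h0 : T ≤ c.h0
  rate_le : T * c.rate ≤ 1 / 2
  bound_lt : c.bound T < c.R0
  drift : 2 * c.C ^ 2 * T ≤ (c.δ0 - c.δ) / 2
  -- The energy bounds a squared distance, so 16 yields the factor 4 in the Lipschitz estimate.
  cmp_le : Real.exp (c.cmp c.C c.C (2 * c.C ^ 2) * T) ≤ 16
  -- Bounds the feedback of the distance in Z on the images Q(v_n)v_n in `ImageClose.half`.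
  contraction : c.M * (Real.exp (c.rate * T) * (c.M * (T * (8 * c.C ^ 4)))) ≤ 1 / 16

/-- Each condition other than positivity holds strictly at T = 0 and is continuous in T. Thus T is
chosen from the constants alone. -/
theorem exists_isTime : ∃ T, c.IsTime T := by
  have e2 : ∀ᶠ T in 𝓝 (0 : ℝ), T ≤ c.h0 := eventually_le_nhds c.h0_pos
  have e3 : ∀ᶠ T in 𝓝 (0 : ℝ), T * c.rate ≤ 1 / 2 :=
    Tendsto.eventually_le_const (show (0 : ℝ) * c.rate < 1 / 2 by norm_num)
      (Continuous.tendsto (by fun_prop) 0)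
  have e4 : ∀ᶠ T in 𝓝 (0 : ℝ), c.bound T < c.R0 := by
    have hc : Continuous c.bound := by unfold bound; fun_prop
    have := hc.tendsto 0
    refine this.eventually_lt_const ?_
    have := c.R_lt
    simp only [bound, mul_zero, Real.exp_zero, add_zero, one_mul]
    linarith
  have e5 : ∀ᶠ T in 𝓝 (0 : ℝ), 2 * c.C ^ 2 * T ≤ (c.δ0 - c.δ) / 2 :=
    Tendsto.eventually_le_const (show 2 * c.C ^ 2 * (0 : ℝ) < (c.δ0 - c.δ) / 2 by
      have := c.δ_lt; linarith) (Continuous.tendsto (by fun_prop) 0)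
  have e6 : ∀ᶠ T in 𝓝 (0 : ℝ), Real.exp (c.cmp c.C c.C (2 * c.C ^ 2) * T) ≤ 16 :=
    Tendsto.eventually_le_const
      (show Real.exp (c.cmp c.C c.C (2 * c.C ^ 2) * 0) < 16 by norm_num)
      (Continuous.tendsto (by fun_prop) 0)
  have e7 : ∀ᶠ T in 𝓝 (0 : ℝ),
      c.M * (Real.exp (c.rate * T) * (c.M * (T * (8 * c.C ^ 4)))) ≤ 1 / 16 :=
    Tendsto.eventually_le_const
      (show c.M * (Real.exp (c.rate * 0) * (c.M * (0 * (8 * c.C ^ 4)))) < 1 / 16 by norm_num)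
      (Continuous.tendsto (by fun_prop) 0)
  have e1 : ∀ᶠ T in 𝓝[>] (0 : ℝ), 0 < T := self_mem_nhdsWithin
  have h := e1.and ((e2.and (e3.and (e4.and (e5.and (e6.and e7))))).filter_mono nhdsWithin_le_nhds)
  obtain ⟨T, h1, h2, h3, h4, h5, h6, h7⟩ := h.exists
  exact ⟨T, h1, h2, h3, h4, h5, h6, h7⟩

end PairConst

namespace KatoPair

variable {Y Z : Type*} [NormedAddCommGroup Y] [NormedSpace ℝ Y]
  [NormedAddCommGroup Z] [NormedSpace ℝ Z]

/-- `u = (1 - h A(v))⁻¹ g`, and `Q(v) u` is the limit of resolvents in `Y`. -/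
structure IsRes (P : KatoPair Y Z) (c : PairConst) (v : Y) (h : ℝ) (g u : Z) : Prop where
  eq : P.ι u - h • P.A v u = P.ι g
  le : ∀ g' u', P.ι u' - h • P.A v u' = P.ι g' →
      (1 - h * c.C) * formNorm (P.ℓ v) (P.Q v u - P.ι u') ≤
        formNorm (P.ℓ v) (P.Q v g + h • P.B v u - P.ι g')

variable {P : KatoPair Y Z} {c : PairConst}

theorem IsGood.norm_le_formNorm (hP : P.IsGood c) {v : Y} (hv : v ∈ ball P.y0 c.δ0) (w : Z) :
    ‖w‖ ≤ c.q * c.M * formNorm (P.ℓ v) (P.Q v w) := by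
  have := c.q_pos
  calc ‖w‖ ≤ c.q * ‖P.Q v w‖ := hP.Q_inv v hv w
    _ ≤ c.q * (c.M * formNorm (P.ℓ v) (P.Q v w)) := by gcongr; exact (hP.form v hv).norm_le _
    _ = _ := by ring

theorem IsGood.formNorm_le (hP : P.IsGood c) {v : Y} (hv : v ∈ ball P.y0 c.δ0) (w : Z) :
    formNorm (P.ℓ v) (P.Q v w) ≤ c.M * c.q * ‖w‖ := by
  have := c.M_pos
  calc _ ≤ c.M * ‖P.Q v w‖ := (hP.form v hv).formNorm_le _
    _ ≤ c.M * (c.q * ‖w‖) := by gcongr; exact hP.Q_norm v hv w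
    _ = _ := by ring

/-- The comparison estimate in `Y` for a resolvent step. -/
theorem IsRes.sub_le {v : Y} {h : ℝ} {g u g' u' : Z} (hu : P.IsRes c v h g u)
    (h0 : 0 ≤ h) (hr : h * c.rate ≤ 1 / 2) (hu' : P.ι u' - h • P.A v u' = P.ι g') :
    formNorm (P.ℓ v) (P.Q v u - P.ι u') ≤ Real.exp (c.resRate * h) *
      formNorm (P.ℓ v) (P.Q v g + h • P.B v u - P.ι g') := by
  have hM := c.M_pos; have hq := c.q_pos; have hC := c.C_pos
  have hN := EquivForm.formNorm_nonneg (P.ℓ v) (P.Q v u - P.ι u')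
  have e1 := hu.le g' u' hu'
  have e3 : 2 * c.C ≤ c.resRate := by
    have : 0 ≤ c.M ^ 2 * c.C * c.q := by positivity
    unfold PairConst.resRate; linarith
  have e4 : h * (2 * c.C) ≤ 1 / 2 :=
    hr.trans' (by gcongr; exact e3.trans c.resRate_le_rate)
  have e5 : 1 + h * (2 * c.C) ≤ Real.exp (c.resRate * h) := by
    have := Real.add_one_le_exp (c.resRate * h)
    have : h * (2 * c.C) ≤ h * c.resRate := by gcongr
    linarith
  have e6 : formNorm (P.ℓ v) (P.Q v u - P.ι u') ≤ (1 + h * (2 * c.C)) *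
      formNorm (P.ℓ v) (P.Q v g + h • P.B v u - P.ι g') := by
    have e7 : 0 ≤ h * c.C := by positivity
    have e8 : 1 ≤ (1 + h * (2 * c.C)) * (1 - h * c.C) := by nlinarith
    calc _ ≤ (1 + h * (2 * c.C)) * (1 - h * c.C) * formNorm (P.ℓ v) (P.Q v u - P.ι u') :=
          le_mul_of_one_le_left hN e8
      _ ≤ _ := by rw [mul_assoc]; gcongr
  exact e6.trans (mul_le_mul_of_nonneg_right e5 (EquivForm.formNorm_nonneg _ _))

/-- The resolvent in `Z`. -/
theorem IsGood.res_le (hP : P.IsGood c) {v : Y} (hv : v ∈ ball P.y0 c.δ0) {h : ℝ}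
    (h0 : 0 ≤ h) (hr : h * c.rate ≤ 1 / 2) {g u : Z} (hu : P.IsRes c v h g u) :
    formNorm (P.ℓ v) (P.Q v u) ≤ Real.exp (c.resRate * h) * formNorm (P.ℓ v) (P.Q v g) := by
  have hM := c.M_pos; have hq := c.q_pos; have hC := c.C_pos
  have hl := hP.form v hv
  have hN := EquivForm.formNorm_nonneg (P.ℓ v) (P.Q v u)
  have hNg := EquivForm.formNorm_nonneg (P.ℓ v) (P.Q v g)
  -- Comparison with the trivial solution u' = g' = 0 leaves the norm of Q(v)u; the term hB(v)u is
  -- absorbed on the left.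
  have e1 := hu.le 0 0 (by simp)
  simp only [map_zero, sub_zero] at e1
  have e2 : formNorm (P.ℓ v) (P.Q v g + h • P.B v u) ≤ formNorm (P.ℓ v) (P.Q v g) +
      h * (c.M ^ 2 * c.C * c.q) * formNorm (P.ℓ v) (P.Q v u) := by
    refine (hl.formNorm_add_le _ _).trans ?_
    rw [EquivForm.formNorm_smul, abs_of_nonneg h0]
    have : formNorm (P.ℓ v) (P.B v u) ≤ (c.M ^ 2 * c.C * c.q) * formNorm (P.ℓ v) (P.Q v u) := by
      calc _ ≤ c.M * ‖P.B v u‖ := hl.formNorm_le _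
        _ ≤ c.M * (c.C * (c.q * c.M * formNorm (P.ℓ v) (P.Q v u))) := by
          gcongr
          exact (hP.B_norm v hv u).trans (by gcongr; exact hP.norm_le_formNorm hv u)
        _ = _ := by ring
    have := mul_le_mul_of_nonneg_left this h0
    linarith
  have e3 : (1 - h * (c.resRate / 2)) * formNorm (P.ℓ v) (P.Q v u) ≤
      formNorm (P.ℓ v) (P.Q v g) := by
    unfold PairConst.resRate; linarith
  have e4 : h * c.resRate ≤ 1 / 2 := hr.trans' (by gcongr; exact c.resRate_le_rate)
  have e5 := Real.add_one_le_exp (c.resRate * h)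
  have e6 : formNorm (P.ℓ v) (P.Q v u) ≤ (1 + h * c.resRate) * formNorm (P.ℓ v) (P.Q v g) := by
    have e7 : 0 ≤ h * c.resRate := mul_nonneg h0 c.resRate_pos.le
    have e8 : 1 ≤ (1 + h * c.resRate) * (1 - h * (c.resRate / 2)) := by nlinarith
    calc _ ≤ (1 + h * c.resRate) * (1 - h * (c.resRate / 2)) * formNorm (P.ℓ v) (P.Q v u) :=
          le_mul_of_one_le_left hN e8
      _ ≤ _ := by rw [mul_assoc]; gcongr
  refine e6.trans ?_
  gcongr
  linarith

/-- By `lower`, the change of the form is small relative to the form itself. Written as an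
exponential, it multiplies along the steps of a scheme. -/
theorem IsGood.formNorm_shift_le (hP : P.IsGood c) {v v' : Y} (hv : v ∈ ball P.y0 c.δ0)
    (hv' : v' ∈ ball P.y0 c.δ0) {d : ℝ} (hd : ‖v' - v‖ ≤ d) (x : Y) :
    formNorm (P.ℓ v') x ≤ Real.exp (c.C * c.M ^ 2 * d) * formNorm (P.ℓ v) x := by
  have hM := c.M_pos; have hC := c.C_pos
  have hl := hP.form v hv
  have hd0 := (norm_nonneg _).trans hd
  have hN := EquivForm.formNorm_nonneg (P.ℓ v) x
  have e1 := Real.add_one_le_exp (c.C * c.M ^ 2 * d)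
  have e0 : 0 ≤ c.C * c.M ^ 2 * d := by positivity
  refine Real.sqrt_le_iff.2 ⟨by positivity, ?_⟩
  have e2 := (abs_le.1 (hP.form_lip v' hv' v hv x x)).2
  have e3 := hl.lower x
  have e4 : c.C * ‖v' - v‖ * ‖x‖ * ‖x‖ ≤ c.C * d * (c.M ^ 2 * P.ℓ v x x) := by
    calc _ ≤ c.C * d * ‖x‖ * ‖x‖ := by gcongr
      _ = c.C * d * ‖x‖ ^ 2 := by ring
      _ ≤ _ := by gcongr
  rw [mul_pow, hl.formNorm_sq]
  have e5 : 1 + c.C * c.M ^ 2 * d ≤ Real.exp (c.C * c.M ^ 2 * d) ^ 2 := by nlinarith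
  have := mul_le_mul_of_nonneg_right e5 (hl.nonneg x)
  linarith

theorem IsGood.formNorm_Q_shift_le (hP : P.IsGood c) {v v' : Y} (hv : v ∈ ball P.y0 c.δ0)
    (hv' : v' ∈ ball P.y0 c.δ0) {d : ℝ} (hd : ‖v' - v‖ ≤ d) (u : Z) :
    formNorm (P.ℓ v') (P.Q v' u) ≤ Real.exp (c.shiftRate * d) * formNorm (P.ℓ v) (P.Q v u) := by
  have hM := c.M_pos; have hq := c.q_pos; have hC := c.C_pos
  have hd0 := (norm_nonneg _).trans hd
  have hl := hP.form v hv
  have hN := EquivForm.formNorm_nonneg (P.ℓ v) (P.Q v u)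
  have e1 := hl.formNorm_add_le (P.Q v u) (P.Q v' u - P.Q v u)
  have e2 : formNorm (P.ℓ v) (P.Q v' u - P.Q v u) ≤
      c.M ^ 2 * c.C * c.q * d * formNorm (P.ℓ v) (P.Q v u) := by
    calc _ ≤ c.M * ‖P.Q v' u - P.Q v u‖ := hl.formNorm_le _
      _ ≤ c.M * (c.C * d * (c.q * c.M * formNorm (P.ℓ v) (P.Q v u))) := by
        gcongr
        exact (hP.Q_lip v' hv' v hv u).trans (by gcongr; exact hP.norm_le_formNorm hv u)
      _ = _ := by ring
  have e3 := Real.add_one_le_exp (c.M ^ 2 * c.C * c.q * d)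
  rw [add_sub_cancel] at e1
  calc _ ≤ Real.exp (c.C * c.M ^ 2 * d) * formNorm (P.ℓ v) (P.Q v' u) :=
        hP.formNorm_shift_le hv hv' hd _
    _ ≤ Real.exp (c.C * c.M ^ 2 * d) *
        (Real.exp (c.M ^ 2 * c.C * c.q * d) * formNorm (P.ℓ v) (P.Q v u)) := by
      gcongr
      refine (e1.trans (add_le_add_right e2 _)).trans ?_
      rw [← one_add_mul]
      gcongr
      linarith
    _ = _ := by
      rw [← mul_assoc, ← Real.exp_add]
      unfold PairConst.shiftRate
      ring_nf

/-- An implicit Euler scheme `v_{n+1} = (1 - h A(v_n))⁻¹ (v_n + h g_n)` with step `h = T / N`. -/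
structure IsEuler (P : KatoPair Y Z) (c : PairConst) (T : ℝ) (N : ℕ) (v g : ℕ → Z) : Prop where
  pos : 0 < N
  start : v 0 ∈ P.dom c.δ c.R
  res : ∀ n < N, P.IsRes c (P.ι (v n)) (T / N) (v n + (T / N) • g n) (v (n + 1))
  norm_g : ∀ n < N, ‖g n‖ ≤ c.C
  norm_v : ∀ n ≤ N, ‖v n‖ ≤ c.bound T
  near : ∀ n ≤ N, ‖P.ι (v n) - P.ι (v 0)‖ ≤ (c.δ0 - c.δ) / 2

theorem mem_ball_of_near {v : Y} {v0 : Z} {R : ℝ} (h0 : v0 ∈ P.dom c.δ R)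
    (h : ‖v - P.ι v0‖ ≤ (c.δ0 - c.δ) / 2) : v ∈ ball P.y0 c.δ0 := by
  have h1 : dist (P.ι v0) P.y0 < c.δ := h0.1
  have h2 := dist_triangle v (P.ι v0) P.y0
  rw [dist_eq_norm v (P.ι v0)] at h2
  have := c.δ_lt
  rw [mem_ball]
  linarith

theorem IsGood.increment_le (hP : P.IsGood c) {v : Y} (hv : v ∈ ball P.y0 c.δ0) {g u : Z}
    (hg : ‖g‖ ≤ c.C) (hu : ‖u‖ ≤ c.C) : ‖P.A v u + P.ι g‖ ≤ 2 * c.C ^ 2 := by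
  have hC := c.C_pos
  have e1 := (hP.A_norm v hv u).trans (mul_le_mul_of_nonneg_left hu hC.le)
  have e2 := (hP.norm_ι g).trans (mul_le_mul_of_nonneg_left hg hC.le)
  refine (norm_add_le _ _).trans ?_
  linarith

theorem IsRes.sub_eq {v g u : Z} {h : ℝ} (hu : P.IsRes c (P.ι v) h (v + h • g) u) :
    P.ι u - P.ι v = h • (P.A (P.ι v) u + P.ι g) := by
  have := hu.eq
  rw [map_add, map_smul, sub_eq_iff_eq_add] at this
  rw [this, smul_add]; abel

theorem _root_.PairConst.IsTime.bound_le {T : ℝ} (hT : c.IsTime T) : c.bound T ≤ c.C :=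
  hT.bound_lt.le.trans c.R0_le_C

/-- The implicit Euler scheme stays in the domain up to the time `T`. -/
theorem IsGood.exists_isEuler (hP : P.IsGood c) {T : ℝ} (hT : c.IsTime T) {N : ℕ} (hN : 0 < N)
    {v0 : Z} (hv0 : v0 ∈ P.dom c.δ c.R) (F : ℕ → Z → Z)
    (hF : ∀ n < N, ∀ v ∈ P.dom c.δ0 c.R0, ‖F n v‖ ≤ c.C) :
    ∃ v : ℕ → Z, v 0 = v0 ∧ P.IsEuler c T N v (fun n => F n (v n)) := by
  have hM := c.M_pos; have hq := c.q_pos; have hC := c.C_pos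
  have hrate := c.rate_pos; have hR := c.R_pos; have hTp := hT.pos
  have hN' : (0 : ℝ) < N := by exact_mod_cast hN
  set h := T / N with hh
  have hpos : 0 < h := by positivity
  have hhT : h ≤ T := div_le_self hT.pos.le (by exact_mod_cast hN)
  have hr : h * c.rate ≤ 1 / 2 := hT.rate_le.trans' (by gcongr)
  classical
  -- The step is made total with the value 0 outside the ball; the induction below shows that this
  -- case does not occur before N.
  have hex : ∀ (n : ℕ) (v : Z), ∃ u, P.ι v ∈ ball P.y0 c.δ0 →
      P.IsRes c (P.ι v) h (v + h • F n v) u := by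
    intro n v
    by_cases hv : P.ι v ∈ ball P.y0 c.δ0
    · obtain ⟨u, hu1, hu2⟩ := hP.resolvent _ hv h hpos (hhT.trans hT.le_h0) (v + h • F n v)
      exact ⟨u, fun _ => ⟨hu1, hu2⟩⟩
    · exact ⟨0, fun h => absurd h hv⟩
  choose next hnext using hex
  set v : ℕ → Z := fun n => Nat.rec v0 next n with hv
  have hv_succ : ∀ n, v (n + 1) = next n (v n) := fun n => rfl
  have hnh : ∀ n : ℕ, n ≤ N → n * h ≤ T := by
    intro n hn
    rw [hh, mul_div_assoc', div_le_iff₀ hN', mul_comm]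
    gcongr
  have hbd : ∀ n : ℕ, n ≤ N → c.q * c.M * (Real.exp (c.rate * (n * h)) *
      (c.M * c.q * c.R + c.rate * (n * h))) ≤ c.bound T := by
    intro n hn
    have := hnh n hn
    unfold PairConst.bound
    gcongr
  -- `v n` is measured in the norm attached to `v n` itself. A step adds the forcing, applies the
  -- resolvent at fixed `v n`, and moves the norm to `v (n + 1)`; the three rates add up to `rate`.
  have key : ∀ n ≤ N, formNorm (P.ℓ (P.ι (v n))) (P.Q (P.ι (v n)) (v n)) ≤
      Real.exp (c.rate * (n * h)) * (c.M * c.q * c.R + c.rate * (n * h)) ∧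
      ‖P.ι (v n) - P.ι v0‖ ≤ 2 * c.C ^ 2 * (n * h) ∧ ‖v n‖ ≤ c.bound T := by
    intro n
    induction n with
    | zero =>
      intro hn
      have h1 : P.ι v0 ∈ ball P.y0 c.δ0 := ball_subset_ball c.δ_lt.le hv0.1
      have h2 : ‖v0‖ < c.R := by simpa using hv0.2
      have h3 : formNorm (P.ℓ (P.ι v0)) (P.Q (P.ι v0) v0) ≤ c.M * c.q * c.R :=
        (hP.formNorm_le h1 v0).trans (by gcongr)
      refine ⟨by simpa [hv] using h3, by simp [hv], ?_⟩
      refine (hP.norm_le_formNorm h1 v0).trans ((hbd 0 hn).trans' ?_)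
      simpa using mul_le_mul_of_nonneg_left h3 (mul_pos hq hM).le
    | succ n ih =>
      intro hn
      obtain ⟨i1, i2, i3⟩ := ih (by omega)
      have hnT := hnh n (by omega)
      have hnear : ‖P.ι (v n) - P.ι v0‖ ≤ (c.δ0 - c.δ) / 2 :=
        i2.trans (hT.drift.trans' (by gcongr))
      have hmem := mem_ball_of_near hv0 hnear
      have hdom : v n ∈ P.dom c.δ0 c.R0 :=
        ⟨hmem, by simpa using i3.trans_lt hT.bound_lt⟩
      have hg := hF n (by omega) _ hdom
      have hres := hnext n (v n) hmem
      rw [← hv_succ] at hres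
      have e1 := hP.res_le hmem hpos.le hr hres
      have e2 : formNorm (P.ℓ (P.ι (v n))) (P.Q (P.ι (v n)) (v n + h • F n (v n))) ≤
          formNorm (P.ℓ (P.ι (v n))) (P.Q (P.ι (v n)) (v n)) + h * (c.M * c.q * c.C) := by
        rw [map_add, map_smul]
        refine ((hP.form _ hmem).formNorm_add_le _ _).trans ?_
        rw [EquivForm.formNorm_smul, abs_of_pos hpos]
        gcongr
        exact (hP.formNorm_le hmem _).trans (by gcongr)
      have e3 : c.M * c.q * c.C ≤ c.rate := by
        have := c.resRate_pos
        have := c.shiftRate_pos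
        have : 0 ≤ c.shiftRate * (2 * c.C ^ 2) := by positivity
        unfold PairConst.rate; linarith
      have hcast : ((n + 1 : ℕ) : ℝ) * h = n * h + h := by push_cast; ring
      have e4 : formNorm (P.ℓ (P.ι (v n))) (P.Q (P.ι (v n)) (v n + h • F n (v n))) ≤
          Real.exp (c.rate * (n * h)) * (c.M * c.q * c.R + c.rate * ((n + 1 : ℕ) * h)) := by
        rw [hcast]
        have h5 : 1 ≤ Real.exp (c.rate * (n * h)) := Real.one_le_exp (by positivity)
        have h6 : h * (c.M * c.q * c.C) ≤ Real.exp (c.rate * (n * h)) * (c.rate * h) := by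
          have h7 : h * (c.M * c.q * c.C) ≤ h * c.rate := by gcongr
          have h8 : 0 ≤ c.rate * h := by positivity
          nlinarith
        have := e2.trans (add_le_add i1 h6)
        linarith
      have e5 : formNorm (P.ℓ (P.ι (v n))) (P.Q (P.ι (v n)) (v (n + 1))) ≤
          Real.exp (c.resRate * h + c.rate * (n * h)) *
            (c.M * c.q * c.R + c.rate * ((n + 1 : ℕ) * h)) := by
        rw [Real.exp_add, mul_assoc]
        exact e1.trans (by gcongr)
      -- The bound in Z is first derived with the norm at `v n`. It controls the increment in Y and
      -- so places `v (n + 1)` in the ball, where its own norm may be used.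
      have hnorm : ‖v (n + 1)‖ ≤ c.bound T := by
        refine (hP.norm_le_formNorm hmem _).trans ((hbd (n + 1) hn).trans' ?_)
        gcongr
        refine e5.trans ?_
        gcongr
        rw [hcast, mul_add, add_comm]
        gcongr
        exact c.resRate_le_rate
      have hinc : ‖P.ι (v (n + 1)) - P.ι (v n)‖ ≤ 2 * c.C ^ 2 * h := by
        rw [hres.sub_eq, norm_smul, Real.norm_of_nonneg hpos.le, mul_comm]
        gcongr
        exact hP.increment_le hmem hg (hnorm.trans hT.bound_le)
      have hdist : ‖P.ι (v (n + 1)) - P.ι v0‖ ≤ 2 * c.C ^ 2 * ((n + 1 : ℕ) * h) := by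
        have := norm_sub_le_norm_sub_add_norm_sub (P.ι (v (n + 1))) (P.ι (v n)) (P.ι v0)
        rw [hcast]
        linarith
      have hmem' : P.ι (v (n + 1)) ∈ ball P.y0 c.δ0 := by
        refine mem_ball_of_near hv0 (hdist.trans (hT.drift.trans' ?_))
        have := hnh (n + 1) hn
        gcongr
      refine ⟨?_, hdist, hnorm⟩
      refine (hP.formNorm_Q_shift_le hmem hmem' hinc (v (n + 1))).trans ?_
      refine (mul_le_mul_of_nonneg_left e5 (Real.exp_pos _).le).trans ?_
      rw [← mul_assoc, ← Real.exp_add]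
      gcongr
      rw [hcast]
      have : 0 ≤ c.M * c.q * c.C * h := by positivity
      unfold PairConst.rate
      linarith
  refine ⟨v, rfl, hN, hv0, ?_, ?_, fun n hn => (key n hn).2.2, ?_⟩
  · intro n hn
    obtain ⟨-, i2, i3⟩ := key n hn.le
    have hnT := hnh n hn.le
    exact hnext n (v n) (mem_ball_of_near hv0 (i2.trans (hT.drift.trans' (by gcongr))))
  · intro n hn
    obtain ⟨-, i2, i3⟩ := key n hn.le
    have hnT := hnh n hn.le
    exact hF n hn _ ⟨mem_ball_of_near hv0 (i2.trans (hT.drift.trans' (by gcongr))),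
      by simpa using i3.trans_lt hT.bound_lt⟩
  · intro n hn
    have hnT := hnh n hn
    exact (key n hn).2.1.trans (hT.drift.trans' (by gcongr))

end KatoPair

/-! ### Interpolated schemes, stability and convergence in Y -/

namespace KatoPair

variable {Y Z : Type*} [NormedAddCommGroup Y] [NormedSpace ℝ Y]
  [NormedAddCommGroup Z] [NormedSpace ℝ Z] {P : KatoPair Y Z} {c : PairConst}

/-- A path with bounded velocity is Lipschitz. -/
theorem IsPath.lipschitz {T β ε L : ℝ} {q a : ℝ → Y} {b : ℝ → Z} {γ : ℝ → Y}
    (h : P.IsPath c T β ε q a b γ) (hL : ∀ t ∈ Ico 0 T, ‖P.A (a t) (b t) + γ t‖ ≤ L) :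
    ∀ t ∈ Icc 0 T, ∀ t' ∈ Icc 0 T, ‖q t - q t'‖ ≤ L * |t - t'| := by
  have key : ∀ t' ∈ Icc 0 T, ∀ t ∈ Icc t' T, ‖q t - q t'‖ ≤ L * (t - t') := by
    intro t' ht'
    refine norm_image_sub_le_of_norm_deriv_right_le_segment
      (h.cont.mono (Icc_subset_Icc_left ht'.1)) (f' := fun t => P.A (a t) (b t) + γ t) ?_ ?_
    · exact fun x hx => h.deriv x ⟨ht'.1.trans hx.1, hx.2⟩
    · exact fun x hx => hL x ⟨ht'.1.trans hx.1, hx.2⟩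
  intro t ht t' ht'
  rcases le_total t' t with hle | hle
  · rw [abs_of_nonneg (sub_nonneg.2 hle)]; exact key t' ht' t ⟨hle, ht.2⟩
  · rw [abs_of_nonpos (sub_nonpos.2 hle), norm_sub_rev, neg_sub]; exact key t ht t' ⟨hle, ht'.2⟩

theorem floor_lt_of_mem_Ico {T t : ℝ} {N : ℕ} (hN : 0 < N) (ht : t ∈ Ico 0 T) :
    ⌊t / (T / N)⌋₊ < N := by
  have hT : 0 < T := ht.1.trans_lt ht.2
  have hN' : (0 : ℝ) < N := by exact_mod_cast hN
  rw [Nat.floor_lt (by have := ht.1; positivity), div_lt_iff₀ (by positivity),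
    mul_div_cancel₀ _ hN'.ne']
  exact ht.2

/-- Unlike the floor, this index stays below N at t = T. -/
theorem exists_index_of_mem_Icc {T t : ℝ} {N : ℕ} (hT : 0 < T) (hN : 0 < N) (ht : t ∈ Icc 0 T) :
    ∃ n < N, (n : ℝ) ≤ t / (T / N) ∧ t / (T / N) ≤ n + 1 := by
  have hN' : (0 : ℝ) < N := by exact_mod_cast hN
  rcases ht.2.eq_or_lt with h | h
  · refine ⟨N - 1, by omega, ?_, ?_⟩
    · rw [h, div_div_cancel₀ hT.ne']; exact_mod_cast Nat.sub_le _ _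
    · rw [h, div_div_cancel₀ hT.ne']
      have : N ≤ N - 1 + 1 := by omega
      exact_mod_cast this
  · have := ht.1
    exact ⟨_, floor_lt_of_mem_Ico hN ⟨ht.1, h⟩, Nat.floor_le (by positivity),
      (Nat.lt_floor_add_one _).le⟩

theorem mem_segment_of_le {E : Type*} [NormedAddCommGroup E] [NormedSpace ℝ E] (a : ℕ → E)
    {s : ℝ} {n : ℕ} (h1 : (n : ℝ) ≤ s) (h2 : s ≤ n + 1) :
    interp a s ∈ segment ℝ (a n) (a (n + 1)) := by
  rw [interp_eq a h1 h2, segment_eq_image']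
  exact ⟨s - n, ⟨by linarith, by linarith⟩, rfl⟩

theorem map_interp {E F : Type*} [NormedAddCommGroup E] [NormedSpace ℝ E] [NormedAddCommGroup F]
    [NormedSpace ℝ F] (L : E →L[ℝ] F) (a : ℕ → E) (s : ℝ) :
    L (interp a s) = interp (fun n => L (a n)) s := by
  simp [interp]

namespace IsEuler

variable {T : ℝ} {N : ℕ} {v g : ℕ → Z}

theorem step_pos (h : P.IsEuler c T N v g) (hT : 0 < T) : 0 < T / N := by
  have : (0 : ℝ) < N := by exact_mod_cast h.pos
  positivity

theorem mem_ball (h : P.IsEuler c T N v g) {n : ℕ} (hn : n ≤ N) :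
    P.ι (v n) ∈ ball P.y0 c.δ0 :=
  mem_ball_of_near h.start (h.near n hn)

theorem norm_le (h : P.IsEuler c T N v g) (hT : c.IsTime T) {n : ℕ} (hn : n ≤ N) : ‖v n‖ ≤ c.C :=
  (h.norm_v n hn).trans hT.bound_le

theorem mem_dom (h : P.IsEuler c T N v g) (hT : c.IsTime T) {n : ℕ} (hn : n ≤ N) :
    v n ∈ P.dom c.δ0 c.R0 :=
  ⟨h.mem_ball hn, by simpa using (h.norm_v n hn).trans_lt hT.bound_lt⟩

theorem velocity_le (h : P.IsEuler c T N v g) (hP : P.IsGood c) (hT : c.IsTime T) {n : ℕ}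
    (hn : n < N) : ‖P.A (P.ι (v n)) (v (n + 1)) + P.ι (g n)‖ ≤ 2 * c.C ^ 2 :=
  hP.increment_le (h.mem_ball hn.le) (h.norm_g n hn) (h.norm_le hT hn)

theorem sub_eq (h : P.IsEuler c T N v g) {n : ℕ} (hn : n < N) :
    P.ι (v (n + 1)) - P.ι (v n) = (T / N) • (P.A (P.ι (v n)) (v (n + 1)) + P.ι (g n)) :=
  (h.res n hn).sub_eq

theorem norm_sub_le (h : P.IsEuler c T N v g) (hP : P.IsGood c) (hT : c.IsTime T) {n : ℕ}
    (hn : n < N) : ‖P.ι (v (n + 1)) - P.ι (v n)‖ ≤ 2 * c.C ^ 2 * (T / N) := by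
  have h0 := h.step_pos hT.pos
  rw [h.sub_eq hn, norm_smul, Real.norm_of_nonneg h0.le, mul_comm]
  gcongr
  exact h.velocity_le hP hT hn

theorem interp_mem (h : P.IsEuler c T N v g) (hT : c.IsTime T) {t : ℝ} (ht : t ∈ Icc 0 T) :
    ‖interp v (t / (T / N))‖ ≤ c.bound T ∧
      ‖P.ι (interp v (t / (T / N))) - P.ι (v 0)‖ ≤ (c.δ0 - c.δ) / 2 := by
  obtain ⟨n, hn, h1, h2⟩ := exists_index_of_mem_Icc hT.pos h.pos ht
  constructor
  · have := (convex_closedBall (0 : Z) (c.bound T)).segment_subset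
      (by simpa using h.norm_v n hn.le) (by simpa using h.norm_v (n + 1) hn)
      (mem_segment_of_le v h1 h2)
    simpa using this
  · have := (convex_closedBall (P.ι (v 0)) ((c.δ0 - c.δ) / 2)).segment_subset
      (by simpa [dist_eq_norm] using h.near n hn.le)
      (by simpa [dist_eq_norm] using h.near (n + 1) hn)
      (mem_segment_of_le (fun n => P.ι (v n)) h1 h2)
    rw [map_interp]
    simpa [dist_eq_norm] using this

theorem interp_mem_dom (h : P.IsEuler c T N v g) (hT : c.IsTime T) {t : ℝ} (ht : t ∈ Icc 0 T) :
    interp v (t / (T / N)) ∈ P.dom c.δ0 c.R0 := by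
  obtain ⟨h1, h2⟩ := h.interp_mem hT ht
  exact ⟨mem_ball_of_near h.start h2, by simpa using h1.trans_lt hT.bound_lt⟩

/-- The interpolation of an implicit Euler scheme is a path. -/
theorem isPath (h : P.IsEuler c T N v g) (hP : P.IsGood c) (hT : c.IsTime T) :
    P.IsPath c T c.C (2 * c.C ^ 2 * (T / N)) (fun t => P.ι (interp v (t / (T / N))))
      (fun t => P.ι (v ⌊t / (T / N)⌋₊)) (fun t => v (⌊t / (T / N)⌋₊ + 1))
      (fun t => P.ι (g ⌊t / (T / N)⌋₊)) := by
  have h0 := h.step_pos hT.pos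
  refine ⟨?_, ?_, ?_, ?_, ?_⟩
  · exact (P.ι.continuous.comp ((continuous_interp v).comp (continuous_id.div_const _))).continuousOn
  · intro t ht
    have hn := floor_lt_of_mem_Ico h.pos ht
    have h1 := hasDerivWithinAt_interp (fun n => P.ι (v n)) h0 ht.1
    rw [h.sub_eq hn, smul_smul, inv_mul_cancel₀ h0.ne', one_smul] at h1
    simp only [map_interp]
    exact h1
  · exact fun t ht => h.mem_ball (floor_lt_of_mem_Ico h.pos ht).le
  · exact fun t ht => h.norm_le hT (floor_lt_of_mem_Ico h.pos ht)
  · intro t ht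
    have := ht.1
    have h1 := (norm_sub_endpoints_le_of_mem_segment (interp_mem_segment (fun n => P.ι (v n))
      (show 0 ≤ t / (T / N) by positivity))).2
    rw [map_interp]
    exact h1.trans (h.norm_sub_le hP hT (floor_lt_of_mem_Ico h.pos ht))

theorem interp_sub_floor_le (h : P.IsEuler c T N v g) (hP : P.IsGood c) (hT : c.IsTime T) {t : ℝ}
    (ht : t ∈ Ico 0 T) : ‖P.ι (v ⌊t / (T / N)⌋₊) - P.ι (interp v (t / (T / N)))‖ ≤
      2 * c.C ^ 2 * (T / N) := by
  have h0 := h.step_pos hT.pos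
  have := ht.1
  have h1 := (norm_sub_endpoints_le_of_mem_segment (interp_mem_segment (fun n => P.ι (v n))
      (show 0 ≤ t / (T / N) by positivity))).1
  rw [map_interp, norm_sub_rev]
  exact h1.trans (h.norm_sub_le hP hT (floor_lt_of_mem_Ico h.pos ht))

theorem interp_lipschitz (h : P.IsEuler c T N v g) (hP : P.IsGood c) (hT : c.IsTime T) :
    ∀ t ∈ Icc 0 T, ∀ t' ∈ Icc 0 T, ‖P.ι (interp v (t / (T / N))) -
      P.ι (interp v (t' / (T / N)))‖ ≤ 2 * c.C ^ 2 * |t - t'| :=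
  (h.isPath hP hT).lipschitz fun _ ht => h.velocity_le hP hT (floor_lt_of_mem_Ico h.pos ht)

/-- Two schemes with nearly the same forcing remain close in `Y`. -/
theorem compare (h : P.IsEuler c T N v g) (hP : P.IsGood c) (hT : c.IsTime T) {N' : ℕ}
    {v' g' : ℕ → Z} (h' : P.IsEuler c T N' v' g') (h0 : v 0 = v' 0) {ε : ℝ} (hε1 : ε ≤ 1)
    (hε : 2 * c.C ^ 2 * (T / N) ≤ ε) (hε' : 2 * c.C ^ 2 * (T / N') ≤ ε)
    (hg : ∀ t ∈ Ico 0 T, ‖P.ι (g ⌊t / (T / N)⌋₊) - P.ι (g' ⌊t / (T / N')⌋₊)‖ ≤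
      c.C * ‖P.ι (interp v (t / (T / N))) - P.ι (interp v' (t / (T / N')))‖ + ε) :
    ∀ t ∈ Icc 0 T, ‖P.ι (interp v (t / (T / N))) - P.ι (interp v' (t / (T / N')))‖ ^ 2 ≤
      16 * c.M ^ 2 * c.cmp c.C c.C (2 * c.C ^ 2) * T * ε := by
  intro t ht
  have hC := c.C_pos; have hM := c.M_pos
  have hε0 : 0 ≤ ε := by
    have := h.step_pos hT.pos
    exact hε.trans' (by positivity)
  have hcmp : 0 ≤ c.cmp c.C c.C (2 * c.C ^ 2) := by unfold PairConst.cmp; positivity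
  have hp1 := h.isPath hP hT
  have hp2 := h'.isPath hP hT
  have hp1' : P.IsPath c T c.C ε _ _ _ _ :=
    ⟨hp1.cont, hp1.deriv, hp1.mem, hp1.norm_le, fun t ht => (hp1.close t ht).trans hε⟩
  have hp2' : P.IsPath c T c.C ε _ _ _ _ :=
    ⟨hp2.cont, hp2.deriv, hp2.mem, hp2.norm_le, fun t ht => (hp2.close t ht).trans hε'⟩
  have key := hP.compare hC.le hC.le (by positivity : (0 : ℝ) ≤ 2 * c.C ^ 2) hε0 hε1
    (fun t ht => (h.interp_mem_dom hT ht).1) (h.interp_lipschitz hP hT) hp1' hp2' ?_ ?_ hg t ht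
  · refine key.trans ?_
    simp only [zero_div, interp_zero, h0, sub_self, norm_zero]
    have e1 : Real.exp (c.cmp c.C c.C (2 * c.C ^ 2) * t) ≤ 16 := hT.cmp_le.trans' (by
      gcongr; exact ht.2)
    have ht0 := ht.1
    have ht1 := ht.2
    calc _ ≤ c.M ^ 2 * (16 * (c.M ^ 2 * 0 ^ 2 + c.cmp c.C c.C (2 * c.C ^ 2) * ε * T)) := by gcongr
      _ = _ := by ring
  · intro t ht
    have e1 := h.interp_sub_floor_le hP hT ht
    have : 0 ≤ c.C * ‖P.ι (interp v (t / (T / N))) - P.ι (interp v' (t / (T / N')))‖ := by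
      positivity
    linarith
  · intro t ht
    have e1 := h'.interp_sub_floor_le hP hT ht
    have e2 := norm_sub_le_norm_sub_add_norm_sub (P.ι (v' ⌊t / (T / N')⌋₊))
      (P.ι (interp v' (t / (T / N')))) (P.ι (interp v (t / (T / N))))
    rw [norm_sub_rev (P.ι (interp v' (t / (T / N'))))] at e2
    have := le_mul_of_one_le_left (norm_nonneg (P.ι (interp v (t / (T / N))) -
      P.ι (interp v' (t / (T / N'))))) c.one_le_C
    linarith

end IsEuler

/-- A solution of `v_t = A(v) v + f(v)` on `[0, T]`. -/
structure IsSol (P : KatoPair Y Z) (c : PairConst) (T : ℝ) (v : ℝ → Z) : Prop where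
  mem_dom : ∀ t ∈ Icc 0 T, v t ∈ P.dom c.δ0 c.R0
  continuousOn : ContinuousOn v (Icc 0 T)
  equation : ∀ t ∈ Icc 0 T, HasDerivWithinAt (fun s => P.ι (v s))
    (P.A (P.ι (v t)) (v t) + P.ι (P.f (v t))) (Icc 0 T) t

/-- Solutions depend Lipschitz continuously in `Y` on the initial value. -/
theorem IsSol.compare (hP : P.IsGood c) {T : ℝ} (hT : c.IsTime T) {v1 v2 : ℝ → Z}
    (h1 : P.IsSol c T v1) (h2 : P.IsSol c T v2) :
    ∀ t ∈ Icc 0 T, ‖P.ι (v2 t) - P.ι (v1 t)‖ ≤ 4 * c.M ^ 2 * ‖P.ι (v2 0) - P.ι (v1 0)‖ := by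
  intro t ht
  have hC := c.C_pos; have hM := c.M_pos
  have hcmp : 0 ≤ c.cmp c.C c.C (2 * c.C ^ 2) := by unfold PairConst.cmp; positivity
  have hn : ∀ {v : ℝ → Z}, P.IsSol c T v → ∀ t ∈ Icc 0 T, ‖v t‖ ≤ c.C := fun h t ht => by
    have := (h.mem_dom t ht).2
    rw [mem_ball_zero_iff] at this
    exact this.le.trans c.R0_le_C
  have hp : ∀ {v : ℝ → Z}, P.IsSol c T v → P.IsPath c T c.C 0 (fun t => P.ι (v t))
      (fun t => P.ι (v t)) v (fun t => P.ι (P.f (v t))) := fun h =>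
    ⟨P.ι.continuous.comp_continuousOn h.continuousOn,
      fun t ht => (h.equation t (Ico_subset_Icc_self ht)).mono_of_mem_nhdsWithin
        (Icc_mem_nhdsGE_of_mem ht),
      fun t ht => (h.mem_dom t (Ico_subset_Icc_self ht)).1,
      fun t ht => hn h t (Ico_subset_Icc_self ht), fun t _ => by simp⟩
  have hlip := (hp h2).lipschitz fun t ht =>
    hP.increment_le (h2.mem_dom t (Ico_subset_Icc_self ht)).1
      (hP.f_norm _ (h2.mem_dom t (Ico_subset_Icc_self ht))) (hn h2 t (Ico_subset_Icc_self ht))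
  -- Exact solutions are paths with ε = 0. The form moves along `v2`, so the coefficient of `v1`
  -- deviates from it by the very distance to be estimated; κ = C ≥ 1 accommodates this.
  have key := hP.compare hC.le hC.le (by positivity : (0 : ℝ) ≤ 2 * c.C ^ 2) le_rfl zero_le_one
    (fun t ht => (h2.mem_dom t ht).1) hlip (hp h2) (hp h1) ?_ ?_ ?_ t ht
  · refine (abs_le_of_sq_le_sq' ?_ (by positivity)).2
    refine key.trans ?_
    have e1 : Real.exp (c.cmp c.C c.C (2 * c.C ^ 2) * t) ≤ 16 := hT.cmp_le.trans' (by
      gcongr; exact ht.2)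
    calc _ = Real.exp (c.cmp c.C c.C (2 * c.C ^ 2) * t) *
          (c.M ^ 4 * ‖P.ι (v2 0) - P.ι (v1 0)‖ ^ 2) := by ring
      _ ≤ 16 * (c.M ^ 4 * ‖P.ι (v2 0) - P.ι (v1 0)‖ ^ 2) := by gcongr
      _ = _ := by ring
  · intro t _
    simp only [sub_self, norm_zero]
    positivity
  · intro t _
    rw [norm_sub_rev, add_zero]
    exact le_mul_of_one_le_left (norm_nonneg _) c.one_le_C
  · intro t ht
    rw [add_zero]
    exact hP.f_lip _ (h2.mem_dom t (Ico_subset_Icc_self ht)) _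
      (h1.mem_dom t (Ico_subset_Icc_self ht))

theorem tendsto_div_two_pow (T : ℝ) : Tendsto (fun i : ℕ => T / ((2 ^ i : ℕ) : ℝ)) atTop (𝓝 0) := by
  push_cast
  exact (tendsto_const_nhds (x := T)).div_atTop (tendsto_pow_atTop_atTop_of_one_lt one_lt_two)

/-- The implicit Euler schemes for `v_t = A(v) v + f(v)` are a Cauchy sequence in `Y`. -/
theorem IsGood.exists_cauchy_isEuler (hP : P.IsGood c) {T : ℝ} (hT : c.IsTime T) {v0 : Z}
    (hv0 : v0 ∈ P.dom c.δ c.R) :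
    ∃ v : ℕ → ℕ → Z, (∀ i, v i 0 = v0) ∧
      (∀ i, P.IsEuler c T (2 ^ i) (v i) (fun n => P.f (v i n))) ∧
      ∀ η > 0, ∃ J, ∀ i ≥ J, ∀ j ≥ J, ∀ t ∈ Icc 0 T,
        ‖P.ι (interp (v i) (t / (T / (2 ^ i : ℕ)))) -
          P.ι (interp (v j) (t / (T / (2 ^ j : ℕ))))‖ ≤ η := by
  have hC := c.C_pos
  choose v hv1 hv2 using fun i : ℕ => hP.exists_isEuler hT (N := 2 ^ i) (by positivity) hv0
    (fun _ => P.f) (fun _ _ v hv => hP.f_norm v hv)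
  refine ⟨v, hv1, hv2, fun η hη => ?_⟩
  set D := 16 * c.M ^ 2 * c.cmp c.C c.C (2 * c.C ^ 2) * T with hD
  have hD0 : 0 ≤ D := by
    have := hT.pos; have := c.M_pos
    have hcmp : 0 ≤ c.cmp c.C c.C (2 * c.C ^ 2) := by unfold PairConst.cmp; positivity
    positivity
  -- `D` is the constant of `IsEuler.compare`, so an error ε in the data becomes a squared distance
  -- at most η².
  set ε := min 1 (η ^ 2 / (D + 1)) with hε
  have hε0 : 0 < ε := lt_min one_pos (by positivity)
  have hDε : D * ε ≤ η ^ 2 := by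
    calc D * ε ≤ (D + 1) * (η ^ 2 / (D + 1)) := by gcongr; linarith; exact min_le_right _ _
      _ = _ := by field_simp
  have hev := (tendsto_div_two_pow T).eventually_le_const
    (show (0 : ℝ) < ε / (4 * c.C ^ 3) by positivity)
  obtain ⟨J, hJ⟩ := eventually_atTop.1 hev
  have hJ' : ∀ i ≥ J, 2 * c.C ^ 3 * (T / (2 ^ i : ℕ)) ≤ ε / 2 := by
    intro i hi
    have := hJ i hi
    rw [le_div_iff₀ (by positivity)] at this
    linarith
  have hJ'' : ∀ i ≥ J, 2 * c.C ^ 2 * (T / (2 ^ i : ℕ)) ≤ ε := by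
    intro i hi
    have h0 := (hv2 i).step_pos hT.pos
    refine ((hJ' i hi).trans (half_le_self hε0.le)).trans' ?_
    gcongr
    exacts [c.one_le_C, by norm_num]
  refine ⟨J, fun i hi j hj t ht => ?_⟩
  have key := (hv2 i).compare hP hT (hv2 j) (by rw [hv1, hv1]) (min_le_left _ _) (hJ'' i hi)
    (hJ'' j hj) ?_ t ht
  · exact (abs_le_of_sq_le_sq' (key.trans hDε) hη.le).2
  · intro t ht
    have hi' := (floor_lt_of_mem_Ico (hv2 i).pos ht).le
    have hj' := (floor_lt_of_mem_Ico (hv2 j).pos ht).le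
    have e1 := hP.f_lip _ ((hv2 i).mem_dom hT hi') _ ((hv2 j).mem_dom hT hj')
    have e2 := (hv2 i).interp_sub_floor_le hP hT ht
    have e3 := (hv2 j).interp_sub_floor_le hP hT ht
    set xi := P.ι (v i ⌊t / (T / (2 ^ i : ℕ))⌋₊)
    set xj := P.ι (v j ⌊t / (T / (2 ^ j : ℕ))⌋₊)
    set yi := P.ι (interp (v i) (t / (T / (2 ^ i : ℕ))))
    set yj := P.ι (interp (v j) (t / (T / (2 ^ j : ℕ))))
    have e4 : ‖xi - xj‖ ≤ ‖xi - yi‖ + ‖yi - yj‖ + ‖xj - yj‖ := by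
      have : xi - xj = (xi - yi) + (yi - yj) - (xj - yj) := by abel
      rw [this]
      exact (_root_.norm_sub_le _ _).trans (add_le_add_left (norm_add_le _ _) _)
    refine e1.trans ?_
    have e5 : c.C * ‖xi - xj‖ ≤ c.C * (2 * c.C ^ 2 * (T / (2 ^ i : ℕ)) + ‖yi - yj‖ +
        2 * c.C ^ 2 * (T / (2 ^ j : ℕ))) := by gcongr; linarith
    have e6 := hJ' i hi
    have e7 := hJ' j hj
    linarith

end KatoPair

/-! ### Strong convergence of convex combinations of the forcing -/

/-- A bounded sequence in a pre-Hilbert space has convex combinations of its tails that form a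
Cauchy sequence. -/
theorem exists_cauchy_convexHull {E : Type*} [AddCommGroup E] [Module ℝ E]
    (s : LinearMap.BilinForm ℝ E) (hs : ∀ x y, s x y = s y x) (hs0 : ∀ x, 0 ≤ s x x) (x : ℕ → E)
    {K : ℝ} (hx : ∀ i, s (x i) (x i) ≤ K) :
    ∃ y : ℕ → E, (∀ i, y i ∈ convexHull ℝ (x '' Ici i)) ∧
      ∀ ε > 0, ∃ J, ∀ i ≥ J, ∀ j ≥ J, s (y i - y j) (y i - y j) ≤ ε := by
  set S : ℕ → Set ℝ := fun i => (fun z => s z z) '' convexHull ℝ (x '' Ici i) with hS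
  have hbdd : ∀ i, BddBelow (S i) := fun i => ⟨0, by rintro _ ⟨z, -, rfl⟩; exact hs0 z⟩
  have hmem : ∀ i, x i ∈ convexHull ℝ (x '' Ici i) := fun i =>
    subset_convexHull ℝ _ ⟨i, self_mem_Ici, rfl⟩
  have hne : ∀ i, (S i).Nonempty := fun i => ⟨_, x i, hmem i, rfl⟩
  have hanti : ∀ {i j}, i ≤ j → convexHull ℝ (x '' Ici j) ⊆ convexHull ℝ (x '' Ici i) :=
    fun h => convexHull_mono (image_mono (Ici_subset_Ici.2 h))
  -- The least energies `d i` of the tails increase and are bounded by K, so they converge. For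
  -- near-minimisers y i, y j with i ≤ j the midpoint has energy at least `d i`, and the
  -- parallelogram identity makes the energy of y i - y j small.
  set d : ℕ → ℝ := fun i => sInf (S i) with hd
  have hmono : Monotone d := fun i j h => csInf_le_csInf (hbdd i) (hne j) (image_mono (hanti h))
  have hdK : BddAbove (range d) := ⟨K, by
    rintro _ ⟨i, rfl⟩
    exact (csInf_le (hbdd i) ⟨x i, hmem i, rfl⟩).trans (hx i)⟩
  have hlim := (tendsto_atTop_ciSup hmono hdK).cauchySeq
  have hy : ∀ i : ℕ, ∃ y ∈ convexHull ℝ (x '' Ici i), s y y < d i + 1 / ((i : ℝ) + 1) := by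
    intro i
    obtain ⟨_, ⟨y, hy, rfl⟩, h⟩ := exists_lt_of_csInf_lt (hne i)
      (show sInf (S i) < d i + 1 / ((i : ℝ) + 1) from lt_add_of_pos_right _ (by positivity))
    exact ⟨y, hy, h⟩
  choose y hy1 hy2 using hy
  refine ⟨y, hy1, fun ε hε => ?_⟩
  obtain ⟨J1, hJ1⟩ := Metric.cauchySeq_iff.1 hlim (ε / 8) (by positivity)
  obtain ⟨J2, hJ2⟩ := exists_nat_one_div_lt (show 0 < ε / 8 by positivity)
  have key : ∀ i ≥ max J1 J2, ∀ j ≥ i, s (y i - y j) (y i - y j) ≤ ε := by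
    intro i hi j hj
    have hi1 : J1 ≤ i := (le_max_left _ _).trans hi
    have hi2 : J2 ≤ i := (le_max_right _ _).trans hi
    have e1 : ∀ k ≥ i, 1 / ((k : ℝ) + 1) ≤ ε / 8 := fun k hk =>
      (one_div_le_one_div_of_le (by positivity)
        (by have : (J2 : ℝ) ≤ k := by exact_mod_cast hi2.trans hk
            linarith)).trans hJ2.le
    have e2 := hJ1 i hi1 j (hi1.trans hj)
    rw [Real.dist_eq] at e2
    have e3 := (abs_lt.1 e2).1
    have hmid : (1 / 2 : ℝ) • y i + (1 / 2 : ℝ) • y j ∈ convexHull ℝ (x '' Ici i) :=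
      (convex_convexHull ℝ _) (hy1 i) (hanti hj (hy1 j)) (by norm_num) (by norm_num) (by norm_num)
    have e4 : d i ≤ s ((1 / 2 : ℝ) • y i + (1 / 2 : ℝ) • y j)
        ((1 / 2 : ℝ) • y i + (1 / 2 : ℝ) • y j) := csInf_le (hbdd i) ⟨_, hmid, rfl⟩
    have e5 := hy2 i
    have e6 := hy2 j
    have e7 := e1 i le_rfl
    have e8 := e1 j hj
    have e9 := hs (y i) (y j)
    simp only [map_add, map_sub, map_smul, LinearMap.add_apply, LinearMap.sub_apply,
      LinearMap.smul_apply, smul_eq_mul] at e4 ⊢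
    linarith
  refine ⟨max J1 J2, fun i hi j hj => ?_⟩
  rcases le_total i j with h | h
  · exact key i hi j h
  · have := key j hj i h
    rwa [← neg_sub, map_neg, map_neg, LinearMap.neg_apply, neg_neg]

namespace KatoPair

variable {Y Z : Type*} [NormedAddCommGroup Y] [NormedSpace ℝ Y]
  [NormedAddCommGroup Z] [NormedSpace ℝ Z] {P : KatoPair Y Z} {c : PairConst}

/-- The forcing terms along a sequence of schemes that converges in `Y` have convex combinations
that converge in `L²(0, T; Z)`. -/
theorem IsGood.exists_forcing (hP : P.IsGood c) {T : ℝ} (hT : c.IsTime T) {v0 : Z}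
    {v : ℕ → ℕ → Z} (hv0 : ∀ i, v i 0 = v0)
    (hv : ∀ i, P.IsEuler c T (2 ^ i) (v i) (fun n => P.f (v i n)))
    (hc : ∀ η > 0, ∃ J, ∀ i ≥ J, ∀ j ≥ J, ∀ t ∈ Icc 0 T,
        ‖P.ι (interp (v i) (t / (T / (2 ^ i : ℕ)))) -
          P.ι (interp (v j) (t / (T / (2 ^ j : ℕ))))‖ ≤ η) :
    ∃ G : ℕ → ℝ → Z, (∀ i, Continuous (G i)) ∧ (∀ i, ∀ t ∈ Icc 0 T, ‖G i t‖ ≤ c.C) ∧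
      (∀ η > 0, ∃ J, ∀ i ≥ J, ∀ j ≥ J, ∫ t in 0..T, ‖G i t - G j t‖ ≤ η) ∧
      ∀ η > 0, ∃ J, ∀ i ≥ J, ∀ j ≥ J, ∀ t ∈ Icc 0 T,
        ‖P.ι (G i t) - P.ι (P.f (interp (v j) (t / (T / (2 ^ j : ℕ)))))‖ ≤ η := by
  have hC := c.C_pos; have hM := c.M_pos; have hq := c.q_pos; have hTp := hT.pos
  have hv0' : P.ι v0 ∈ ball P.y0 c.δ0 := by
    rw [← hv0 0]; exact (hv 0).mem_ball (Nat.zero_le _)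
  have hcl : ∀ t : ℝ, (projIcc 0 T hTp.le t : ℝ) ∈ Icc 0 T := fun t => (projIcc 0 T hTp.le t).2
  -- Clamping t to [0, T] gives continuous functions on ℝ. The form `s` below sees only [0, T], so
  -- it is merely semidefinite on C(ℝ, Z), which suffices.
  have hcont : ∀ i, Continuous fun t : ℝ =>
      P.f (interp (v i) ((projIcc 0 T hTp.le t : ℝ) / (T / (2 ^ i : ℕ)))) := fun i =>
    hP.f_cont.comp_continuous ((continuous_interp _).comp
      ((continuous_subtype_val.comp continuous_projIcc).div_const _))
      fun t => (hv i).interp_mem_dom hT (hcl t)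
  set x : ℕ → C(ℝ, Z) := fun i => ⟨_, hcont i⟩ with hx
  have hxt : ∀ i, ∀ t ∈ Icc 0 T, x i t = P.f (interp (v i) (t / (T / (2 ^ i : ℕ)))) := by
    intro i t ht
    simp only [hx, ContinuousMap.coe_mk, projIcc_of_mem hTp.le ht]
  -- Any inner product equivalent to the norm of Z would do; the one at the initial value is used
  -- for all times.
  set ℓ := (P.ℓ (P.ι v0)).bilinearComp (P.Q (P.ι v0)) (P.Q (P.ι v0)) with hℓ
  have hℓa : ∀ y z, ℓ y z = P.ℓ (P.ι v0) (P.Q (P.ι v0) y) (P.Q (P.ι v0) z) := fun y z => rfl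
  have hl := hP.form _ hv0'
  have hint : ∀ G H : C(ℝ, Z), IntervalIntegrable (fun t => ℓ (G t) (H t)) MeasureTheory.volume 0 T :=
    fun G H => Continuous.intervalIntegrable (by fun_prop) _ _
  set s : LinearMap.BilinForm ℝ C(ℝ, Z) := LinearMap.mk₂ ℝ (fun G H => ∫ t in 0..T, ℓ (G t) (H t))
    (fun G G' H => by
      rw [← intervalIntegral.integral_add (hint _ _) (hint _ _)]; simp)
    (fun a G H => by
      rw [smul_eq_mul, ← intervalIntegral.integral_const_mul]; simp)
    (fun G H H' => by
      rw [← intervalIntegral.integral_add (hint _ _) (hint _ _)]; simp)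
    (fun a G H => by
      rw [smul_eq_mul, ← intervalIntegral.integral_const_mul]; simp) with hs
  have hsa : ∀ G H, s G H = ∫ t in 0..T, ℓ (G t) (H t) := fun G H => rfl
  have hlow : ∀ w, ‖w‖ ^ 2 ≤ (c.q * c.M) ^ 2 * ℓ w w := by
    intro w
    have h1 := hP.norm_le_formNorm hv0' w
    calc ‖w‖ ^ 2 ≤ (c.q * c.M * formNorm (P.ℓ (P.ι v0)) (P.Q (P.ι v0) w)) ^ 2 := by gcongr
      _ = _ := by rw [mul_pow, hl.formNorm_sq]; rfl
  obtain ⟨y, hy1, hy2⟩ := exists_cauchy_convexHull s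
    (fun G H => by simp only [hsa, hℓa]; congr 1; ext t; exact hl.symm _ _)
    (fun G => intervalIntegral.integral_nonneg hTp.le fun t _ => hl.nonneg _) x
    (K := T * (c.M * c.q * c.C) ^ 2) (fun i => by
      rw [hsa]
      have h1 : ∀ t ∈ Icc 0 T, ℓ (x i t) (x i t) ≤ (c.M * c.q * c.C) ^ 2 := by
        intro t ht
        have h2 := hP.formNorm_le hv0' (x i t)
        have h3 : ‖x i t‖ ≤ c.C := by
          rw [hxt i t ht]
          exact hP.f_norm _ ((hv i).interp_mem_dom hT ht)
        rw [hℓa, ← hl.formNorm_sq]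
        have h4 := EquivForm.formNorm_nonneg (P.ℓ (P.ι v0)) (P.Q (P.ι v0) (x i t))
        gcongr
        exact h2.trans (by gcongr)
      have h5 := intervalIntegral.integral_mono_on hTp.le (hint (x i) (x i))
        (intervalIntegrable_const (c := (c.M * c.q * c.C) ^ 2)) h1
      simpa using h5)
  refine ⟨fun i => y i, fun i => (y i).continuous, ?_, ?_, ?_⟩
  · intro i t ht
    have hsub : convexHull ℝ (x '' Ici i) ⊆ {G : C(ℝ, Z) | G t ∈ closedBall (0 : Z) c.C} := by
      refine convexHull_min ?_ ?_
      · rintro _ ⟨j, -, rfl⟩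
        change x j t ∈ closedBall (0 : Z) c.C
        rw [hxt j t ht, mem_closedBall_zero_iff]
        exact hP.f_norm _ ((hv j).interp_mem_dom hT ht)
      · intro G hG H hH a b ha hb hab
        exact convex_closedBall (0 : Z) c.C hG hH ha hb hab
    simpa using hsub (hy1 i)
  · intro η hη
    set σ := η / (2 * T) with hσ
    have hσ0 : 0 < σ := by positivity
    obtain ⟨J, hJ⟩ := hy2 (2 * σ * η / (c.q * c.M) ^ 2) (by positivity)
    refine ⟨J, fun i hi j hj => ?_⟩
    have h1 := hJ i hi j hj
    rw [hsa] at h1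
    -- The inequality x ≤ σ + x²/(4σ) passes from L² to L¹; σ is chosen so that the constant term
    -- integrates to η/2.
    have h2 : ∀ t ∈ Icc 0 T, ‖y i t - y j t‖ ≤
        σ + (c.q * c.M) ^ 2 / (4 * σ) * ℓ ((y i - y j) t) ((y i - y j) t) := by
      intro t _
      have h3 := hlow ((y i - y j) t)
      have h4 : ‖y i t - y j t‖ ≤ σ + ‖y i t - y j t‖ ^ 2 / (4 * σ) := by
        rw [← sub_le_iff_le_add', le_div_iff₀ (by positivity)]
        nlinarith [sq_nonneg (‖y i t - y j t‖ - 2 * σ)]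
      refine h4.trans ?_
      rw [div_mul_eq_mul_div]
      gcongr
      exact h3
    have h6 : IntervalIntegrable (fun t => ‖y i t - y j t‖) MeasureTheory.volume 0 T :=
      Continuous.intervalIntegrable (by fun_prop) _ _
    have h5 := intervalIntegral.integral_mono_on hTp.le h6
      (intervalIntegrable_const.add ((hint (y i - y j) (y i - y j)).const_mul _)) h2
    rw [intervalIntegral.integral_add intervalIntegrable_const ((hint _ _).const_mul _),
      intervalIntegral.integral_const_mul, intervalIntegral.integral_const, sub_zero,
      smul_eq_mul] at h5
    have h7 : (c.q * c.M) ^ 2 / (4 * σ) * ∫ t in 0..T, ℓ ((y i - y j) t) ((y i - y j) t) ≤ η / 2 := by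
      calc _ ≤ (c.q * c.M) ^ 2 / (4 * σ) * (2 * σ * η / (c.q * c.M) ^ 2) := by gcongr
        _ = η / 2 := by field_simp; norm_num
    have h8 : T * σ = η / 2 := by rw [hσ]; field_simp
    linarith
  · intro η hη
    obtain ⟨J, hJ⟩ := hc (η / c.C) (by positivity)
    refine ⟨J, fun i hi j hj t ht => ?_⟩
    -- All late terms f(v_k) lie in one small ball of Y about `z`. Balls are convex, so convex
    -- combinations stay there.
    set z := P.ι (P.f (interp (v j) (t / (T / (2 ^ j : ℕ))))) with hz
    have hsub : convexHull ℝ (x '' Ici i) ⊆ {G : C(ℝ, Z) | P.ι (G t) ∈ closedBall z η} := by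
      refine convexHull_min ?_ ?_
      · rintro _ ⟨k, hk, rfl⟩
        change P.ι (x k t) ∈ closedBall z η
        rw [hxt k t ht, mem_closedBall, dist_eq_norm, hz]
        refine (hP.f_lip _ ((hv k).interp_mem_dom hT ht) _ ((hv j).interp_mem_dom hT ht)).trans ?_
        have := hJ k (hi.trans hk) j hj t ht
        rw [le_div_iff₀ hC] at this
        linarith
      · intro G hG H hH a b ha hb hab
        have := convex_closedBall z η hG hH ha hb hab
        simpa using this
    have := hsub (hy1 i)
    simpa [dist_eq_norm] using this

end KatoPair

/-! ### Dyadic grids and the linear scheme for Q(v_n)v_n -/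

/-- The step size of a dyadic grid on `[0, T]`. -/
noncomputable abbrev dyadicStep (T : ℝ) (k : ℕ) : ℝ := T / ((2 ^ k : ℕ) : ℝ)

theorem dyadicStep_pos {T : ℝ} (hT : 0 < T) (k : ℕ) : 0 < dyadicStep T k := by
  unfold dyadicStep; positivity

theorem dyadicStep_eq (T : ℝ) {k l : ℕ} (h : k ≤ l) :
    dyadicStep T k = ((2 ^ (l - k) : ℕ) : ℝ) * dyadicStep T l := by
  obtain ⟨d, rfl⟩ := Nat.exists_eq_add_of_le h
  simp only [dyadicStep, Nat.add_sub_cancel_left]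
  push_cast
  rw [pow_add]
  field_simp

theorem natCast_mul_dyadicStep_mem {T : ℝ} (hT : 0 < T) {k n : ℕ} (hn : n ≤ 2 ^ k) :
    (n : ℝ) * dyadicStep T k ∈ Icc 0 T := by
  have h := dyadicStep_pos hT k
  refine ⟨by positivity, ?_⟩
  rw [dyadicStep, mul_div_assoc', div_le_iff₀ (by positivity), mul_comm]
  gcongr

/-- The point of a coarse grid before a given point of a fine grid. -/
theorem coarse_index {T : ℝ} (hT : 0 < T) {k l n : ℕ} (h : k ≤ l) (hn : n < 2 ^ l) :
    n / 2 ^ (l - k) < 2 ^ k ∧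
      |((n / 2 ^ (l - k) : ℕ) : ℝ) * dyadicStep T k - n * dyadicStep T l| ≤ dyadicStep T k ∧
      |((n / 2 ^ (l - k) + 1 : ℕ) : ℝ) * dyadicStep T k - (n + 1 : ℕ) * dyadicStep T l| ≤
        dyadicStep T k := by
  have hd := dyadicStep_pos hT l
  rw [dyadicStep_eq T h]
  have hm0 : 0 < 2 ^ (l - k) := by positivity
  have hlk : 2 ^ l = 2 ^ (l - k) * 2 ^ k := by rw [← pow_add]; congr 1; omega
  generalize 2 ^ (l - k) = m at *
  have h1 : n / m < 2 ^ k := by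
    rw [Nat.div_lt_iff_lt_mul hm0, mul_comm, ← hlk]; exact hn
  have h2 : n / m * m ≤ n := Nat.div_mul_le_self n m
  have h3 : n < (n / m + 1) * m := by
    have := Nat.div_add_mod n m
    have := Nat.mod_lt n hm0
    nlinarith
  have h2' : ((n / m : ℕ) : ℝ) * m ≤ n := by exact_mod_cast h2
  have h3' : (n : ℝ) + 1 ≤ (((n / m : ℕ) : ℝ) + 1) * m := by exact_mod_cast h3
  refine ⟨h1, ?_, ?_⟩
  · rw [← mul_assoc, ← sub_mul, abs_mul, abs_of_pos hd]
    gcongr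
    rw [abs_le]
    constructor <;> linarith
  · push_cast
    rw [← mul_assoc, ← sub_mul, abs_mul, abs_of_pos hd]
    gcongr
    have : (1 : ℝ) ≤ m := by exact_mod_cast hm0
    rw [abs_le]
    constructor <;> linarith
namespace KatoPair

variable {Y Z : Type*} [NormedAddCommGroup Y] [NormedSpace ℝ Y]
  [NormedAddCommGroup Z] [NormedSpace ℝ Z] {P : KatoPair Y Z} {c : PairConst}

/-- A sequence of implicit Euler schemes on dyadic grids that converges in `Y` and whose forcing is
a Cauchy sequence in `L¹(0, T; Z)`. -/
structure IsEulerSeq (P : KatoPair Y Z) (c : PairConst) (T : ℝ) (e : ℕ → ℕ) (V g : ℕ → ℕ → Z)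
    (p : ℝ → Y) : Prop where
  start : ∀ i j, V i 0 = V j 0
  euler : ∀ j, P.IsEuler c T (2 ^ e j) (V j) (g j)
  le_e : ∀ j, j ≤ e j
  cont : ContinuousOn p (Icc 0 T)
  mem : ∀ t ∈ Icc 0 T, p t ∈ ball P.y0 c.δ0
  lim : ∀ η > 0, ∃ J, ∀ j ≥ J, ∀ t ∈ Icc 0 T,
    ‖P.ι (interp (V j) (t / dyadicStep T (e j))) - p t‖ ≤ η
  forcing : ∀ η > 0, ∃ J, ∀ i ≥ J, ∀ j ≥ J, e i ≤ e j → dyadicStep T (e j) *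
    ∑ n ∈ Finset.range (2 ^ e j), ‖g j n - g i (n / 2 ^ (e j - e i))‖ ≤ η

/-- The image of a scheme in `Y`. -/
noncomputable def image (P : KatoPair Y Z) (V : ℕ → Z) (n : ℕ) : Y := P.Q (P.ι (V n)) (V n)

/-- The forcing for the image of a scheme in `Y`. -/
noncomputable def force (P : KatoPair Y Z) (V g : ℕ → Z) (n : ℕ) : Y :=
  P.Q (P.ι (V n)) (g n) + P.B (P.ι (V n)) (V (n + 1))

/-- The contribution of the change of `Q(v)` to the image of a scheme in `Y`. -/
noncomputable def drift (P : KatoPair Y Z) (h : ℝ) (V : ℕ → Z) (n : ℕ) : Y :=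
  h⁻¹ • (P.Q (P.ι (V (n + 1))) (V (n + 1)) - P.Q (P.ι (V n)) (V (n + 1)))

/-- The limit of `force`. -/
noncomputable def limForce (P : KatoPair Y Z) (x : Y) (a u : Z) : Y := P.Q x a + P.B x u

/-- The limit of `drift`. -/
noncomputable def limDrift (P : KatoPair Y Z) (x : Y) (a u : Z) : Y :=
  fderiv ℝ P.Q x (P.A x u + P.ι a) u

/-- Since Q(v) is bounded below, closeness in Z can be read off from the images in Y and from the
distance of the coefficients in Y. -/
theorem IsGood.norm_sub_le_image (hP : P.IsGood c) {v v' : Y} (hv : v ∈ ball P.y0 c.δ0)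
    (hv' : v' ∈ ball P.y0 c.δ0) {u u' : Z} (hu' : ‖u'‖ ≤ c.C) :
    ‖u - u'‖ ≤ c.C * ‖P.Q v u - P.Q v' u'‖ + c.C ^ 3 * ‖v - v'‖ := by
  have hC := c.C_pos; have hq := c.q_pos
  have e1 := hP.Q_inv v hv (u - u')
  have e2 := hP.Q_lip v hv v' hv' u'
  have e3 : P.Q v (u - u') = (P.Q v u - P.Q v' u') - (P.Q v u' - P.Q v' u') := by
    rw [map_sub]; abel
  have e4 : ‖P.Q v (u - u')‖ ≤ ‖P.Q v u - P.Q v' u'‖ + c.C * ‖v - v'‖ * c.C := by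
    rw [e3]
    refine (norm_sub_le _ _).trans ?_
    gcongr
    exact e2.trans (by gcongr)
  calc _ ≤ c.C * (‖P.Q v u - P.Q v' u'‖ + c.C * ‖v - v'‖ * c.C) := e1.trans (by
        gcongr; exact c.q_le_C)
    _ = _ := by ring

theorem IsGood.limForce_sub_le (hP : P.IsGood c) {x : Y} (hx : x ∈ ball P.y0 c.δ0) (a u a' u' : Z) :
    ‖P.limForce x a u - P.limForce x a' u'‖ ≤ c.C * (‖u - u'‖ + ‖a - a'‖) := by
  have e1 := hP.Q_norm x hx (a - a')
  have e2 := hP.B_norm x hx (u - u')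
  have e3 : P.limForce x a u - P.limForce x a' u' = P.Q x (a - a') + P.B x (u - u') := by
    simp only [limForce, map_sub]; abel
  have e4 : c.q * ‖a - a'‖ ≤ c.C * ‖a - a'‖ := by gcongr; exact c.q_le_C
  rw [e3]
  refine (norm_add_le _ _).trans ?_
  linarith

/-- The drift is bilinear in the velocity and u, and the velocity is linear in (a, u); hence a
Lipschitz bound on bounded sets of Z. -/
theorem IsGood.limDrift_sub_le (hP : P.IsGood c) {x : Y} (hx : x ∈ ball P.y0 c.δ0) {a u a' u' : Z}
    (ha : ‖a‖ ≤ c.C) (hu : ‖u‖ ≤ c.C) (hu' : ‖u'‖ ≤ c.C) :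
    ‖P.limDrift x a u - P.limDrift x a' u'‖ ≤ 3 * c.C ^ 3 * (‖u - u'‖ + ‖a - a'‖) := by
  have hC := c.C_pos
  set D := fderiv ℝ P.Q x with hD
  have hDn := hP.fderiv_Q x hx
  have e3 : P.limDrift x a u - P.limDrift x a' u' =
      D (P.A x u + P.ι a) (u - u') + D (P.A x (u - u') + P.ι (a - a')) u' := by
    simp only [limDrift, map_sub, map_add, sub_apply, add_apply, ← hD]; abel
  have hop : ∀ w z, ‖D w z‖ ≤ c.C * ‖w‖ * ‖z‖ := fun w z =>
    D.le_of_opNorm₂_le_of_le hDn le_rfl le_rfl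
  have e4 := hP.increment_le hx ha hu
  have e5 : ‖P.A x (u - u') + P.ι (a - a')‖ ≤ c.C * ‖u - u'‖ + c.C * ‖a - a'‖ :=
    (norm_add_le _ _).trans (add_le_add (hP.A_norm x hx _) (hP.norm_ι _))
  rw [e3]
  have e6 := (hop (P.A x u + P.ι a) (u - u')).trans
    (show _ ≤ c.C * (2 * c.C ^ 2) * ‖u - u'‖ by gcongr)
  have e7 := (hop (P.A x (u - u') + P.ι (a - a')) u').trans
    (show _ ≤ c.C * (c.C * ‖u - u'‖ + c.C * ‖a - a'‖) * c.C by gcongr)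
  refine (norm_add_le _ _).trans ((add_le_add e6 e7).trans ?_)
  have : 0 ≤ c.C ^ 3 * ‖a - a'‖ := by positivity
  linarith

namespace IsEulerSeq

variable {T : ℝ} {e : ℕ → ℕ} {V g : ℕ → ℕ → Z} {p : ℝ → Y}

theorem tendsto_step (h : P.IsEulerSeq c T e V g p) :
    Tendsto (fun j => dyadicStep T (e j)) atTop (𝓝 0) :=
  (tendsto_div_two_pow T).comp (tendsto_atTop_mono h.le_e tendsto_id)

theorem exists_step_le (h : P.IsEulerSeq c T e V g p) {η : ℝ} (hη : 0 < η) :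
    ∃ J, ∀ j ≥ J, dyadicStep T (e j) ≤ η :=
  eventually_atTop.1 (h.tendsto_step.eventually_le_const hη)

theorem ι_eq_interp {T : ℝ} (hT : 0 < T) (v : ℕ → Z) (k n : ℕ) :
    P.ι (v n) = P.ι (interp v ((n : ℝ) * dyadicStep T k / dyadicStep T k)) := by
  rw [mul_div_cancel_right₀ _ (dyadicStep_pos hT k).ne', interp_natCast]

/-- The window of two steps covers both nodes n and n + 1 when t is within one step of the node n.
-/
theorem ι_sub_le (h : P.IsEulerSeq c T e V g p) (hP : P.IsGood c) (hT : c.IsTime T) {η : ℝ}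
    (hη : 0 < η) : ∃ J, ∀ j ≥ J, ∀ n : ℕ, n ≤ 2 ^ e j → ∀ t ∈ Icc 0 T,
      |n * dyadicStep T (e j) - t| ≤ 2 * dyadicStep T (e j) → ‖P.ι (V j n) - p t‖ ≤ η := by
  have hC := c.C_pos
  obtain ⟨J1, hJ1⟩ := h.lim (η / 2) (by positivity)
  obtain ⟨J2, hJ2⟩ := h.exists_step_le (show 0 < η / (8 * c.C ^ 2) by positivity)
  refine ⟨max J1 J2, fun j hj n hn t ht hnt => ?_⟩
  have e1 := hJ1 j ((le_max_left _ _).trans hj) t ht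
  have e2 := hJ2 j ((le_max_right _ _).trans hj)
  have e3 := (h.euler j).interp_lipschitz hP hT _ (natCast_mul_dyadicStep_mem hT.pos hn) t ht
  rw [← ι_eq_interp hT.pos] at e3
  have e4 := norm_sub_le_norm_sub_add_norm_sub (P.ι (V j n))
    (P.ι (interp (V j) (t / dyadicStep T (e j)))) (p t)
  have e5 : 2 * c.C ^ 2 * |n * dyadicStep T (e j) - t| ≤
      2 * c.C ^ 2 * (2 * (η / (8 * c.C ^ 2))) := by gcongr; linarith
  have e6 : 2 * c.C ^ 2 * (2 * (η / (8 * c.C ^ 2))) = η / 2 := by field_simp; norm_num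
  linarith

theorem ι_sub_ι_le (h : P.IsEulerSeq c T e V g p) (hP : P.IsGood c) (hT : c.IsTime T) {η : ℝ}
    (hη : 0 < η) : ∃ J, ∀ i ≥ J, ∀ j ≥ J, ∀ n : ℕ, n ≤ 2 ^ e i → ∀ l : ℕ, l ≤ 2 ^ e j →
      |n * dyadicStep T (e i) - l * dyadicStep T (e j)| ≤
        dyadicStep T (e i) + dyadicStep T (e j) → ‖P.ι (V i n) - P.ι (V j l)‖ ≤ η := by
  have hC := c.C_pos
  obtain ⟨J1, hJ1⟩ := h.lim (η / 4) (by positivity)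
  obtain ⟨J2, hJ2⟩ := h.exists_step_le (show 0 < η / (8 * c.C ^ 2) by positivity)
  refine ⟨max J1 J2, fun i hi j hj n hn l hl hnl => ?_⟩
  have hs := natCast_mul_dyadicStep_mem hT.pos hn
  have hs' := natCast_mul_dyadicStep_mem hT.pos hl
  have e1 := hJ1 i ((le_max_left _ _).trans hi) _ hs'
  have e1' := hJ1 j ((le_max_left _ _).trans hj) _ hs'
  have e2 := hJ2 i ((le_max_right _ _).trans hi)
  have e2' := hJ2 j ((le_max_right _ _).trans hj)
  have e3 := (h.euler i).interp_lipschitz hP hT _ hs _ hs'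
  rw [← ι_eq_interp hT.pos] at e3
  rw [← ι_eq_interp hT.pos] at e1'
  set y := P.ι (interp (V i) (l * dyadicStep T (e j) / dyadicStep T (e i))) with hy
  have e4 : ‖P.ι (V i n) - P.ι (V j l)‖ ≤ ‖P.ι (V i n) - y‖ +
      ‖y - p (l * dyadicStep T (e j))‖ + ‖P.ι (V j l) - p (l * dyadicStep T (e j))‖ := by
    have : P.ι (V i n) - P.ι (V j l) = (P.ι (V i n) - y) +
      (y - p (l * dyadicStep T (e j))) - (P.ι (V j l) - p (l * dyadicStep T (e j))) := by abel
    rw [this]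
    exact (norm_sub_le _ _).trans (add_le_add_left (norm_add_le _ _) _)
  have e5 : 2 * c.C ^ 2 * |n * dyadicStep T (e i) - l * dyadicStep T (e j)| ≤
      2 * c.C ^ 2 * (2 * (η / (8 * c.C ^ 2))) := by gcongr; linarith
  have e6 : 2 * c.C ^ 2 * (2 * (η / (8 * c.C ^ 2))) = η / 2 := by field_simp; norm_num
  linarith

/-- `B` and the derivative of `Q` are only continuous. The limit curve is compact in Y, so their
continuity is uniform near it; this is why convergence in Y has to come first. -/
theorem exists_uniform (h : P.IsEulerSeq c T e V g p) (hP : P.IsGood c) {η : ℝ} (hη : 0 < η) :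
    ∃ ρ > 0, ∀ t ∈ Icc 0 T, ∀ y ∈ ball (p t) ρ, y ∈ ball P.y0 c.δ0 ∧ ‖P.B y - P.B (p t)‖ ≤ η ∧
      ‖fderiv ℝ P.Q y - fderiv ℝ P.Q (p t)‖ ≤ η := by
  have hK : IsCompact (p '' Icc 0 T) := isCompact_Icc.image_of_continuousOn h.cont
  have hKU : p '' Icc 0 T ⊆ ball P.y0 c.δ0 := by rintro _ ⟨t, ht, rfl⟩; exact h.mem t ht
  obtain ⟨ρ1, hρ1, h1⟩ := hK.exists_thickening_subset_open isOpen_ball hKU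
  have hF : ContinuousOn (fun y => (P.B y, fderiv ℝ P.Q y)) (ball P.y0 c.δ0) :=
    hP.B_cont.prodMk (hP.Q_contDiff.continuousOn_fderiv_of_isOpen isOpen_ball le_rfl)
  have h2 := hK.uniformContinuousAt_of_continuousAt (r := {q | dist q.1 q.2 < η})
    (fun y => (P.B y, fderiv ℝ P.Q y))
    (fun y hy => hF.continuousAt (isOpen_ball.mem_nhds (hKU hy))) (Metric.dist_mem_uniformity hη)
  obtain ⟨ρ2, hρ2, h3⟩ := Metric.mem_uniformity_dist.1 h2
  refine ⟨min ρ1 ρ2, lt_min hρ1 hρ2, fun t ht y hy => ?_⟩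
  have hpt : p t ∈ p '' Icc 0 T := ⟨t, ht, rfl⟩
  have h4 := h3 (a := p t) (b := y)
    (by rw [dist_comm]; exact lt_of_lt_of_le hy (min_le_right _ _)) hpt
  have h5 : dist (P.B (p t), fderiv ℝ P.Q (p t)) (P.B y, fderiv ℝ P.Q y) < η := h4
  rw [Prod.dist_eq, max_lt_iff] at h5
  refine ⟨h1 (mem_thickening_iff.2 ⟨_, hpt, lt_of_lt_of_le hy (min_le_left _ _)⟩), ?_, ?_⟩
  · rw [← dist_eq_norm, dist_comm]; exact h5.1.le
  · rw [← dist_eq_norm, dist_comm]; exact h5.2.le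

/-- The velocity (v' - v)/h equals A(v)u + ιa exactly, and the mean value inequality with DQ nearly
constant near x = p t gives Q(v') - Q(v) = DQ(x)(v' - v) + o(h), uniformly in n. -/
theorem force_drift_sub_le (h : P.IsEulerSeq c T e V g p) (hP : P.IsGood c) (hT : c.IsTime T)
    {η : ℝ} (hη : 0 < η) : ∃ J, ∀ j ≥ J, ∀ n : ℕ, n < 2 ^ e j → ∀ t ∈ Icc 0 T,
      |n * dyadicStep T (e j) - t| ≤ dyadicStep T (e j) →
      ‖P.force (V j) (g j) n - P.limForce (p t) (g j n) (V j (n + 1))‖ ≤ η ∧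
      ‖P.drift (dyadicStep T (e j)) (V j) n - P.limDrift (p t) (g j n) (V j (n + 1))‖ ≤ η := by
  have hC := c.C_pos
  have hC1 := c.one_le_C
  set σ := η / (4 * c.C ^ 4) with hσ
  have hσ0 : 0 < σ := by positivity
  have hση : 4 * c.C ^ 4 * σ = η := by rw [hσ]; field_simp
  obtain ⟨ρ, hρ, hu⟩ := h.exists_uniform hP hσ0
  obtain ⟨J, hJ⟩ := h.ι_sub_le hP hT (show 0 < min (ρ / 2) σ by positivity)
  refine ⟨J, fun j hj n hn t ht hnt => ?_⟩
  have hstep := dyadicStep_pos hT.pos (e j)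
  have hv := hJ j hj n hn.le t ht (by linarith)
  have hv' := hJ j hj (n + 1) hn t ht (by
    have : ((n + 1 : ℕ) : ℝ) * dyadicStep T (e j) - t =
      (n * dyadicStep T (e j) - t) + dyadicStep T (e j) := by push_cast; ring
    rw [this]
    refine (abs_add_le _ _).trans ?_
    rw [abs_of_pos hstep]; linarith)
  have hxb := h.mem t ht
  have hEu := h.euler j
  have hvb := hEu.mem_ball hn.le
  have hun := hEu.norm_le hT (n := n + 1) hn
  have hgn := hEu.norm_g n hn
  have hvel := hEu.velocity_le hP hT hn
  have hsub := hEu.sub_eq hn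
  simp only [force, drift, limForce, limDrift]
  set x := p t with hx
  set u := V j (n + 1) with hu'
  set v := P.ι (V j n) with hvdef
  set v' := P.ι u with hv'def
  set a := g j n with ha
  have hvσ : ‖v - x‖ ≤ σ := hv.trans (min_le_right _ _)
  have hvρ : v ∈ ball x ρ := by
    rw [Metric.mem_ball, dist_eq_norm]
    exact (hv.trans (min_le_left _ _)).trans_lt (half_lt_self hρ)
  have hvρ' : v' ∈ ball x ρ := by
    rw [Metric.mem_ball, dist_eq_norm]
    exact (hv'.trans (min_le_left _ _)).trans_lt (half_lt_self hρ)
  constructor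
  · have e1 := hP.Q_lip v hvb x hxb a
    have e2 := (P.B v - P.B x).le_of_opNorm_le (hu t ht v hvρ).2.1 u
    have e3 : P.Q v a + P.B v u - (P.Q x a + P.B x u) =
        (P.Q v a - P.Q x a) + (P.B v - P.B x) u := by rw [sub_apply]; abel
    have e4 : c.C * ‖v - x‖ * ‖a‖ ≤ c.C * σ * c.C := by gcongr
    have e5 : σ * ‖u‖ ≤ σ * c.C := by gcongr
    rw [e3]
    refine (norm_add_le _ _).trans ((add_le_add (e1.trans e4) (e2.trans e5)).trans ?_)
    have e6 : c.C ^ 2 ≤ c.C ^ 4 := by gcongr; norm_num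
    have e7 : c.C ≤ c.C ^ 4 := le_self_pow₀ hC1 (by norm_num)
    rw [← hση]
    nlinarith
  · set D := fderiv ℝ P.Q x with hD
    have hop : ∀ w z, ‖D w z‖ ≤ c.C * ‖w‖ * ‖z‖ := fun w z =>
      D.le_of_opNorm₂_le_of_le (hP.fderiv_Q x hxb) le_rfl le_rfl
    have e1 := (convex_ball x ρ).norm_image_sub_le_of_norm_fderiv_le' (𝕜 := ℝ) (f := P.Q)
      (fun y hy => (hP.Q_contDiff.differentiableOn one_ne_zero).differentiableAt
        (isOpen_ball.mem_nhds (hu t ht y hy).1)) (fun y hy => (hu t ht y hy).2.2) hvρ hvρ'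
    set w := P.A v u + P.ι a with hw
    have e2 := (P.Q v' - P.Q v - D (v' - v)).le_of_opNorm_le e1 u
    have e3 : (dyadicStep T (e j))⁻¹ • (P.Q v' u - P.Q v u) - D (P.A x u + P.ι a) u =
        (dyadicStep T (e j))⁻¹ • ((P.Q v' - P.Q v - D (v' - v)) u) + D (P.A v u - P.A x u) u := by
      rw [hsub]
      have : P.A v u - P.A x u = w - (P.A x u + P.ι a) := by rw [hw]; abel
      rw [this]
      simp only [map_smul, map_sub, sub_apply, smul_apply, smul_sub, smul_smul,
        inv_mul_cancel₀ hstep.ne', one_smul]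
      abel
    rw [e3]
    have e4 : ‖v' - v‖ ≤ dyadicStep T (e j) * (2 * c.C ^ 2) := by
      rw [hsub, norm_smul, Real.norm_of_nonneg hstep.le]
      gcongr
    have e5 : ‖(dyadicStep T (e j))⁻¹ • ((P.Q v' - P.Q v - D (v' - v)) u)‖ ≤
        σ * (2 * c.C ^ 2) * c.C := by
      rw [norm_smul, norm_inv, Real.norm_of_nonneg hstep.le, inv_mul_le_iff₀ hstep]
      calc _ ≤ σ * ‖v' - v‖ * ‖u‖ := e2
        _ ≤ σ * (dyadicStep T (e j) * (2 * c.C ^ 2)) * c.C := by gcongr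
        _ = _ := by ring
    have e6 := hP.A_lip v hvb x hxb u
    have e7 := (hop (P.A v u - P.A x u) u).trans (show _ ≤ c.C * (c.C * σ * c.C) * c.C by
      gcongr; exact e6.trans (by gcongr))
    refine (norm_add_le _ _).trans ((add_le_add e5 e7).trans ?_)
    have e8 : c.C ^ 3 ≤ c.C ^ 4 := by gcongr; norm_num
    rw [← hση]
    nlinarith

/-- Both schemes are compared with the limit expressions at the same point of the limit curve. What
remains is their Lipschitz dependence on u and a in Z, with C + 3C³ ≤ 4C³. -/
theorem force_drift_sub_coarse_le (h : P.IsEulerSeq c T e V g p) (hP : P.IsGood c)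
    (hT : c.IsTime T) {η : ℝ} (hη : 0 < η) :
    ∃ J, ∀ i ≥ J, ∀ j ≥ J, e i ≤ e j → ∀ n : ℕ, n < 2 ^ e j →
      ‖P.force (V j) (g j) n - P.force (V i) (g i) (n / 2 ^ (e j - e i))‖ +
      ‖P.drift (dyadicStep T (e j)) (V j) n -
        P.drift (dyadicStep T (e i)) (V i) (n / 2 ^ (e j - e i))‖ ≤
      η + 4 * c.C ^ 3 * (‖V j (n + 1) - V i (n / 2 ^ (e j - e i) + 1)‖ +
        ‖g j n - g i (n / 2 ^ (e j - e i))‖) := by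
  have hC := c.C_pos
  have hC1 := c.one_le_C
  obtain ⟨J, hJ⟩ := h.force_drift_sub_le hP hT (show 0 < η / 4 by positivity)
  refine ⟨J, fun i hi j hj hij n hn => ?_⟩
  obtain ⟨hc1, hc2, -⟩ := coarse_index hT.pos hij hn
  set n' := n / 2 ^ (e j - e i) with hn'
  have hs := natCast_mul_dyadicStep_mem hT.pos hn.le
  have hxb := h.mem _ hs
  obtain ⟨a1, a2⟩ := hJ j hj n hn _ hs (by
    rw [sub_self, abs_zero]; exact (dyadicStep_pos hT.pos _).le)
  obtain ⟨b1, b2⟩ := hJ i hi n' hc1 _ hs hc2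
  set x := p (n * dyadicStep T (e j)) with hx
  have c1 := hP.limForce_sub_le hxb (g j n) (V j (n + 1)) (g i n') (V i (n' + 1))
  have c2 := hP.limDrift_sub_le hxb (a' := g i n') ((h.euler j).norm_g n hn)
    ((h.euler j).norm_le hT (n := n + 1) hn) ((h.euler i).norm_le hT (n := n' + 1) hc1)
  have tri : ∀ (A B A' B' : Y), ‖A - B‖ ≤ ‖A - A'‖ + ‖A' - B'‖ + ‖B - B'‖ := by
    intro A B A' B'
    have : A - B = (A - A') + (A' - B') - (B - B') := by abel
    rw [this]
    exact (norm_sub_le _ _).trans (add_le_add_left (norm_add_le _ _) _)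
  have d1 := tri (P.force (V j) (g j) n) (P.force (V i) (g i) n')
    (P.limForce x (g j n) (V j (n + 1))) (P.limForce x (g i n') (V i (n' + 1)))
  have d2 := tri (P.drift (dyadicStep T (e j)) (V j) n) (P.drift (dyadicStep T (e i)) (V i) n')
    (P.limDrift x (g j n) (V j (n + 1))) (P.limDrift x (g i n') (V i (n' + 1)))
  have e1 : c.C ≤ c.C ^ 3 := le_self_pow₀ hC1 (by norm_num)
  have e2 := mul_le_mul_of_nonneg_right e1
    (show 0 ≤ ‖V j (n + 1) - V i (n' + 1)‖ + ‖g j n - g i n'‖ by positivity)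
  linarith

end IsEulerSeq

end KatoPair

/-! ### Linear comparison schemes with forcing in Z -/

/-- A discrete Gronwall inequality. -/
theorem le_exp_mul_of_le_exp_mul {a e : ℕ → ℝ} {κ h : ℝ} {N : ℕ} (hκ : 0 ≤ κ) (h0 : 0 ≤ h)
    (he : ∀ n < N, 0 ≤ e n) (ha : ∀ n < N, a (n + 1) ≤ Real.exp (κ * h) * (a n + h * e n)) :
    ∀ n ≤ N, a n ≤ Real.exp (κ * (n * h)) * (a 0 + h * ∑ k ∈ Finset.range n, e k) := by
  intro n
  induction n with
  | zero => simp
  | succ n ih =>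
    intro hn
    have i1 := ih (by omega)
    have i2 := he n hn
    have h1 : 1 ≤ Real.exp (κ * (n * h)) := Real.one_le_exp (by positivity)
    have h2 : h * e n ≤ Real.exp (κ * (n * h)) * (h * e n) :=
      le_mul_of_one_le_left (by positivity) h1
    calc a (n + 1) ≤ Real.exp (κ * h) * (a n + h * e n) := ha n hn
      _ ≤ Real.exp (κ * h) * (Real.exp (κ * (n * h)) * (a 0 + h * ∑ k ∈ Finset.range n, e k) +
          Real.exp (κ * (n * h)) * (h * e n)) := by gcongr
      _ = Real.exp (κ * h + κ * (n * h)) * (a 0 + h * ∑ k ∈ Finset.range (n + 1), e k) := by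
        rw [Finset.sum_range_succ, Real.exp_add]; ring
      _ = _ := by
        congr 2
        push_cast
        ring

namespace PairConst

/-- A bound in `Z` for comparison schemes. -/
noncomputable def compBound (c : PairConst) (T β : ℝ) : ℝ :=
  c.q * c.M * (Real.exp (c.rate * T) * (c.M * c.q * β + T * (2 * (c.M * c.q * β)))) + β

theorem le_compBound (c : PairConst) {T β : ℝ} (hT : 0 ≤ T) (hβ : 0 ≤ β) :
    β ≤ c.compBound T β := by
  have hM := c.M_pos; have hq := c.q_pos
  unfold compBound
  exact le_add_of_nonneg_left (by positivity)

end PairConst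

namespace KatoPair

variable {Y Z : Type*} [NormedAddCommGroup Y] [NormedSpace ℝ Y]
  [NormedAddCommGroup Z] [NormedSpace ℝ Z] {P : KatoPair Y Z} {c : PairConst}

/-- A linear scheme with the coefficients of a given implicit Euler scheme and forcing in `Z`. -/
structure IsComparator (P : KatoPair Y Z) (c : PairConst) (T : ℝ) (N : ℕ) (v Γ E u z : ℕ → Z) :
    Prop where
  res : ∀ n < N, P.IsRes c (P.ι (v n)) (T / N) (z n + (T / N) • Γ n) (u n)
  succ : ∀ n < N, z (n + 1) = u n + (T / N) • E n

theorem IsEuler.step_le {T : ℝ} {N : ℕ} {v g : ℕ → Z} (h : P.IsEuler c T N v g) (hT : 0 < T) :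
    T / N ≤ T :=
  div_le_self hT.le (by exact_mod_cast h.pos)

theorem IsEuler.natCast_mul_step_le {T : ℝ} {N : ℕ} {v g : ℕ → Z} (h : P.IsEuler c T N v g)
    (hT : 0 < T) {n : ℕ} (hn : n ≤ N) : n * (T / N) ≤ T := by
  have hN' : (0 : ℝ) < N := by exact_mod_cast h.pos
  rw [mul_div_assoc', div_le_iff₀ hN', mul_comm]
  gcongr

theorem IsEuler.exists_isComparator {T : ℝ} {N : ℕ} {v g : ℕ → Z} (h : P.IsEuler c T N v g)
    (hP : P.IsGood c) (hT : c.IsTime T) (Γ E : ℕ → Z) (z0 : Z) :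
    ∃ u z, z 0 = z0 ∧ P.IsComparator c T N v Γ E u z := by
  have hex : ∀ (n : ℕ) (w : Z), ∃ u, n < N → P.IsRes c (P.ι (v n)) (T / N) w u := by
    intro n w
    by_cases hn : n < N
    · obtain ⟨u, hu1, hu2⟩ := hP.resolvent _ (h.mem_ball hn.le) (T / N) (h.step_pos hT.pos)
        ((h.step_le hT.pos).trans hT.le_h0) w
      exact ⟨u, fun _ => ⟨hu1, hu2⟩⟩
    · exact ⟨0, fun h => absurd h hn⟩
  choose J hJ using hex
  let z : ℕ → Z := fun n => Nat.rec z0 (fun n w => J n (w + (T / N) • Γ n) + (T / N) • E n) n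
  exact ⟨fun n => J n (z n + (T / N) • Γ n), z, rfl, fun n hn => hJ n _ hn, fun n _ => rfl⟩

namespace IsComparator

variable {T : ℝ} {N : ℕ} {v g Γ E u z : ℕ → Z}

/-- The one-step bounds of the nonlinear scheme apply again. Forcing acts both inside and outside
the resolvent, hence the factor 2 in `compBound`; the bound does not depend on N. -/
theorem norm_le (hz : P.IsComparator c T N v Γ E u z) (h : P.IsEuler c T N v g)
    (hP : P.IsGood c) (hT : c.IsTime T) {β : ℝ} (h0 : ‖z 0‖ ≤ β) (hΓ : ∀ n < N, ‖Γ n‖ ≤ β)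
    (hE : ∀ n < N, ‖E n‖ ≤ β) : ∀ n < N, ‖u n‖ ≤ c.compBound T β := by
  have hM := c.M_pos; have hq := c.q_pos; have hC := c.C_pos
  have hβ : 0 ≤ β := (norm_nonneg _).trans h0
  have hs := h.step_pos hT.pos
  have hr : T / N * c.rate ≤ 1 / 2 := hT.rate_le.trans' (by
    have := c.rate_pos
    gcongr
    exact h.step_le hT.pos)
  set k := T / N with hk
  have hrate : c.resRate * k + c.shiftRate * (2 * c.C ^ 2 * k) ≤ c.rate * k := by
    have : 0 ≤ c.M * c.q * c.C * k := by positivity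
    unfold PairConst.rate; linarith
  have hres : ∀ n < N, formNorm (P.ℓ (P.ι (v n))) (P.Q (P.ι (v n)) (u n)) ≤
      Real.exp (c.resRate * k) * (formNorm (P.ℓ (P.ι (v n))) (P.Q (P.ι (v n)) (z n)) +
        k * (c.M * c.q * β)) := by
    intro n hn
    have hmem := h.mem_ball hn.le
    refine (hP.res_le hmem hs.le hr (hz.res n hn)).trans ?_
    gcongr
    rw [map_add, map_smul]
    refine ((hP.form _ hmem).formNorm_add_le _ _).trans ?_
    rw [EquivForm.formNorm_smul, abs_of_pos hs]
    gcongr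
    exact (hP.formNorm_le hmem _).trans (by gcongr; exact hΓ n hn)
  have hexp : Real.exp (c.resRate * k) ≤ Real.exp (c.rate * k) := by
    gcongr; exact c.resRate_le_rate
  have hshift : ∀ n < N, formNorm (P.ℓ (P.ι (v (n + 1)))) (P.Q (P.ι (v (n + 1))) (z (n + 1))) ≤
      Real.exp (c.rate * k) * (formNorm (P.ℓ (P.ι (v n))) (P.Q (P.ι (v n)) (z n)) +
        k * (2 * (c.M * c.q * β))) := by
    intro n hn
    have hmem := h.mem_ball hn.le
    have hmem' := h.mem_ball (n := n + 1) hn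
    have e1 := hP.formNorm_Q_shift_le hmem hmem' (h.norm_sub_le hP hT hn) (u n)
    have e2 : formNorm (P.ℓ (P.ι (v (n + 1)))) (P.Q (P.ι (v (n + 1))) (z (n + 1))) ≤
        formNorm (P.ℓ (P.ι (v (n + 1)))) (P.Q (P.ι (v (n + 1))) (u n)) + k * (c.M * c.q * β) := by
      rw [hz.succ n hn, map_add, map_smul]
      refine ((hP.form _ hmem').formNorm_add_le _ _).trans ?_
      rw [EquivForm.formNorm_smul, abs_of_pos hs]
      gcongr
      exact (hP.formNorm_le hmem' _).trans (by gcongr; exact hE n hn)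
    set b := formNorm (P.ℓ (P.ι (v n))) (P.Q (P.ι (v n)) (z n)) with hb
    have hb0 : 0 ≤ b := EquivForm.formNorm_nonneg _ _
    have e3 := e1.trans (mul_le_mul_of_nonneg_left (hres n hn) (Real.exp_pos _).le)
    rw [← mul_assoc, ← Real.exp_add] at e3
    have e4 : Real.exp (c.shiftRate * (2 * c.C ^ 2 * k) + c.resRate * k) *
        (b + k * (c.M * c.q * β)) ≤ Real.exp (c.rate * k) * (b + k * (c.M * c.q * β)) := by
      gcongr
      linarith
    have e5 : k * (c.M * c.q * β) ≤ Real.exp (c.rate * k) * (k * (c.M * c.q * β)) :=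
      le_mul_of_one_le_left (by positivity)
        (Real.one_le_exp (mul_nonneg c.rate_pos.le hs.le))
    linarith
  have key := le_exp_mul_of_le_exp_mul (N := N)
    (a := fun n => formNorm (P.ℓ (P.ι (v n))) (P.Q (P.ι (v n)) (z n)))
    (e := fun _ => 2 * (c.M * c.q * β)) c.rate_pos.le hs.le (fun _ _ => by positivity) hshift
  intro n hn
  have hmem := h.mem_ball hn.le
  have hnT := h.natCast_mul_step_le hT.pos (n := n + 1) hn
  have e1 := key n hn.le
  have e0 : formNorm (P.ℓ (P.ι (v 0))) (P.Q (P.ι (v 0)) (z 0)) ≤ c.M * c.q * β :=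
    (hP.formNorm_le (h.mem_ball (Nat.zero_le _)) _).trans (by gcongr)
  have hcr := c.rate_pos
  have e2 : formNorm (P.ℓ (P.ι (v n))) (P.Q (P.ι (v n)) (u n)) ≤
      Real.exp (c.rate * T) * (c.M * c.q * β + T * (2 * (c.M * c.q * β))) := by
    simp only [Finset.sum_const, Finset.card_range, nsmul_eq_mul] at e1
    have e3 : k * (c.M * c.q * β) ≤ Real.exp (c.rate * (n * k)) * (k * (2 * (c.M * c.q * β))) := by
      have : k * (c.M * c.q * β) ≤ k * (2 * (c.M * c.q * β)) := by
        linarith [show 0 ≤ k * (c.M * c.q * β) by positivity]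
      exact this.trans (le_mul_of_one_le_left (by positivity) (Real.one_le_exp (by positivity)))
    calc _ ≤ Real.exp (c.rate * k) * (Real.exp (c.rate * (n * k)) *
          (c.M * c.q * β + k * (n * (2 * (c.M * c.q * β)))) +
          Real.exp (c.rate * (n * k)) * (k * (2 * (c.M * c.q * β)))) := by
          refine (hres n hn).trans ?_
          have h1 : Real.exp (c.rate * (n * k)) * (formNorm (P.ℓ (P.ι (v 0)))
            (P.Q (P.ι (v 0)) (z 0)) + k * (n * (2 * (c.M * c.q * β)))) ≤
            Real.exp (c.rate * (n * k)) *
              (c.M * c.q * β + k * (n * (2 * (c.M * c.q * β)))) := by gcongr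
          have h2 := EquivForm.formNorm_nonneg (P.ℓ (P.ι (v n))) (P.Q (P.ι (v n)) (z n))
          have h3 : 0 ≤ k * (c.M * c.q * β) := by positivity
          gcongr
          exact e1.trans h1
      _ = Real.exp (c.rate * ((n + 1 : ℕ) * k)) *
          (c.M * c.q * β + ((n + 1 : ℕ) * k) * (2 * (c.M * c.q * β))) := by
          have : c.rate * ((n + 1 : ℕ) * k) = c.rate * k + c.rate * (n * k) := by push_cast; ring
          rw [this, Real.exp_add]
          push_cast
          ring
      _ ≤ _ := by gcongr
  refine (hP.norm_le_formNorm hmem _).trans ?_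
  unfold PairConst.compBound
  have := mul_le_mul_of_nonneg_left e2 (mul_pos hq hM).le
  linarith

/-- The distance between the image of a scheme and a comparison scheme. -/
theorem norm_image_sub_le (hz : P.IsComparator c T N v Γ E u z) (h : P.IsEuler c T N v g)
    (hP : P.IsGood c) (hT : c.IsTime T) {n : ℕ} (hn : n ≤ N) :
    ‖P.image v n - P.ι (z n)‖ ≤ c.M * (Real.exp (c.rate * T) *
      (c.M * (‖P.image v 0 - P.ι (z 0)‖ + T / N * ∑ k ∈ Finset.range N,
        (‖P.force v g k - P.ι (Γ k)‖ + ‖P.drift (T / N) v k - P.ι (E k)‖)))) := by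
  have hM := c.M_pos; have hq := c.q_pos; have hC := c.C_pos
  have hs := h.step_pos hT.pos
  have hr : T / N * c.rate ≤ 1 / 2 := hT.rate_le.trans' (by
    have := c.rate_pos
    gcongr
    exact h.step_le hT.pos)
  have hnT := h.natCast_mul_step_le hT.pos hn
  set k := T / N with hk
  have hrate : c.C * c.M ^ 2 * (2 * c.C ^ 2 * k) + c.resRate * k ≤ c.rate * k := by
    have h1 : 0 ≤ c.M * c.q * c.C * k := by positivity
    have h2 : 0 ≤ c.M ^ 2 * c.C * c.q * (2 * c.C ^ 2 * k) := by positivity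
    unfold PairConst.rate PairConst.shiftRate; linarith
  have step : ∀ n < N, formNorm (P.ℓ (P.ι (v (n + 1)))) (P.image v (n + 1) - P.ι (z (n + 1))) ≤
      Real.exp (c.rate * k) * (formNorm (P.ℓ (P.ι (v n))) (P.image v n - P.ι (z n)) +
        k * (c.M * (‖P.force v g n - P.ι (Γ n)‖ + ‖P.drift k v n - P.ι (E n)‖))) := by
    intro n hn
    have hmem := h.mem_ball hn.le
    have hmem' := h.mem_ball (n := n + 1) hn
    have hl := hP.form _ hmem
    have e1 := (h.res n hn).sub_le hs.le hr (hz.res n hn).eq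
    -- Q(v_n)v_{n+1} is the resolvent in Y of the image plus h times `force`, and replacing Q(v_n)
    -- by Q(v_{n+1}) adds h times `drift`. So image and comparison scheme obey the same recursion
    -- with different data.
    have d1 : P.Q (P.ι (v n)) (v n + k • g n) + k • P.B (P.ι (v n)) (v (n + 1)) -
        P.ι (z n + k • Γ n) = (P.image v n - P.ι (z n)) + k • (P.force v g n - P.ι (Γ n)) := by
      simp only [image, force, map_add, map_smul, smul_sub, smul_add]; abel
    have d2 : P.image v (n + 1) - P.ι (z (n + 1)) = (P.Q (P.ι (v n)) (v (n + 1)) - P.ι (u n)) +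
        k • (P.drift k v n - P.ι (E n)) := by
      rw [hz.succ n hn]
      simp only [image, drift, map_add, map_smul, smul_sub, smul_smul, mul_inv_cancel₀ hs.ne',
        one_smul]
      abel
    set a := formNorm (P.ℓ (P.ι (v n))) (P.image v n - P.ι (z n)) with ha
    have ha0 : 0 ≤ a := EquivForm.formNorm_nonneg _ _
    have hsm : ∀ x : Y, formNorm (P.ℓ (P.ι (v n))) (k • x) ≤ k * (c.M * ‖x‖) := by
      intro x
      rw [EquivForm.formNorm_smul, abs_of_pos hs]
      gcongr
      exact hl.formNorm_le x
    have e2 := hP.formNorm_shift_le hmem hmem' (h.norm_sub_le hP hT hn)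
      (P.image v (n + 1) - P.ι (z (n + 1)))
    have e3 : formNorm (P.ℓ (P.ι (v n))) (P.image v (n + 1) - P.ι (z (n + 1))) ≤
        Real.exp (c.resRate * k) * (a + k * (c.M * ‖P.force v g n - P.ι (Γ n)‖) +
          k * (c.M * ‖P.drift k v n - P.ι (E n)‖)) := by
      rw [d2]
      refine (hl.formNorm_add_le _ _).trans ?_
      have f1 := hsm (P.drift k v n - P.ι (E n))
      have f2 : formNorm (P.ℓ (P.ι (v n))) (P.Q (P.ι (v n)) (v n + k • g n) +
          k • P.B (P.ι (v n)) (v (n + 1)) - P.ι (z n + k • Γ n)) ≤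
          a + k * (c.M * ‖P.force v g n - P.ι (Γ n)‖) := by
        rw [d1]
        exact (hl.formNorm_add_le _ _).trans (add_le_add_right (hsm _) _)
      have f3 := e1.trans (mul_le_mul_of_nonneg_left f2 (Real.exp_pos _).le)
      have f4 : k * (c.M * ‖P.drift k v n - P.ι (E n)‖) ≤ Real.exp (c.resRate * k) *
          (k * (c.M * ‖P.drift k v n - P.ι (E n)‖)) :=
        le_mul_of_one_le_left (by positivity)
          (Real.one_le_exp (mul_nonneg c.resRate_pos.le hs.le))
      linarith
    have e4 := e2.trans (mul_le_mul_of_nonneg_left e3 (Real.exp_pos _).le)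
    rw [← mul_assoc, ← Real.exp_add] at e4
    refine e4.trans ?_
    calc _ ≤ Real.exp (c.rate * k) * (a + k * (c.M * ‖P.force v g n - P.ι (Γ n)‖) +
          k * (c.M * ‖P.drift k v n - P.ι (E n)‖)) := by gcongr
      _ = _ := by ring
  have key := le_exp_mul_of_le_exp_mul (N := N)
    (a := fun n => formNorm (P.ℓ (P.ι (v n))) (P.image v n - P.ι (z n)))
    (e := fun n => c.M * (‖P.force v g n - P.ι (Γ n)‖ + ‖P.drift k v n - P.ι (E n)‖))
    c.rate_pos.le hs.le (fun _ _ => by positivity) step n hn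
  refine ((hP.form _ (h.mem_ball hn)).norm_le _).trans ?_
  have hcr := c.rate_pos
  gcongr
  refine key.trans ?_
  have e0 := (hP.form _ (h.mem_ball (Nat.zero_le N))).formNorm_le (P.image v 0 - P.ι (z 0))
  have e1 : ∑ x ∈ Finset.range n, c.M *
      (‖P.force v g x - P.ι (Γ x)‖ + ‖P.drift k v x - P.ι (E x)‖) ≤
      c.M * ∑ x ∈ Finset.range N, (‖P.force v g x - P.ι (Γ x)‖ + ‖P.drift k v x - P.ι (E x)‖) := by
    rw [← Finset.mul_sum]
    gcongr
  have e2 : c.M * (‖P.image v 0 - P.ι (z 0)‖ + k * ∑ x ∈ Finset.range N,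
      (‖P.force v g x - P.ι (Γ x)‖ + ‖P.drift k v x - P.ι (E x)‖)) =
      c.M * ‖P.image v 0 - P.ι (z 0)‖ + k * (c.M * ∑ x ∈ Finset.range N,
      (‖P.force v g x - P.ι (Γ x)‖ + ‖P.drift k v x - P.ι (E x)‖)) := by ring
  rw [e2]
  have f0 : 0 ≤ formNorm (P.ℓ (P.ι (v 0))) (P.image v 0 - P.ι (z 0)) :=
    EquivForm.formNorm_nonneg _ _
  have f1 : 0 ≤ ∑ x ∈ Finset.range n, c.M *
      (‖P.force v g x - P.ι (Γ x)‖ + ‖P.drift k v x - P.ι (E x)‖) :=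
    Finset.sum_nonneg fun _ _ => by positivity
  gcongr

theorem velocity_le (hz : P.IsComparator c T N v Γ E u z) (h : P.IsEuler c T N v g)
    (hP : P.IsGood c) (hT : c.IsTime T) {β : ℝ} (h0 : ‖z 0‖ ≤ β) (hΓ : ∀ n < N, ‖Γ n‖ ≤ β)
    (hE : ∀ n < N, ‖E n‖ ≤ β) {n : ℕ} (hn : n < N) :
    ‖P.A (P.ι (v n)) (u n) + P.ι (Γ n + E n)‖ ≤ 3 * c.C * c.compBound T β := by
  have hC := c.C_pos
  have hβ := c.le_compBound hT.pos.le ((norm_nonneg _).trans h0)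
  have e1 := (hP.A_norm _ (h.mem_ball hn.le) (u n)).trans
    (mul_le_mul_of_nonneg_left (hz.norm_le h hP hT h0 hΓ hE n hn) hC.le)
  have e2 : ‖P.ι (Γ n + E n)‖ ≤ c.C * (c.compBound T β + c.compBound T β) :=
    (hP.norm_ι _).trans (by
      gcongr
      exact norm_add_le_of_le ((hΓ n hn).trans hβ) ((hE n hn).trans hβ))
  refine (norm_add_le _ _).trans ?_
  linarith

theorem sub_eq (hz : P.IsComparator c T N v Γ E u z) (hs : T / N ≠ 0) {n : ℕ} (hn : n < N) :
    (T / N)⁻¹ • (P.ι (z (n + 1)) - P.ι (z n)) =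
      P.A (P.ι (v n)) (u n) + P.ι (Γ n + E n) := by
  have e1 := (hz.res n hn).eq
  have e2 : P.ι (u n) = P.ι (z n) + (T / N) • P.ι (Γ n) + (T / N) • P.A (P.ι (v n)) (u n) := by
    rw [sub_eq_iff_eq_add] at e1
    rw [e1, map_add, map_smul]
  rw [inv_smul_eq_iff₀ hs, hz.succ n hn, map_add, map_smul, e2]
  simp only [map_add, smul_add]
  abel

/-- A acts on `u n`, which differs from `z (n + 1)` by the outer forcing. Together with the velocity
bound this gives 4 = 3 + 1 in the closeness constant. -/
theorem isPath (hz : P.IsComparator c T N v Γ E u z) (h : P.IsEuler c T N v g)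
    (hP : P.IsGood c) (hT : c.IsTime T) {β : ℝ} (h0 : ‖z 0‖ ≤ β) (hΓ : ∀ n < N, ‖Γ n‖ ≤ β)
    (hE : ∀ n < N, ‖E n‖ ≤ β) :
    P.IsPath c T (c.compBound T β) (4 * c.C * c.compBound T β * (T / N))
      (fun t => P.ι (interp z (t / (T / N)))) (fun t => P.ι (v ⌊t / (T / N)⌋₊))
      (fun t => u ⌊t / (T / N)⌋₊) (fun t => P.ι (Γ ⌊t / (T / N)⌋₊ + E ⌊t / (T / N)⌋₊)) := by
  have hC := c.C_pos
  have hs := h.step_pos hT.pos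
  have hβ := c.le_compBound hT.pos.le ((norm_nonneg _).trans h0)
  refine ⟨?_, ?_, ?_, ?_, ?_⟩
  · exact (P.ι.continuous.comp ((continuous_interp z).comp (continuous_id.div_const _))).continuousOn
  · intro t ht
    have hn := floor_lt_of_mem_Ico h.pos ht
    have h1 := hasDerivWithinAt_interp (fun n => P.ι (z n)) hs ht.1
    rw [hz.sub_eq hs.ne' hn] at h1
    simp only [map_interp]
    exact h1
  · exact fun t ht => h.mem_ball (floor_lt_of_mem_Ico h.pos ht).le
  · exact fun t ht => hz.norm_le h hP hT h0 hΓ hE _ (floor_lt_of_mem_Ico h.pos ht)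
  · intro t ht
    have := ht.1
    have hn := floor_lt_of_mem_Ico h.pos ht
    have h1 := (norm_sub_endpoints_le_of_mem_segment (interp_mem_segment (fun n => P.ι (z n))
      (show 0 ≤ t / (T / N) by positivity))).2
    have h2 := hz.sub_eq hs.ne' hn
    have h3 := hz.velocity_le h hP hT h0 hΓ hE hn
    rw [← h2, norm_smul, norm_inv, Real.norm_of_nonneg hs.le, inv_mul_le_iff₀ hs] at h3
    rw [map_interp]
    set n := ⌊t / (T / N)⌋₊
    have h4 : ‖P.ι (z (n + 1)) - P.ι (u n)‖ ≤ T / N * (c.C * c.compBound T β) := by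
      rw [hz.succ n hn, map_add, map_smul, add_sub_cancel_left, norm_smul,
        Real.norm_of_nonneg hs.le]
      gcongr
      exact (hP.norm_ι _).trans (by gcongr; exact (hE n hn).trans hβ)
    have h5 := norm_sub_le_norm_sub_add_norm_sub (interp (fun n => P.ι (z n)) (t / (T / N)))
      (P.ι (z (n + 1))) (P.ι (u n))
    linarith

end IsComparator

end KatoPair

/-! ### Convergence of the schemes in Z -/

/-- Data prescribed on the coarse grid thus become the same function of t for every finer scheme. -/
theorem floor_div_dyadicStep {T : ℝ} (hT : 0 < T) {k l : ℕ} (h : k ≤ l) (t : ℝ) :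
    ⌊t / dyadicStep T l⌋₊ / 2 ^ (l - k) = ⌊t / dyadicStep T k⌋₊ := by
  have h1 := dyadicStep_pos hT l
  rw [← Nat.floor_div_natCast, dyadicStep_eq T h, div_div, mul_comm]

namespace KatoPair

variable {Y Z : Type*} [NormedAddCommGroup Y] [NormedSpace ℝ Y]
  [NormedAddCommGroup Z] [NormedSpace ℝ Z] {P : KatoPair Y Z} {c : PairConst}

namespace IsEulerSeq

variable {T : ℝ} {e : ℕ → ℕ} {V g : ℕ → ℕ → Z} {p : ℝ → Y}

/-- Comparison schemes with forcing that is constant on a fixed grid are a Cauchy sequence. -/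
theorem comparator_cauchy (h : P.IsEulerSeq c T e V g p) (hP : P.IsGood c) (hT : c.IsTime T)
    {k : ℕ} {Γ E : ℕ → Z} {u z : ℕ → ℕ → Z} {z0 : Z} {β : ℝ} (hz0 : ∀ j, z j 0 = z0)
    (h0 : ‖z0‖ ≤ β) (hΓ : ∀ n : ℕ, n < 2 ^ k → ‖Γ n‖ ≤ β) (hE : ∀ n : ℕ, n < 2 ^ k → ‖E n‖ ≤ β)
    (hz : ∀ j, P.IsComparator c T (2 ^ e j) (V j) (fun n => Γ (n / 2 ^ (e j - k)))
      (fun n => E (n / 2 ^ (e j - k))) (u j) (z j)) {η : ℝ} (hη : 0 < η) :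
    ∃ J, ∀ i ≥ J, ∀ j ≥ J, ∀ n : ℕ, n ≤ 2 ^ e i → ∀ l : ℕ, l ≤ 2 ^ e j →
      |n * dyadicStep T (e i) - l * dyadicStep T (e j)| ≤
        dyadicStep T (e i) + dyadicStep T (e j) → ‖P.ι (z i n) - P.ι (z j l)‖ ≤ η := by
  have hC := c.C_pos; have hM := c.M_pos
  have hβ := c.le_compBound hT.pos.le ((norm_nonneg _).trans h0)
  set b := c.compBound T β with hb
  have hb0 : 0 ≤ b := ((norm_nonneg _).trans h0).trans hβ
  have hcmp : 0 ≤ c.cmp b 0 (2 * c.C ^ 2) := by unfold PairConst.cmp; positivity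
  set D := c.M ^ 2 * (Real.exp (c.cmp b 0 (2 * c.C ^ 2) * T) * (c.cmp b 0 (2 * c.C ^ 2) * T)) with hD
  have hD0 : 0 ≤ D := by have := hT.pos; positivity
  set ε := min 1 ((η / 2) ^ 2 / (D + 1)) with hε
  have hε0 : 0 < ε := lt_min one_pos (by positivity)
  have hDε : D * ε ≤ (η / 2) ^ 2 := by
    calc D * ε ≤ (D + 1) * ((η / 2) ^ 2 / (D + 1)) := by
          gcongr
          · linarith
          · exact min_le_right _ _
      _ = _ := by field_simp
  obtain ⟨J1, hJ1⟩ := h.lim (ε / 4) (by positivity)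
  obtain ⟨J2, hJ2⟩ := h.exists_step_le (show 0 < ε / (4 * c.C ^ 2) by positivity)
  obtain ⟨J3, hJ3⟩ := h.exists_step_le (show 0 < ε / (4 * c.C * b + 1) by positivity)
  obtain ⟨J4, hJ4⟩ := h.exists_step_le (show 0 < η / (4 * (3 * c.C * b + 1)) by positivity)
  have hidx : ∀ {j n : ℕ}, k ≤ e j → n < 2 ^ e j → n / 2 ^ (e j - k) < 2 ^ k :=
    fun h1 h2 => (coarse_index hT.pos h1 h2).1
  have hpath : ∀ j ≥ max J3 k, P.IsPath c T b ε (fun t => P.ι (interp (z j) (t / dyadicStep T (e j))))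
      (fun t => P.ι (V j ⌊t / dyadicStep T (e j)⌋₊)) (fun t => u j ⌊t / dyadicStep T (e j)⌋₊)
      (fun t => P.ι (Γ ⌊t / dyadicStep T k⌋₊ + E ⌊t / dyadicStep T k⌋₊)) := by
    intro j hj
    have hkj : k ≤ e j := ((le_max_right _ _).trans hj).trans (h.le_e j)
    have h1 := (hz j).isPath (h.euler j) hP hT (by rw [hz0]; exact h0)
      (fun n hn => hΓ _ (hidx hkj hn)) (fun n hn => hE _ (hidx hkj hn))
    have h2 := hJ3 j ((le_max_left _ _).trans hj)
    rw [le_div_iff₀ (by positivity)] at h2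
    have h3 := dyadicStep_pos hT.pos (e j)
    refine ⟨h1.cont, ?_, h1.mem, h1.norm_le, fun t ht => (h1.close t ht).trans ?_⟩
    · intro t ht
      have := h1.deriv t ht
      have hfl := floor_div_dyadicStep hT.pos hkj t
      simp only [dyadicStep] at hfl
      simp only [hfl] at this
      exact this
    · rw [← hb]
      simp only [dyadicStep] at h2 h3
      linarith
  have hvel : ∀ j ≥ k, ∀ t ∈ Icc 0 T, ∀ t' ∈ Icc 0 T,
      ‖P.ι (interp (z j) (t / dyadicStep T (e j))) - P.ι (interp (z j) (t' / dyadicStep T (e j)))‖ ≤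
        3 * c.C * b * |t - t'| := by
    intro j hj
    have hkj : k ≤ e j := hj.trans (h.le_e j)
    have h1 := (hz j).isPath (h.euler j) hP hT (by rw [hz0]; exact h0)
      (fun n hn => hΓ _ (hidx hkj hn)) (fun n hn => hE _ (hidx hkj hn))
    exact h1.lipschitz fun t ht => (hz j).velocity_le (h.euler j) hP hT (by rw [hz0]; exact h0)
      (fun n hn => hΓ _ (hidx hkj hn)) (fun n hn => hE _ (hidx hkj hn))
      (floor_lt_of_mem_Ico (h.euler j).pos ht)
  have hclose : ∀ i ≥ max J1 J2, ∀ j ≥ max J1 J2, ∀ t ∈ Ico 0 T,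
      ‖P.ι (V i ⌊t / dyadicStep T (e i)⌋₊) - P.ι (interp (V j) (t / dyadicStep T (e j)))‖ ≤
        0 * ‖P.ι (interp (z i) (t / dyadicStep T (e i))) -
          P.ι (interp (z j) (t / dyadicStep T (e j)))‖ + ε := by
    intro i hi j hj t ht
    have e1 := (h.euler i).interp_sub_floor_le hP hT ht
    have e2 := hJ1 i ((le_max_left _ _).trans hi) t (Ico_subset_Icc_self ht)
    have e3 := hJ1 j ((le_max_left _ _).trans hj) t (Ico_subset_Icc_self ht)
    have e4 := hJ2 i ((le_max_right _ _).trans hi)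
    rw [le_div_iff₀ (by positivity)] at e4
    simp only [dyadicStep] at e2 e3 e4 ⊢
    set x := P.ι (V i ⌊t / (T / (2 ^ e i : ℕ))⌋₊)
    set y := P.ι (interp (V i) (t / (T / (2 ^ e i : ℕ))))
    set y' := P.ι (interp (V j) (t / (T / (2 ^ e j : ℕ))))
    have e5 : x - y' = (x - y) + (y - p t) - (y' - p t) := by abel
    rw [e5, zero_mul, zero_add]
    refine (norm_sub_le _ _).trans ?_
    have := norm_add_le (x - y) (y - p t)
    linarith
  refine ⟨max (max J1 J2) (max (max J3 k) J4), fun i hi j hj n hn l hl hnl => ?_⟩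
  have hi1 : i ≥ max J1 J2 := (le_max_left _ _).trans hi
  have hj1 : j ≥ max J1 J2 := (le_max_left _ _).trans hj
  have hi2 : i ≥ max J3 k := ((le_max_left _ _).trans (le_max_right _ _)).trans hi
  have hj2 : j ≥ max J3 k := ((le_max_left _ _).trans (le_max_right _ _)).trans hj
  have hi3 : i ≥ J4 := ((le_max_right _ _).trans (le_max_right _ _)).trans hi
  have hj3 : j ≥ J4 := ((le_max_right _ _).trans (le_max_right _ _)).trans hj
  have hs := natCast_mul_dyadicStep_mem hT.pos hn
  have hs' := natCast_mul_dyadicStep_mem hT.pos hl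
  -- Here κ = 0: the coefficients come from the given schemes, already close in Y, and both forcings
  -- are the same function of t.
  have key := hP.compare hb0 le_rfl (by positivity : (0 : ℝ) ≤ 2 * c.C ^ 2) hε0.le (min_le_left _ _)
    (fun t ht => ((h.euler j).interp_mem_dom hT ht).1) ((h.euler j).interp_lipschitz hP hT)
    (hpath i hi2) (hpath j hj2) (hclose i hi1 j hj1) (fun t ht => by
      have := hclose j hj1 j hj1 t ht
      rw [zero_mul, zero_add] at this ⊢
      exact this)
    (fun t _ => by rw [sub_self, norm_zero, zero_mul, zero_add]; exact hε0.le) _ hs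
  have e1 : ‖P.ι (interp (z i) (n * dyadicStep T (e i) / dyadicStep T (e i))) -
      P.ι (interp (z j) (n * dyadicStep T (e i) / dyadicStep T (e j)))‖ ≤ η / 2 := by
    refine (abs_le_of_sq_le_sq' ((key.trans ?_).trans hDε) (by positivity)).2
    simp only [zero_div, interp_zero, hz0, sub_self, norm_zero]
    have hs0 := hs.1
    have hs1 := hs.2
    calc _ ≤ c.M ^ 2 * (Real.exp (c.cmp b 0 (2 * c.C ^ 2) * T) *
          (c.M ^ 2 * 0 ^ 2 + c.cmp b 0 (2 * c.C ^ 2) * ε * T)) := by gcongr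
      _ = _ := by ring
  rw [← ι_eq_interp hT.pos] at e1
  have e2 := hvel j ((le_max_right _ _).trans hj2) _ hs _ hs'
  rw [← ι_eq_interp hT.pos] at e2
  have e3 := hJ4 i hi3
  have e4 := hJ4 j hj3
  rw [le_div_iff₀ (by positivity)] at e3 e4
  have h3 := dyadicStep_pos hT.pos (e i)
  have h4 := dyadicStep_pos hT.pos (e j)
  have e5 : 3 * c.C * b * |n * dyadicStep T (e i) - l * dyadicStep T (e j)| ≤
      3 * c.C * b * (dyadicStep T (e i) + dyadicStep T (e j)) := by gcongr
  refine (norm_sub_le_norm_sub_add_norm_sub _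
    (P.ι (interp (z j) (n * dyadicStep T (e i) / dyadicStep T (e j)))) _).trans ?_
  linarith

/-- The images of the schemes at neighbouring times are eventually `d`-close. -/
def ImageClose (P : KatoPair Y Z) (T : ℝ) (e : ℕ → ℕ) (V : ℕ → ℕ → Z) (d : ℝ) : Prop :=
  ∃ J, ∀ i ≥ J, ∀ j ≥ J, ∀ n : ℕ, n ≤ 2 ^ e i → ∀ l : ℕ, l ≤ 2 ^ e j →
    |n * dyadicStep T (e i) - l * dyadicStep T (e j)| ≤
      dyadicStep T (e i) + dyadicStep T (e j) → ‖P.image (V i) n - P.image (V j) l‖ ≤ d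

theorem imageClose_const (h : P.IsEulerSeq c T e V g p) (hP : P.IsGood c) (hT : c.IsTime T) :
    ImageClose P T e V (2 * c.C ^ 2) := by
  have hC := c.C_pos
  have key : ∀ j, ∀ n : ℕ, n ≤ 2 ^ e j → ‖P.image (V j) n‖ ≤ c.C ^ 2 := by
    intro j n hn
    calc _ ≤ c.q * ‖V j n‖ := hP.Q_norm _ ((h.euler j).mem_ball hn) _
      _ ≤ c.C * c.C := by gcongr; exacts [c.q_le_C, (h.euler j).norm_le hT hn]
      _ = _ := by ring
  refine ⟨0, fun i _ j _ n hn l hl _ => (norm_sub_le _ _).trans ?_⟩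
  linarith [key i n hn, key j l hl]

/-- Fix a late scheme I and approximate its initial image, force and drift by elements of Z, dense
in Y. Comparison schemes driven by these data differ from the image of scheme j by the integrated
forcing error, which is O(T) times the distance in Z of schemes j and I, itself at most C d plus
small terms. For short times this is at most d/8. The comparison schemes are eventually d/4-close,
and 1/8 + 1/4 + 1/8 = 1/2. -/
theorem ImageClose.half (h : P.IsEulerSeq c T e V g p) (hP : P.IsGood c) (hT : c.IsTime T)
    {d : ℝ} (hd : 0 < d) (hcl : ImageClose P T e V d) : ImageClose P T e V (d / 2) := by
  have hC := c.C_pos; have hM := c.M_pos; have hTp := hT.pos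
  -- `K` is the total coefficient of η in the final estimate; η is chosen so that these errors
  -- amount to d/16.
  set K := c.M * (Real.exp (c.rate * T) * (c.M * (1 + T * (3 + 4 * c.C ^ 6) + 4 * c.C ^ 3))) with hK
  have hK0 : 0 < K := by positivity
  set η := d / (16 * K) with hη
  have hη0 : 0 < η := by positivity
  have hKη : K * η = d / 16 := by rw [hη]; field_simp
  obtain ⟨J1, hJ1⟩ := hcl
  obtain ⟨J2, hJ2⟩ := h.force_drift_sub_coarse_le hP hT hη0
  obtain ⟨J3, hJ3⟩ := h.forcing η hη0
  obtain ⟨J4, hJ4⟩ := h.ι_sub_ι_le hP hT hη0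
  set I := max (max J1 J2) (max J3 J4) with hI
  have hI1 : J1 ≤ I := (le_max_left _ _).trans (le_max_left _ _)
  have hI2 : J2 ≤ I := (le_max_right _ _).trans (le_max_left _ _)
  have hI3 : J3 ≤ I := (le_max_left _ _).trans (le_max_right _ _)
  have hI4 : J4 ≤ I := (le_max_right _ _).trans (le_max_right _ _)
  have happ : ∀ y : Y, ∃ w : Z, ‖y - P.ι w‖ ≤ η := fun y => by
    obtain ⟨w, hw⟩ := hP.denseRange.exists_dist_lt y hη0
    exact ⟨w, by rw [← dist_eq_norm]; exact hw.le⟩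
  choose Γ hΓ using fun n => happ (P.force (V I) (g I) n)
  choose E hE using fun n => happ (P.drift (dyadicStep T (e I)) (V I) n)
  obtain ⟨z0, hz0⟩ := happ (P.image (V I) 0)
  choose u z hzz hz using fun j => (h.euler j).exists_isComparator hP hT
    (fun n => Γ (n / 2 ^ (e j - e I))) (fun n => E (n / 2 ^ (e j - e I))) z0
  -- β depends on the approximation in Z and may be huge for small d. This is harmless, since
  -- `comparator_cauchy` is used with I and the data fixed.
  set β := ‖z0‖ + ∑ n ∈ Finset.range (2 ^ e I), (‖Γ n‖ + ‖E n‖) with hβ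
  have hβn : ∀ n : ℕ, n < 2 ^ e I → ‖Γ n‖ + ‖E n‖ ≤ β := by
    intro n hn
    have := Finset.single_le_sum (f := fun n => ‖Γ n‖ + ‖E n‖) (fun _ _ => by positivity)
      (Finset.mem_range.2 hn)
    have h0 := norm_nonneg z0
    linarith
  have hβ0 : ‖z0‖ ≤ β := le_add_of_nonneg_right (Finset.sum_nonneg fun _ _ => by positivity)
  obtain ⟨J5, hJ5⟩ := h.comparator_cauchy hP hT hzz hβ0
    (fun n hn => (le_add_of_nonneg_right (norm_nonneg _)).trans (hβn n hn))
    (fun n hn => (le_add_of_nonneg_left (norm_nonneg _)).trans (hβn n hn)) hz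
    (show 0 < d / 4 by positivity)
  have hcomp : ∀ j ≥ max I (e I), ∀ n : ℕ, n ≤ 2 ^ e j → ‖P.image (V j) n - P.ι (z j n)‖ ≤ d / 8 := by
    intro j hj n hn
    have hjI : I ≤ j := (le_max_left _ _).trans hj
    have hej : e I ≤ e j := ((le_max_right _ _).trans hj).trans (h.le_e j)
    have hs := dyadicStep_pos hTp (e j)
    have step : ∀ n ∈ Finset.range (2 ^ e j),
        ‖P.force (V j) (g j) n - P.ι (Γ (n / 2 ^ (e j - e I)))‖ +
        ‖P.drift (dyadicStep T (e j)) (V j) n - P.ι (E (n / 2 ^ (e j - e I)))‖ ≤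
        (3 * η + 4 * c.C ^ 3 * (c.C * d + c.C ^ 3 * η)) +
          4 * c.C ^ 3 * ‖g j n - g I (n / 2 ^ (e j - e I))‖ := by
      intro n hn
      have hn := Finset.mem_range.1 hn
      obtain ⟨hc1, -, hc3⟩ := coarse_index hTp hej hn
      have e1 := hJ2 I hI2 j (hI2.trans hjI) hej n hn
      set n' := n / 2 ^ (e j - e I) with hn'
      have hwin : |((n + 1 : ℕ) : ℝ) * dyadicStep T (e j) - (n' + 1 : ℕ) * dyadicStep T (e I)| ≤
          dyadicStep T (e j) + dyadicStep T (e I) := by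
        rw [abs_sub_comm]; linarith
      have e2 := hJ1 j (hI1.trans hjI) I hI1 (n + 1) hn (n' + 1) hc1 hwin
      have e3 := hJ4 j (hI4.trans hjI) I hI4 (n + 1) hn (n' + 1) hc1 hwin
      have e4 := hP.norm_sub_le_image ((h.euler j).mem_ball (n := n + 1) hn)
        ((h.euler I).mem_ball (n := n' + 1) hc1) (u := V j (n + 1))
        ((h.euler I).norm_le hT (n := n' + 1) hc1)
      have e5 : ‖V j (n + 1) - V I (n' + 1)‖ ≤ c.C * d + c.C ^ 3 * η :=
        e4.trans (by gcongr; exact e2)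
      have e6 := norm_sub_le_norm_sub_add_norm_sub (P.force (V j) (g j) n)
        (P.force (V I) (g I) n') (P.ι (Γ n'))
      have e7 := norm_sub_le_norm_sub_add_norm_sub (P.drift (dyadicStep T (e j)) (V j) n)
        (P.drift (dyadicStep T (e I)) (V I) n') (P.ι (E n'))
      have e8 := hΓ n'
      have e9 := hE n'
      have e10 := mul_le_mul_of_nonneg_left e5 (show 0 ≤ 4 * c.C ^ 3 by positivity)
      linarith
    have hsum : dyadicStep T (e j) * ∑ n ∈ Finset.range (2 ^ e j),
        (‖P.force (V j) (g j) n - P.ι (Γ (n / 2 ^ (e j - e I)))‖ +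
        ‖P.drift (dyadicStep T (e j)) (V j) n - P.ι (E (n / 2 ^ (e j - e I)))‖) ≤
        T * (3 * η + 4 * c.C ^ 3 * (c.C * d + c.C ^ 3 * η)) + 4 * c.C ^ 3 * η := by
      refine (mul_le_mul_of_nonneg_left (Finset.sum_le_sum step) hs.le).trans ?_
      rw [Finset.sum_add_distrib, ← Finset.mul_sum, Finset.sum_const, Finset.card_range,
        nsmul_eq_mul, mul_add, ← mul_assoc]
      have e1 : dyadicStep T (e j) * ((2 ^ e j : ℕ) : ℝ) = T := div_mul_cancel₀ _ (by positivity)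
      rw [e1]
      have e2 := mul_le_mul_of_nonneg_left (hJ3 I hI3 j (hI3.trans hjI) hej)
        (show 0 ≤ 4 * c.C ^ 3 by positivity)
      linarith
    refine ((hz j).norm_image_sub_le (h.euler j) hP hT hn).trans ?_
    have himg : P.image (V j) 0 = P.image (V I) 0 := by
      simp only [image, h.start j I]
    rw [hzz, himg]
    calc _ ≤ c.M * (Real.exp (c.rate * T) * (c.M * (η +
          (T * (3 * η + 4 * c.C ^ 3 * (c.C * d + c.C ^ 3 * η)) + 4 * c.C ^ 3 * η)))) := by
          gcongr
      _ = c.M * (Real.exp (c.rate * T) * (c.M * (T * (8 * c.C ^ 4)))) * (d / 2) + K * η := by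
          rw [hK]; ring
      _ ≤ 1 / 16 * (d / 2) + d / 16 := by
          rw [hKη]; gcongr; exact hT.contraction
      _ ≤ d / 8 := by linarith
  refine ⟨max J5 (max I (e I)), fun i hi j hj n hn l hl hnl => ?_⟩
  have e1 := hcomp i ((le_max_right _ _).trans hi) n hn
  have e2 := hcomp j ((le_max_right _ _).trans hj) l hl
  have e3 := hJ5 i ((le_max_left _ _).trans hi) j ((le_max_left _ _).trans hj) n hn l hl hnl
  have e4 : P.image (V i) n - P.image (V j) l = (P.image (V i) n - P.ι (z i n)) +
      (P.ι (z i n) - P.ι (z j l)) - (P.image (V j) l - P.ι (z j l)) := by abel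
  rw [e4]
  refine (norm_sub_le _ _).trans ?_
  have := norm_add_le (P.image (V i) n - P.ι (z i n)) (P.ι (z i n) - P.ι (z j l))
  linarith

theorem imageClose (h : P.IsEulerSeq c T e V g p) (hP : P.IsGood c) (hT : c.IsTime T)
    {η : ℝ} (hη : 0 < η) : ImageClose P T e V η := by
  have hC := c.C_pos
  have key : ∀ k : ℕ, ImageClose P T e V (2 * c.C ^ 2 * (1 / 2) ^ k) := by
    intro k
    induction k with
    | zero => simpa using h.imageClose_const hP hT
    | succ k ih =>
      have := ih.half h hP hT (by positivity)
      convert this using 1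
      rw [pow_succ]; ring
  obtain ⟨k, hk⟩ := exists_pow_lt_of_lt_one (show 0 < η / (2 * c.C ^ 2) by positivity)
    (show (1 / 2 : ℝ) < 1 by norm_num)
  rw [lt_div_iff₀ (by positivity)] at hk
  obtain ⟨J, hJ⟩ := key k
  exact ⟨J, fun i hi j hj n hn l hl hnl => (hJ i hi j hj n hn l hl hnl).trans (by linarith)⟩

/-- The interpolated schemes are a uniform Cauchy sequence in `Z`. -/
theorem cauchy (h : P.IsEulerSeq c T e V g p) (hP : P.IsGood c) (hT : c.IsTime T)
    {η : ℝ} (hη : 0 < η) : ∃ J, ∀ i ≥ J, ∀ j ≥ J, ∀ t ∈ Icc 0 T,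
      ‖interp (V i) (t / dyadicStep T (e i)) - interp (V j) (t / dyadicStep T (e j))‖ ≤ η := by
  have hC := c.C_pos
  obtain ⟨J1, hJ1⟩ := h.imageClose hP hT (show 0 < η / (2 * c.C) by positivity)
  obtain ⟨J2, hJ2⟩ := h.ι_sub_ι_le hP hT (show 0 < η / (2 * c.C ^ 3) by positivity)
  refine ⟨max J1 J2, fun i hi j hj t ht => ?_⟩
  have hsi := dyadicStep_pos hT.pos (e i)
  have hsj := dyadicStep_pos hT.pos (e j)
  have key : ∀ n : ℕ, n ≤ 2 ^ e i → ∀ l : ℕ, l ≤ 2 ^ e j →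
      |n * dyadicStep T (e i) - l * dyadicStep T (e j)| ≤
        dyadicStep T (e i) + dyadicStep T (e j) → ‖V i n - V j l‖ ≤ η := by
    intro n hn l hl hnl
    have e1 := hJ1 i ((le_max_left _ _).trans hi) j ((le_max_left _ _).trans hj) n hn l hl hnl
    have e2 := hJ2 i ((le_max_right _ _).trans hi) j ((le_max_right _ _).trans hj) n hn l hl hnl
    have e3 := hP.norm_sub_le_image ((h.euler i).mem_ball hn) ((h.euler j).mem_ball hl)
      (u := V i n) ((h.euler j).norm_le hT hl)
    calc _ ≤ c.C * (η / (2 * c.C)) + c.C ^ 3 * (η / (2 * c.C ^ 3)) :=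
          e3.trans (by gcongr; exact e1)
      _ = η := by field_simp; norm_num
  obtain ⟨n, hn, h1, h2⟩ := exists_index_of_mem_Icc hT.pos (h.euler i).pos ht
  obtain ⟨l, hl, h3, h4⟩ := exists_index_of_mem_Icc hT.pos (h.euler j).pos ht
  have f1 := h1
  have f2 := h2
  have f3 := h3
  have f4 := h4
  rw [le_div_iff₀ hsi] at f1
  rw [div_le_iff₀ hsi] at f2
  rw [le_div_iff₀ hsj] at f3
  rw [div_le_iff₀ hsj] at f4
  refine norm_sub_le_of_mem_segments (mem_segment_of_le _ h1 h2) (mem_segment_of_le _ h3 h4)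
    (key _ hn.le _ hl.le ?_) (key _ hn.le _ hl ?_) (key _ hn _ hl.le ?_) (key _ hn _ hl ?_) <;>
  · push_cast
    rw [abs_le]
    unfold dyadicStep at *
    push_cast at *
    constructor <;> linarith

end IsEulerSeq

end KatoPair

/-! ### Passage to the limit in the equation -/

section limits

variable {E : Type*} [NormedAddCommGroup E]

theorem exists_uniform_limit [CompleteSpace E] {F : ℕ → ℝ → E} {s : Set ℝ}
    (hF : ∀ η > 0, ∃ J, ∀ i ≥ J, ∀ j ≥ J, ∀ t ∈ s, ‖F i t - F j t‖ ≤ η)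
    (hc : ∀ i, ContinuousOn (F i) s) :
    ∃ p : ℝ → E, ContinuousOn p s ∧ ∀ η > 0, ∃ J, ∀ j ≥ J, ∀ t ∈ s, ‖F j t - p t‖ ≤ η := by
  have hu : UniformCauchySeqOn F atTop s := by
    rw [Metric.uniformCauchySeqOn_iff]
    intro η hη
    obtain ⟨J, hJ⟩ := hF (η / 2) (by positivity)
    exact ⟨J, fun i hi j hj t ht => by
      rw [dist_eq_norm]; exact (hJ i hi j hj t ht).trans_lt (half_lt_self hη)⟩
  have hl : ∀ t, ∃ y, t ∈ s → Tendsto (fun i => F i t) atTop (𝓝 y) := fun t => by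
    by_cases ht : t ∈ s
    · obtain ⟨y, hy⟩ := cauchySeq_tendsto_of_complete (hu.cauchySeq ht)
      exact ⟨y, fun _ => hy⟩
    · exact ⟨0, fun h => absurd h ht⟩
  choose p hp using hl
  have hp' := hu.tendstoUniformlyOn_of_tendsto hp
  refine ⟨p, hp'.continuousOn (Frequently.of_forall hc), fun η hη => ?_⟩
  obtain ⟨J, hJ⟩ := eventually_atTop.1 (Metric.tendstoUniformlyOn_iff.1 hp' η hη)
  exact ⟨J, fun j hj t ht => by
    rw [← dist_eq_norm, dist_comm]; exact (hJ j hj t ht).le⟩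

theorem norm_sub_le_of_uniform_limit {F : ℕ → ℝ → E} {p : ℝ → E} {s : Set ℝ}
    (h : ∀ η > 0, ∃ J, ∀ j ≥ J, ∀ t ∈ s, ‖F j t - p t‖ ≤ η) {t : ℝ} (ht : t ∈ s) {x : E} {d : ℝ}
    (hd : ∀ j, ‖F j t - x‖ ≤ d) : ‖p t - x‖ ≤ d := by
  refine le_of_forall_pos_le_add fun η hη => ?_
  obtain ⟨J, hJ⟩ := h η hη
  have h1 := hJ J le_rfl t ht
  have h2 := norm_sub_le_norm_sub_add_norm_sub (p t) (F J t) x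
  rw [norm_sub_rev (p t) (F J t)] at h2
  linarith [hd J]

variable [NormedSpace ℝ E]

/-- A uniform limit of functions whose right derivatives converge uniformly to a continuous
function. -/
theorem hasDerivWithinAt_of_uniform_limit {q D : ℝ → E} {Q D' : ℕ → ℝ → E} {T : ℝ}
    (hQ : ∀ j, ContinuousOn (Q j) (Icc 0 T))
    (hd : ∀ j, ∀ t ∈ Ico 0 T, HasDerivWithinAt (Q j) (D' j t) (Ici t) t)
    (hq : ∀ η > 0, ∃ J, ∀ j ≥ J, ∀ t ∈ Icc 0 T, ‖Q j t - q t‖ ≤ η)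
    (hD : ∀ η > 0, ∃ J, ∀ j ≥ J, ∀ t ∈ Ico 0 T, ‖D' j t - D t‖ ≤ η)
    (hDc : ContinuousOn D (Icc 0 T)) {t : ℝ} (ht : t ∈ Icc 0 T) :
    HasDerivWithinAt q (D t) (Icc 0 T) t := by
  rw [hasDerivWithinAt_iff_isLittleO, Asymptotics.isLittleO_iff]
  intro ε hε
  obtain ⟨ρ, hρ, h1⟩ := Metric.continuousOn_iff.1 hDc t ht (ε / 2) (by positivity)
  -- The mean value inequality is applied to Q j y - y • D t before the limit in j. Near t its right
  -- derivative is at most ε, half from the uniform convergence and half from the continuity of D.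
  have key : ∀ s ∈ Icc 0 T, ∀ x ∈ Icc s T, dist s t < ρ → dist x t < ρ →
      ‖q x - q s - (x - s) • D t‖ ≤ ε * (x - s) := by
    intro s hs x hx hst hxt
    refine le_of_forall_pos_le_add fun η hη => ?_
    obtain ⟨J1, hJ1⟩ := hq (η / 2) (by positivity)
    obtain ⟨J2, hJ2⟩ := hD (ε / 2) (by positivity)
    set j := max J1 J2
    have e1 := hJ1 j (le_max_left _ _) s hs
    have e2 := hJ1 j (le_max_left _ _) x ⟨hs.1.trans hx.1, hx.2⟩
    have e3 := norm_image_sub_le_of_norm_deriv_right_le_segment (f := fun y => Q j y - y • D t)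
      (f' := fun y => D' j y - D t) (C := ε) (a := s) (b := x)
      (((hQ j).mono (Icc_subset_Icc hs.1 hx.2)).sub (by fun_prop)) (fun y hy => by
        have h2 := hd j y ⟨hs.1.trans hy.1, hy.2.trans_le hx.2⟩
        have h3 := ((hasDerivAt_id y).smul_const (D t)).hasDerivWithinAt (s := Ici y)
        have h4 := h2.sub h3
        rw [one_smul] at h4
        exact h4)
      (fun y hy => by
        have h2 := hJ2 j (le_max_right _ _) y ⟨hs.1.trans hy.1, hy.2.trans_le hx.2⟩
        have h3 := h1 y ⟨hs.1.trans hy.1, hy.2.le.trans hx.2⟩ (by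
          rw [Real.dist_eq, abs_lt] at *
          constructor <;> linarith [hy.1, hy.2])
        rw [dist_eq_norm] at h3
        have h4 := norm_sub_le_norm_sub_add_norm_sub (D' j y) (D y) (D t)
        linarith) x (right_mem_Icc.2 hx.1)
    have e4 : q x - q s - (x - s) • D t = (Q j x - x • D t - (Q j s - s • D t)) -
        (Q j x - q x) + (Q j s - q s) := by rw [sub_smul]; abel
    rw [e4]
    refine (norm_add_le _ _).trans ?_
    have := norm_sub_le (Q j x - x • D t - (Q j s - s • D t)) (Q j x - q x)
    linarith
  filter_upwards [self_mem_nhdsWithin, mem_nhdsWithin_of_mem_nhds (ball_mem_nhds t hρ)] with x hx hxt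
  have htt : dist t t < ρ := by simpa using hρ
  rcases le_total t x with h | h
  · rw [Real.norm_of_nonneg (sub_nonneg.2 h)]
    exact key t ht x ⟨h, hx.2⟩ htt hxt
  · have h2 := key x hx t ⟨h, ht.2⟩ hxt htt
    have h3 : q x - q t - (x - t) • D t = -(q t - q x - (t - x) • D t) := by
      rw [sub_smul, sub_smul]; abel
    rw [Real.norm_of_nonpos (sub_nonpos.2 h), neg_sub, h3, norm_neg]
    exact h2

end limits

namespace KatoPair

variable {Y Z : Type*} [NormedAddCommGroup Y] [NormedSpace ℝ Y]
  [NormedAddCommGroup Z] [NormedSpace ℝ Z] {P : KatoPair Y Z} {c : PairConst}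

theorem IsGood.velocity_sub_le (hP : P.IsGood c) {v u a v' : Z} (hv : P.ι v ∈ ball P.y0 c.δ0)
    (hv' : v' ∈ P.dom c.δ0 c.R0) (hu : ‖u‖ ≤ c.C) :
    ‖P.A (P.ι v) u + P.ι a - (P.A (P.ι v') v' + P.ι (P.f v'))‖ ≤
      c.C ^ 3 * ‖v - v'‖ + c.C * ‖u - v'‖ + ‖P.ι a - P.ι (P.f v')‖ := by
  have hC := c.C_pos
  have e1 := hP.A_lip _ hv _ hv'.1 u
  have e2 := hP.A_norm _ hv'.1 (u - v')
  have e3 : ‖P.ι v - P.ι v'‖ ≤ c.C * ‖v - v'‖ := by rw [← map_sub]; exact hP.norm_ι _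
  have e4 : P.A (P.ι v) u + P.ι a - (P.A (P.ι v') v' + P.ι (P.f v')) =
      (P.A (P.ι v) u - P.A (P.ι v') u) + P.A (P.ι v') (u - v') + (P.ι a - P.ι (P.f v')) := by
    rw [map_sub]; abel
  have e5 : c.C * ‖P.ι v - P.ι v'‖ * ‖u‖ ≤ c.C ^ 3 * ‖v - v'‖ := by
    calc _ ≤ c.C * (c.C * ‖v - v'‖) * c.C := by gcongr
      _ = _ := by ring
  rw [e4]
  refine (norm_add_le _ _).trans (add_le_add_left ((norm_add_le _ _).trans ?_) _)
  linarith

theorem IsGood.f_sub_le (hP : P.IsGood c) {v v' : Z} (hv : v ∈ P.dom c.δ0 c.R0)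
    (hv' : v' ∈ P.dom c.δ0 c.R0) : ‖P.ι (P.f v) - P.ι (P.f v')‖ ≤ c.C ^ 2 * ‖v - v'‖ := by
  have hC := c.C_pos
  have e3 : ‖P.ι v - P.ι v'‖ ≤ c.C * ‖v - v'‖ := by rw [← map_sub]; exact hP.norm_ι _
  calc _ ≤ c.C * ‖P.ι v - P.ι v'‖ := hP.f_lip v hv v' hv'
    _ ≤ c.C * (c.C * ‖v - v'‖) := by gcongr
    _ = _ := by ring

theorem IsGood.continuousOn_velocity (hP : P.IsGood c) {s : Set ℝ} {v : ℝ → Z}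
    (hv : ContinuousOn v s) (hd : ∀ t ∈ s, v t ∈ P.dom c.δ0 c.R0) :
    ContinuousOn (fun t => P.A (P.ι (v t)) (v t) + P.ι (P.f (v t))) s := by
  intro t ht
  rw [ContinuousWithinAt, tendsto_iff_norm_sub_tendsto_zero]
  have h1 := tendsto_iff_norm_sub_tendsto_zero.1 (hv t ht)
  have h2 := h1.const_mul (c.C ^ 3 + c.C + c.C ^ 2)
  rw [mul_zero] at h2
  refine squeeze_zero' (Eventually.of_forall fun _ => norm_nonneg _) ?_ h2
  filter_upwards [self_mem_nhdsWithin] with x hx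
  have e3 := (hd x hx).2
  rw [mem_ball_zero_iff] at e3
  have e4 := hP.velocity_sub_le (a := P.f (v x)) (hd x hx).1 (hd t ht) (e3.le.trans c.R0_le_C)
  have e5 := hP.f_sub_le (hd x hx) (hd t ht)
  linarith

/-- The limit of a convergent sequence of schemes is a solution. -/
theorem IsEulerSeq.exists_isSol [CompleteSpace Z] {T : ℝ} {e : ℕ → ℕ} {V g : ℕ → ℕ → Z} {p : ℝ → Y}
    (h : P.IsEulerSeq c T e V g p) (hP : P.IsGood c) (hT : c.IsTime T)
    (hg : ∀ η > 0, ∃ J, ∀ j ≥ J, ∀ n : ℕ, n < 2 ^ e j → ‖P.ι (g j n) - P.ι (P.f (V j n))‖ ≤ η) :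
    ∃ v, P.IsSol c T v ∧ v 0 = V 0 0 := by
  have hC := c.C_pos; have hTp := hT.pos
  obtain ⟨v, hvc, hv⟩ := exists_uniform_limit (fun η hη => h.cauchy hP hT hη)
    (fun j => ((continuous_interp (V j)).comp (continuous_id.div_const _)).continuousOn)
  have hvι : ∀ η > 0, ∃ J, ∀ j ≥ J, ∀ t ∈ Icc 0 T,
      ‖P.ι (interp (V j) (t / dyadicStep T (e j))) - P.ι (v t)‖ ≤ η := by
    intro η hη
    obtain ⟨J, hJ⟩ := hv (η / c.C) (by positivity)
    refine ⟨J, fun j hj t ht => ?_⟩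
    rw [← map_sub]
    refine (hP.norm_ι _).trans ?_
    have := hJ j hj t ht
    rw [le_div_iff₀ hC] at this
    linarith
  have hdom : ∀ t ∈ Icc 0 T, v t ∈ P.dom c.δ0 c.R0 := by
    intro t ht
    constructor
    · refine mem_ball_of_near (h.euler 0).start (norm_sub_le_of_uniform_limit hvι ht fun j => ?_)
      rw [h.start 0 j]
      exact ((h.euler j).interp_mem hT ht).2
    · have := norm_sub_le_of_uniform_limit hv ht (x := 0) fun j => by
        rw [sub_zero]; exact ((h.euler j).interp_mem hT ht).1
      rw [sub_zero] at this
      simpa using this.trans_lt hT.bound_lt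
  -- The velocity of an interpolant involves both end nodes of the cell of t, so nodal values must
  -- also converge to v t; uniform continuity of v provides this.
  have hnode : ∀ η > 0, ∃ J, ∀ j ≥ J, ∀ n : ℕ, n ≤ 2 ^ e j → ∀ t ∈ Icc 0 T,
      |n * dyadicStep T (e j) - t| ≤ dyadicStep T (e j) → ‖V j n - v t‖ ≤ η := by
    intro η hη
    have huc := isCompact_Icc.uniformContinuousOn_of_continuous hvc
    obtain ⟨ρ, hρ, h1⟩ := Metric.uniformContinuousOn_iff.1 huc (η / 2) (by positivity)
    obtain ⟨J1, hJ1⟩ := hv (η / 2) (by positivity)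
    obtain ⟨J2, hJ2⟩ := h.exists_step_le (show 0 < ρ / 2 by positivity)
    refine ⟨max J1 J2, fun j hj n hn t ht hnt => ?_⟩
    have hs := natCast_mul_dyadicStep_mem hTp hn
    have e1 := hJ1 j ((le_max_left _ _).trans hj) _ hs
    rw [mul_div_cancel_right₀ _ (dyadicStep_pos hTp _).ne', interp_natCast] at e1
    have e2 := hJ2 j ((le_max_right _ _).trans hj)
    have e3 := h1 _ hs t ht (by rw [Real.dist_eq]; linarith)
    rw [dist_eq_norm] at e3
    have := norm_sub_le_norm_sub_add_norm_sub (V j n) (v (n * dyadicStep T (e j))) (v t)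
    linarith
  refine ⟨v, ⟨hdom, hvc, fun t ht => ?_⟩, ?_⟩
  · refine hasDerivWithinAt_of_uniform_limit
      (Q := fun j t => P.ι (interp (V j) (t / dyadicStep T (e j))))
      (D' := fun j t => P.A (P.ι (V j ⌊t / dyadicStep T (e j)⌋₊))
        (V j (⌊t / dyadicStep T (e j)⌋₊ + 1)) + P.ι (g j ⌊t / dyadicStep T (e j)⌋₊))
      (D := fun t => P.A (P.ι (v t)) (v t) + P.ι (P.f (v t)))
      (fun j => ((h.euler j).isPath hP hT).cont) (fun j => ((h.euler j).isPath hP hT).deriv)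
      hvι ?_ ?_ ht
    · intro η hη
      set σ := η / (c.C ^ 3 + c.C + 1 + c.C ^ 2) with hσ
      have hσ0 : 0 < σ := by positivity
      have hση : (c.C ^ 3 + c.C + 1 + c.C ^ 2) * σ = η := by rw [hσ]; field_simp
      obtain ⟨J1, hJ1⟩ := hnode σ hσ0
      obtain ⟨J2, hJ2⟩ := hg σ hσ0
      refine ⟨max J1 J2, fun j hj t ht => ?_⟩
      have hs := dyadicStep_pos hTp (e j)
      have hn := floor_lt_of_mem_Ico (h.euler j).pos ht
      have f1 : (⌊t / dyadicStep T (e j)⌋₊ : ℝ) ≤ t / dyadicStep T (e j) :=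
        Nat.floor_le (div_nonneg ht.1 hs.le)
      have f2 := (Nat.lt_floor_add_one (t / dyadicStep T (e j))).le
      rw [le_div_iff₀ hs] at f1
      rw [div_le_iff₀ hs] at f2
      change ⌊t / dyadicStep T (e j)⌋₊ < 2 ^ e j at hn
      generalize ⌊t / dyadicStep T (e j)⌋₊ = n at *
      have ht' := Ico_subset_Icc_self ht
      have e1 := hJ1 j ((le_max_left _ _).trans hj) n hn.le t ht' (by
        rw [abs_le]; constructor <;> linarith)
      have e2 := hJ1 j ((le_max_left _ _).trans hj) (n + 1) hn t ht' (by
        generalize dyadicStep T (e j) = k at *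
        push_cast
        rw [abs_le]; constructor <;> linarith)
      have e3 := hJ2 j ((le_max_right _ _).trans hj) n hn
      have hd := (h.euler j).mem_dom hT hn.le
      have e4 := hP.velocity_sub_le (a := g j n) hd.1 (hdom t ht')
        ((h.euler j).norm_le hT (n := n + 1) hn)
      have e5 := hP.f_sub_le hd (hdom t ht')
      have e6 := norm_sub_le_norm_sub_add_norm_sub (P.ι (g j n)) (P.ι (P.f (V j n)))
        (P.ι (P.f (v t)))
      have e7 : c.C ^ 3 * ‖V j n - v t‖ ≤ c.C ^ 3 * σ := by gcongr
      have e8 : c.C * ‖V j (n + 1) - v t‖ ≤ c.C * σ := by gcongr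
      have e9 : c.C ^ 2 * ‖V j n - v t‖ ≤ c.C ^ 2 * σ := by gcongr
      linarith
    · exact hP.continuousOn_velocity hvc hdom
  · have := norm_sub_le_of_uniform_limit hv (left_mem_Icc.2 hTp.le) (x := V 0 0) (d := 0)
      fun j => by rw [zero_div, interp_zero, h.start j 0, sub_self, norm_zero]
    exact sub_eq_zero.1 (norm_le_zero_iff.1 this)

end KatoPair

/-! ### Riemann sums and existence -/

section dyadic

variable {E : Type*} [NormedAddCommGroup E]

/-- Riemann sums of the difference of two slowly varying functions are controlled by the integral. -/
theorem riemann_sum_le {T : ℝ} (hT : 0 < T) {k l : ℕ} (hkl : k ≤ l) {F G : ℝ → E}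
    (hF : Continuous F) (hG : Continuous G) {a b : ℝ}
    (ha : ∀ s ∈ Icc 0 T, ∀ t ∈ Icc 0 T, |s - t| ≤ 2 * dyadicStep T l → ‖F s - F t‖ ≤ a)
    (hb : ∀ s ∈ Icc 0 T, ∀ t ∈ Icc 0 T, |s - t| ≤ 2 * dyadicStep T k → ‖G s - G t‖ ≤ b) :
    dyadicStep T l * ∑ n ∈ Finset.range (2 ^ l), ‖F (n * dyadicStep T l) -
      G ((n / 2 ^ (l - k) : ℕ) * dyadicStep T k)‖ ≤ (∫ t in 0..T, ‖F t - G t‖) + T * (a + b) := by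
  have hl := dyadicStep_pos hT l
  have hk : dyadicStep T l ≤ dyadicStep T k := by
    rw [dyadicStep_eq T hkl]
    exact le_mul_of_one_le_left hl.le (by exact_mod_cast Nat.one_le_two_pow)
  have hend : ((2 ^ l : ℕ) : ℝ) * dyadicStep T l = T := mul_div_cancel₀ _ (by positivity)
  have hcont : Continuous fun t => ‖F t - G t‖ + (a + b) := by fun_prop
  have hsum := intervalIntegral.sum_integral_adjacent_intervals (n := 2 ^ l)
    (a := fun n => (n : ℝ) * dyadicStep T l) (μ := MeasureTheory.volume)
    (f := fun t => ‖F t - G t‖ + (a + b)) (fun _ _ => hcont.intervalIntegrable _ _)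
  have htot : (∫ t in 0..T, (‖F t - G t‖ + (a + b))) =
      (∫ t in 0..T, ‖F t - G t‖) + T * (a + b) := by
    rw [intervalIntegral.integral_add ((by fun_prop : Continuous fun t => ‖F t - G t‖)
      |>.intervalIntegrable _ _) (by simp), intervalIntegral.integral_const, sub_zero, smul_eq_mul]
  rw [hend, Nat.cast_zero, zero_mul, htot] at hsum
  rw [← hsum, Finset.mul_sum]
  refine Finset.sum_le_sum fun n hn => ?_
  have hn := Finset.mem_range.1 hn
  obtain ⟨h1, h2, -⟩ := coarse_index hT hkl hn
  have hs := natCast_mul_dyadicStep_mem hT hn.le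
  have hs1 := natCast_mul_dyadicStep_mem hT (n := n + 1) hn
  have hs' := natCast_mul_dyadicStep_mem hT h1.le
  generalize n / 2 ^ (l - k) = n' at *
  have hstep : ((n + 1 : ℕ) : ℝ) * dyadicStep T l - n * dyadicStep T l = dyadicStep T l := by
    push_cast; ring
  have hle : (n : ℝ) * dyadicStep T l ≤ (n + 1 : ℕ) * dyadicStep T l := by linarith
  calc dyadicStep T l * ‖F (n * dyadicStep T l) - G (n' * dyadicStep T k)‖
      = ∫ _ in (n * dyadicStep T l)..((n + 1 : ℕ) * dyadicStep T l),
          ‖F (n * dyadicStep T l) - G (n' * dyadicStep T k)‖ := by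
        rw [intervalIntegral.integral_const, hstep, smul_eq_mul]
    _ ≤ _ := by
        refine intervalIntegral.integral_mono_on hle (by simp) (hcont.intervalIntegrable _ _) ?_
        intro t ht
        have htT : t ∈ Icc 0 T := ⟨hs.1.trans ht.1, ht.2.trans hs1.2⟩
        have e1 := ha _ hs t htT (by rw [abs_le]; constructor <;> linarith [ht.1, ht.2])
        have e2 := hb _ hs' t htT (by
          rw [abs_le] at h2 ⊢
          constructor <;> linarith [ht.1, ht.2])
        have e3 : F (n * dyadicStep T l) - G (n' * dyadicStep T k) =
            (F (n * dyadicStep T l) - F t) + (F t - G t) - (G (n' * dyadicStep T k) - G t) := by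
          abel
        rw [e3]
        refine (norm_sub_le _ _).trans ?_
        have := norm_add_le (F (n * dyadicStep T l) - F t) (F t - G t)
        linarith

/-- A function with small oscillation on the cells of some fine dyadic grid. -/
theorem exists_dyadicStep_osc {T : ℝ} {F : ℝ → E} (hF : Continuous F) {a : ℝ} (ha : 0 < a)
    (j : ℕ) : ∃ k ≥ j, ∀ s ∈ Icc 0 T, ∀ t ∈ Icc 0 T, |s - t| ≤ 2 * dyadicStep T k →
      ‖F s - F t‖ ≤ a := by
  have huc := isCompact_Icc.uniformContinuousOn_of_continuous (hF.continuousOn (s := Icc 0 T))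
  obtain ⟨ρ, hρ, h1⟩ := Metric.uniformContinuousOn_iff.1 huc a ha
  obtain ⟨k, hk1, hk2⟩ := (((KatoPair.tendsto_div_two_pow T).eventually_lt_const
    (show 0 < ρ / 2 by positivity)).and (eventually_ge_atTop j)).exists
  refine ⟨k, hk2, fun s hs t ht hst => ?_⟩
  have := h1 s hs t ht (by rw [Real.dist_eq]; unfold dyadicStep at hst; linarith)
  rw [dist_eq_norm] at this
  exact this.le

end dyadic

namespace KatoPair

variable {Y Z : Type*} [NormedAddCommGroup Y] [NormedSpace ℝ Y]
  [NormedAddCommGroup Z] [NormedSpace ℝ Z] {P : KatoPair Y Z} {c : PairConst}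

/-- Existence of solutions. -/
theorem IsGood.exists_isSol [CompleteSpace Y] [CompleteSpace Z] (hP : P.IsGood c) {T : ℝ}
    (hT : c.IsTime T) {v0 : Z} (hv0 : v0 ∈ P.dom c.δ c.R) : ∃ v, P.IsSol c T v ∧ v 0 = v0 := by
  have hC := c.C_pos; have hM := c.M_pos; have hTp := hT.pos
  -- The schemes `w` for f itself are only known to be Cauchy in Y. They serve to produce the
  -- forcing `G`, Cauchy in L¹(0, T; Z).
  obtain ⟨w, hw1, hw2, hw3⟩ := hP.exists_cauchy_isEuler hT hv0
  obtain ⟨G, hG1, hG2, hG3, hG4⟩ := hP.exists_forcing hT hw1 hw2 hw3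
  -- The grid is chosen after `G j`, whose modulus of continuity in Z is not uniform in j; so
  -- Riemann sums approximate the L¹ distances.
  choose e he1 he2 using fun j : ℕ => exists_dyadicStep_osc (T := T) (hG1 j)
    (Nat.one_div_pos_of_nat (α := ℝ) (n := j)) j
  have hinv : ∀ η > 0, ∃ J : ℕ, ∀ j : ℕ, j ≥ J → 1 / ((j : ℝ) + 1) ≤ η := fun η hη =>
    eventually_atTop.1 (tendsto_one_div_add_atTop_nhds_zero_nat.eventually_le_const hη)
  choose V hV1 hV2 using fun j : ℕ => hP.exists_isEuler hT (N := 2 ^ e j) (by positivity) hv0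
    (fun n _ => G j (n * dyadicStep T (e j)))
    (fun n hn _ _ => hG2 j _ (natCast_mul_dyadicStep_mem hTp hn.le))
  have hstep : ∀ η > 0, ∃ J, ∀ j ≥ J, dyadicStep T j ≤ η ∧ dyadicStep T (e j) ≤ η := by
    intro η hη
    obtain ⟨J, hJ⟩ := eventually_atTop.1 ((tendsto_div_two_pow T).eventually_le_const hη)
    exact ⟨J, fun j hj => ⟨hJ j hj, hJ _ (hj.trans (he1 j))⟩⟩
  -- The new schemes follow the old ones in Y: the values of `G j` are uniformly close there to f
  -- along `w`.
  have hclose : ∀ η > 0, ∃ J, ∀ i ≥ J, ∀ j ≥ J, ∀ t ∈ Icc 0 T,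
      ‖P.ι (interp (V j) (t / dyadicStep T (e j))) - P.ι (interp (w i) (t / dyadicStep T i))‖ ≤
        η := by
    intro η hη
    set D := 16 * c.M ^ 2 * c.cmp c.C c.C (2 * c.C ^ 2) * T with hD
    have hD0 : 0 ≤ D := by
      have hcmp : 0 ≤ c.cmp c.C c.C (2 * c.C ^ 2) := by unfold PairConst.cmp; positivity
      positivity
    set ε := min 1 (η ^ 2 / (D + 1)) with hε
    have hε0 : 0 < ε := lt_min one_pos (by positivity)
    have hDε : D * ε ≤ η ^ 2 := by
      calc D * ε ≤ (D + 1) * (η ^ 2 / (D + 1)) := by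
            gcongr
            · linarith
            · exact min_le_right _ _
        _ = _ := by field_simp
    obtain ⟨J1, hJ1⟩ := hinv (ε / (3 * c.C)) (by positivity)
    obtain ⟨J2, hJ2⟩ := hG4 (ε / 3) (by positivity)
    obtain ⟨J3, hJ3⟩ := hstep (ε / (6 * c.C ^ 3)) (by positivity)
    refine ⟨max J1 (max J2 J3), fun i hi j hj t ht => ?_⟩
    have hj1 : j ≥ J1 := (le_max_left _ _).trans hj
    have hj2 : j ≥ J2 := ((le_max_left _ _).trans (le_max_right _ _)).trans hj
    have hj3 : j ≥ J3 := ((le_max_right _ _).trans (le_max_right _ _)).trans hj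
    have hi2 : i ≥ J2 := ((le_max_left _ _).trans (le_max_right _ _)).trans hi
    have hi3 : i ≥ J3 := ((le_max_right _ _).trans (le_max_right _ _)).trans hi
    have f1 := (hJ3 j hj3).2
    have f2 := (hJ3 i hi3).1
    rw [le_div_iff₀ (by positivity)] at f1 f2
    have hsj := dyadicStep_pos hTp (e j)
    have hsi := dyadicStep_pos hTp i
    have hpow : c.C ^ 2 ≤ c.C ^ 3 := pow_le_pow_right₀ c.one_le_C (by norm_num)
    have hpow' : ∀ {x : ℝ}, 0 < x → x * (6 * c.C ^ 3) ≤ ε → 2 * c.C ^ 2 * x ≤ ε := by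
      intro x hx h
      have : x * c.C ^ 2 ≤ x * c.C ^ 3 := by gcongr
      have : 0 ≤ x * c.C ^ 3 := by positivity
      linarith
    refine (abs_le_of_sq_le_sq' (((hV2 j).compare hP hT (hw2 i) (by rw [hV1, hw1])
      (min_le_left _ _) (hpow' hsj f1) (hpow' hsi f2) ?_ t ht).trans hDε) hη.le).2
    intro t ht
    have ht' := Ico_subset_Icc_self ht
    have hn := floor_lt_of_mem_Ico (hV2 j).pos ht
    have hni := floor_lt_of_mem_Ico (hw2 i).pos ht
    have hs := natCast_mul_dyadicStep_mem hTp hn.le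
    have g1 : (⌊t / dyadicStep T (e j)⌋₊ : ℝ) ≤ t / dyadicStep T (e j) :=
      Nat.floor_le (div_nonneg ht.1 hsj.le)
    have g2 := (Nat.lt_floor_add_one (t / dyadicStep T (e j))).le
    rw [le_div_iff₀ hsj] at g1
    rw [div_le_iff₀ hsj] at g2
    have e1 := he2 j _ hs t ht' (by rw [abs_le]; constructor <;> linarith)
    have e2 : ‖P.ι (G j (⌊t / dyadicStep T (e j)⌋₊ * dyadicStep T (e j))) - P.ι (G j t)‖ ≤
        ε / 3 := by
      rw [← map_sub]
      refine (hP.norm_ι _).trans ?_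
      have := e1.trans (hJ1 j hj1)
      rw [le_div_iff₀ (by positivity)] at this
      linarith
    have e3 := hJ2 j hj2 i hi2 t ht'
    have e4 := hP.f_lip _ ((hw2 i).interp_mem_dom hT ht') _ ((hw2 i).mem_dom hT hni.le)
    have e5 := (hw2 i).interp_sub_floor_le hP hT ht
    rw [norm_sub_rev] at e5
    have e6 : ‖P.ι (P.f (interp (w i) (t / dyadicStep T i))) -
        P.ι (P.f (w i ⌊t / dyadicStep T i⌋₊))‖ ≤ ε / 3 := by
      refine e4.trans ((mul_le_mul_of_nonneg_left e5 hC.le).trans ?_)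
      change c.C * (2 * c.C ^ 2 * dyadicStep T i) ≤ ε / 3
      linarith
    have e7 : 0 ≤ c.C * ‖P.ι (interp (V j) (t / dyadicStep T (e j))) -
        P.ι (interp (w i) (t / dyadicStep T i))‖ := by positivity
    have e8 : ‖P.ι (G j (⌊t / dyadicStep T (e j)⌋₊ * dyadicStep T (e j))) -
        P.ι (P.f (w i ⌊t / dyadicStep T i⌋₊))‖ ≤ ε := by
      have := norm_sub_le_norm_sub_add_norm_sub
        (P.ι (G j (⌊t / dyadicStep T (e j)⌋₊ * dyadicStep T (e j)))) (P.ι (G j t))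
        (P.ι (P.f (w i ⌊t / dyadicStep T i⌋₊)))
      have := norm_sub_le_norm_sub_add_norm_sub (P.ι (G j t))
        (P.ι (P.f (interp (w i) (t / dyadicStep T i)))) (P.ι (P.f (w i ⌊t / dyadicStep T i⌋₊)))
      linarith
    exact e8.trans (le_add_of_nonneg_left e7)
  obtain ⟨p, hpc, hp⟩ := exists_uniform_limit
    (F := fun j t => P.ι (interp (V j) (t / dyadicStep T (e j)))) (s := Icc 0 T)
    (fun η hη => by
      obtain ⟨J, hJ⟩ := hclose (η / 2) (by positivity)
      refine ⟨J, fun i hi j hj t ht => ?_⟩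
      have e1 := hJ J le_rfl i hi t ht
      have e2 := hJ J le_rfl j hj t ht
      rw [norm_sub_rev] at e2
      refine (norm_sub_le_norm_sub_add_norm_sub _ _ _).trans ((add_le_add e1 e2).trans ?_)
      linarith)
    (fun j => ((hV2 j).isPath hP hT).cont)
  have hseq : P.IsEulerSeq c T e V (fun j n => G j (n * dyadicStep T (e j))) p := by
    refine ⟨fun i j => by rw [hV1, hV1], hV2, he1, hpc, ?_, hp, ?_⟩
    · intro t ht
      refine mem_ball_of_near (hV2 0).start (norm_sub_le_of_uniform_limit hp ht fun j => ?_)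
      rw [hV1 0, ← hV1 j]
      exact ((hV2 j).interp_mem hT ht).2
    · intro η hη
      obtain ⟨J1, hJ1⟩ := hG3 (η / 2) (by positivity)
      obtain ⟨J2, hJ2⟩ := hinv (η / (4 * T)) (by positivity)
      refine ⟨max J1 J2, fun i hi j hj hij => ?_⟩
      have e1 := hJ1 j ((le_max_left _ _).trans hj) i ((le_max_left _ _).trans hi)
      have e2 := hJ2 j ((le_max_right _ _).trans hj)
      have e3 := hJ2 i ((le_max_right _ _).trans hi)
      rw [le_div_iff₀ (by positivity)] at e2 e3
      refine (riemann_sum_le hTp hij (hG1 j) (hG1 i) (he2 j) (he2 i)).trans ?_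
      linarith
  -- The prescribed forcing must match f along `V` in Y only: `G j` is close to f along `w`, and f
  -- is Lipschitz in Y.
  obtain ⟨v, hv1, hv2⟩ := hseq.exists_isSol hP hT fun η hη => by
    obtain ⟨J1, hJ1⟩ := hG4 (η / 2) (by positivity)
    obtain ⟨J2, hJ2⟩ := hclose (η / (2 * c.C)) (by positivity)
    refine ⟨max J1 J2, fun j hj n hn => ?_⟩
    have hj1 := (le_max_left _ _).trans hj
    have hj2 := (le_max_right _ _).trans hj
    have hs := natCast_mul_dyadicStep_mem hTp hn.le
    have e1 := hJ1 j hj1 j hj1 _ hs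
    have e2 := hJ2 j hj2 j hj2 _ hs
    rw [← IsEulerSeq.ι_eq_interp hTp, norm_sub_rev, le_div_iff₀ (by positivity)] at e2
    have e3 := hP.f_lip _ ((hw2 j).interp_mem_dom hT hs) _ ((hV2 j).mem_dom hT hn.le)
    refine (norm_sub_le_norm_sub_add_norm_sub _ _ _).trans ((add_le_add e1 e3).trans ?_)
    change η / 2 + c.C * ‖P.ι (interp (w j) (n * dyadicStep T (e j) / dyadicStep T j)) - _‖ ≤ η
    linarith
  exact ⟨v, hv1, by rw [hv2, hV1]⟩

end KatoPair

/-! ### Reduction of the theorem to the pair -/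

namespace QLConst

variable (c : QLConst)

/-- A common bound for all constants. -/
noncomputable def total (m : ℕ) : ℝ :=
  c.CL * c.CQ ^ m + c.CQ + c.C0 + c.Cf0 + c.Cf1 + |c.R0| + |c.CE| + c.growth m + c.formLip m

/-- Bound for the reciprocal of the step size in the resolvent estimate. -/
noncomputable def resConst (m : ℕ) : ℝ :=
  c.growth m + 4 * (c.CL * c.CQ ^ m) ^ 2 * c.CQ ^ 3 * c.C0

theorem resConst_pos (m : ℕ) : 0 < c.resConst m := by
  have := c.CL_pos; have := c.CQ_pos; have := c.C0_pos; have := c.growth_nonneg m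
  unfold resConst; positivity

theorem le_total (m : ℕ) : c.CL * c.CQ ^ m ≤ c.total m ∧ c.CQ ≤ c.total m ∧ c.C0 ≤ c.total m ∧
    c.Cf0 ≤ c.total m ∧ c.Cf1 ≤ c.total m ∧ c.R0 ≤ c.total m ∧ c.CE ≤ c.total m ∧
    c.growth m ≤ c.total m ∧ c.formLip m ≤ c.total m := by
  have := c.CL_pos; have h2 := c.CQ_pos; have := c.C0_pos; have := c.growth_nonneg m
  have := c.formLip_nonneg m; have := c.Cf0_pos; have := c.Cf1_pos
  have := abs_nonneg c.R0; have := abs_nonneg c.CE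
  have := le_abs_self c.R0; have := le_abs_self c.CE
  have : 0 < c.CL * c.CQ ^ m := by positivity
  unfold total
  refine ⟨?_, ?_, ?_, ?_, ?_, ?_, ?_, ?_, ?_⟩ <;> linarith

/-- The constants for the pair `X^k ⊆ X^{k-1}`. -/
noncomputable def pair (m : ℕ) (δ R : ℝ) (hδ0 : δ < c.δ0) (hR0 : 0 < R)
    (hR : R < (c.CL ^ 2)⁻¹ * (c.CQ ^ (2 * (m + 1)))⁻¹ * c.R0) : PairConst where
  M := c.CL * c.CQ ^ m
  q := c.CQ
  C := c.total m
  δ0 := c.δ0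
  δ := δ
  R := R
  R0 := c.R0
  h0 := 1 / 2 / c.resConst m
  one_le_M := one_le_mul_of_one_le_of_one_le c.one_le_CL (one_le_pow₀ c.one_le_CQ)
  M_le_C := (c.le_total m).1
  one_le_q := c.one_le_CQ
  q_le_C := (c.le_total m).2.1
  δ_lt := hδ0
  R_pos := hR0
  R_lt := by
    have := c.CL_pos; have := c.CQ_pos
    rw [← mul_inv, ← div_eq_inv_mul, lt_div_iff₀ (by positivity)] at hR
    refine lt_of_eq_of_lt ?_ hR
    ring
  R0_le_C := (c.le_total m).2.2.2.2.2.1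
  h0_pos := div_pos one_half_pos (c.resConst_pos m)

end QLConst

namespace QLData

variable {X : ℕ → Type u} [∀ r, NormedAddCommGroup (X r)] [∀ r, NormedSpace ℝ (X r)] {m : ℕ}

/-- The equation in the pair `X^k ⊆ X^{k-1}`. -/
noncomputable def pair (D : QLData X m) (S : DenseScale X) (B : X m → (X (m + 1) →L[ℝ] X m)) :
    KatoPair (X m) (X (m + 1)) where
  y0 := S.incl m D.vs
  ι := S.incl m
  A := D.Ab m
  ℓ := fun v => D.form v m
  Q := D.Q m
  B := B
  f := D.f

variable {S : DenseScale X} {D : QLData X m} {c : QLConst} {δ R : ℝ}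

/-- The top level r = m of the scale supplies the pair. All its constants come from `c`, `m`, δ and
R, so the time of existence does not depend on the spaces. -/
theorem pair_isGood [∀ r, CompleteSpace (X r)] (hδ0 : δ < c.δ0) (hR0 : 0 < R)
    (hR : R < (c.CL ^ 2)⁻¹ * (c.CQ ^ (2 * (m + 1)))⁻¹ * c.R0) (hE : ‖S.incl m‖ ≤ c.CE)
    (h1 : D.H1 S c) (h2 : D.H2 S c) (h3 : D.H3 S c) (h4 : D.H4 S c)
    {B : X m → (X (m + 1) →L[ℝ] X m)} (hBc : ContinuousOn B (D.ballLow S c.δ0))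
    (hB : ∀ v ∈ D.ballLow S c.δ0, D.IsCommutator S m v (B v) ∧ ‖B v‖ ≤ c.C0) :
    (D.pair S B).IsGood (c.pair m δ R hδ0 hR0 hR) := by
  obtain ⟨t1, t2, t3, t4, t5, t6, t7, t8, t9⟩ := c.le_total m
  have hform : ∀ v ∈ D.ballLow S c.δ0, EquivForm (D.form v m) (c.CL * c.CQ ^ m) :=
    fun v hv => equivForm h1 h3 hv le_rfl
  have hC0 := c.C0_pos
  refine
    { denseRange := S.denseRange m
      norm_ι := (S.incl m).le_of_opNorm_le (hE.trans t7)
      form := hform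
      form_lip := fun v hv v' hv' x y => (form_lipschitz h1 h3 hv hv' le_rfl x y).trans (by
        change _ ≤ c.total m * ‖v - v'‖ * ‖x‖ * ‖y‖
        gcongr)
      A_norm := fun v hv => (D.Ab m v).le_of_opNorm_le ((h2.norm_le m le_rfl v hv).trans t3)
      A_lip := fun v hv v' hv' => (D.Ab m v - D.Ab m v').le_of_opNorm_le
        ((h2.lipschitz m le_rfl v hv v' hv').trans (by
          change _ ≤ c.total m * ‖v - v'‖
          gcongr))
      diss := fun v hv w => (dissipative h1 h2 h3 hv le_rfl w).trans
        (mul_le_mul_of_nonneg_right t8 ((hform v hv).nonneg _))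
      Q_norm := fun v hv => h3.norm_apply_le le_rfl hv
      Q_inv := fun v hv => h3.norm_le_apply le_rfl hv
      Q_contDiff := h3.contDiffOn m le_rfl
      Q_lip := fun v hv v' hv' w => (h3.lipschitz le_rfl hv hv' w).trans (by
        change _ ≤ c.total m * ‖v - v'‖ * ‖w‖
        gcongr)
      fderiv_Q := fun v hv => (h3.fderiv_le m le_rfl v hv).trans t3
      B_cont := hBc
      B_norm := fun v hv => (B v).le_of_opNorm_le ((hB v hv).2.trans t3)
      resolvent := ?_
      f_cont := h4.continuousOn
      f_norm := fun v hv => (h4.norm_le v hv).trans t4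
      f_lip := fun v hv v' hv' => (h4.lipschitz v hv v' hv').trans
        (mul_le_mul_of_nonneg_right t5 (norm_nonneg _)) }
  intro v hv h h0 hh g
  have hL := c.CL_pos; have hQ := c.CQ_pos
  have hg := c.growth_nonneg m
  have hh' : h * c.resConst m ≤ 1 / 2 := by
    rwa [← le_div_iff₀ (c.resConst_pos m)]
  have hK : 0 ≤ h * (4 * (c.CL * c.CQ ^ m) ^ 2 * c.CQ ^ 3 * c.C0) := by positivity
  have hG : 0 ≤ h * c.growth m := by positivity
  rw [QLConst.resConst, mul_add] at hh'
  have hω : h * c.growth m ≤ 1 / 2 := by linarith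
  have hs : h * (4 * (c.CL * c.CQ ^ m) ^ 2 * c.CQ ^ 3 * c.C0) ≤ 1 / 2 := by linarith
  obtain ⟨J, hJ1, -, hJ3⟩ := exists_resolvent_of_denseRange h1 h2 h3 le_rfl hv (hB v hv).1
    (hB v hv).2 h0 hω hs (denseRange_sub_smul_Ab h1 h2 h3 hv h0 hω hs le_rfl)
  refine ⟨J g, hJ1 g, fun g' u' hu' => (mul_le_mul_of_nonneg_right ?_
    (EquivForm.formNorm_nonneg _ _)).trans (hJ3 g g' u' hu')⟩
  have : h * c.growth m ≤ h * c.total m := by gcongr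
  change 1 - h * c.total m ≤ _
  linarith

end QLData

theorem theoremT (m : ℕ) (c : QLConst) (δ R : ℝ) (hδ : 0 < δ) (hδ0 : δ < c.δ0)
    (hR : R < (c.CL ^ 2)⁻¹ * (c.CQ ^ (2 * (m + 1)))⁻¹ * c.R0) :
    ∃ T : ℝ, 0 < T ∧
      ∀ (X : ℕ → Type u) [∀ r, NormedAddCommGroup (X r)] [∀ r, NormedSpace ℝ (X r)]
        [∀ r, CompleteSpace (X r)] (S : DenseScale X) (D : QLData X m),
        (∀ r ≤ m, ‖S.incl r‖ ≤ c.CE) → ‖D.vs‖ < R →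
        D.H1 S c → D.H2 S c → D.H3 S c → D.H4 S c →
        (∀ v0 ∈ D.dom S δ R, ∃ v : ℝ → X (m + 1), D.IsSolution S c T v0 v ∧
          ∀ v' : ℝ → X (m + 1), D.IsSolution S c T v0 v' → EqOn v' v (Icc 0 T)) ∧
        ∀ v01 ∈ D.dom S δ R, ∀ v02 ∈ D.dom S δ R, ∀ v1 v2 : ℝ → X (m + 1),
          D.IsSolution S c T v01 v1 → D.IsSolution S c T v02 v2 →
          ∀ t ∈ Icc 0 T, ‖S.incl m (v2 t) - S.incl m (v1 t)‖ ≤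
            4 * c.CL ^ 2 * c.CQ ^ (2 * m) * ‖S.incl m v02 - S.incl m v01‖ := by
  -- For R ≤ 0 no centre with ‖v_*‖ < R exists.
  rcases le_or_gt R 0 with hR0 | hR0
  · exact ⟨1, one_pos, fun X _ _ _ S D _ hvs =>
      absurd (hvs.trans_le hR0) (norm_nonneg _).not_gt⟩
  obtain ⟨T, hT⟩ := (c.pair m δ R hδ0 hR0 hR).exists_isTime
  refine ⟨T, hT.pos, fun X _ _ _ S D hE _ h1 h2 h3 h4 => ?_⟩
  obtain ⟨B, hBc, hB⟩ := h3.commutator m le_rfl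
  have hP := QLData.pair_isGood hδ0 hR0 hR (hE m le_rfl) h1 h2 h3 h4 hBc hB
  have hsol : ∀ {v0 : X (m + 1)} {v : ℝ → X (m + 1)}, D.IsSolution S c T v0 v →
      (D.pair S B).IsSol (c.pair m δ R hδ0 hR0 hR) T v := fun h =>
    ⟨h.mem_dom, h.continuousOn, h.equation⟩
  have hlip : ∀ {v01 v02 : X (m + 1)} {v1 v2 : ℝ → X (m + 1)},
      D.IsSolution S c T v01 v1 → D.IsSolution S c T v02 v2 →
      ∀ t ∈ Icc 0 T, ‖S.incl m (v2 t) - S.incl m (v1 t)‖ ≤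
        4 * c.CL ^ 2 * c.CQ ^ (2 * m) * ‖S.incl m v02 - S.incl m v01‖ := by
    intro v01 v02 v1 v2 hv1 hv2 t ht
    have key := KatoPair.IsSol.compare hP hT (hsol hv1) (hsol hv2) t ht
    rw [hv1.initial, hv2.initial] at key
    refine key.trans_eq ?_
    change 4 * (c.CL * c.CQ ^ m) ^ 2 * ‖S.incl m v02 - S.incl m v01‖ = _
    ring
  refine ⟨fun v0 hv0 => ?_, fun v01 _ v02 _ v1 v2 hv1 hv2 => hlip hv1 hv2⟩
  obtain ⟨v, hv, hv00⟩ := hP.exists_isSol hT (v0 := v0) hv0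
  have hv' : D.IsSolution S c T v0 v := by
    have hu := uniqueDiffOn_Icc hT.pos
    refine ⟨hv.mem_dom, hv.continuousOn, ?_, hv00, hv.equation⟩
    -- The C¹ property is the continuity in Y of the right-hand side of the equation along v.
    rw [contDiffOn_one_iff_derivWithin hu]
    exact ⟨fun t ht => (hv.equation t ht).differentiableWithinAt,
      (hP.continuousOn_velocity hv.continuousOn hv.mem_dom).congr fun t ht =>
        (hv.equation t ht).derivWithin (hu t ht)⟩
  -- Uniqueness is the Lipschitz estimate with equal initial values, together with injectivity of
  -- the embedding.
  refine ⟨v, hv', fun w hw t ht => S.injective m (sub_eq_zero.1 ?_)⟩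
  have := hlip hv' hw t ht
  rw [sub_self, norm_zero, mul_zero] at this
  exact norm_le_zero_iff.1 this
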